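/- A plane binary tree is a finite tree embedded in the plane, considered up to isotopy, whose vertices are properly coloured white and black. Let $\alpha$ and $\beta$ be the permutations of its $n$ edges that send each edge to the next one in counterclockwise order around its white, respectively black, end. The rotation group of the tree is $\langle\alpha,\beta\rangle\subseteq S_n$ (defined up to conjugation). Its automorphisms are the permutations of the edges commuting with $\alpha$ and $\beta$, and the tree is $k$-symmetric if its automorphism group is nontrivial of order $k$. The tree is special if its rotation group is primitive of order less than $n!/2$. The type $\langle a_1,\dots,a_m\,|\,b_1,\dots,b_r\rangle$ is the set of all plane binary trees with white valencies $a_1,\dots,a_m$ and black valencies $b_1,\dots,b_r$. A Shabat polynomial is a polynomial $p\in\mathbb C[z]$ whose set of finite critical values is $\{0,1\}$. It is a Shabat polynomial of the tree $p^{-1}[0,1]$, whose white vertices are the preimages of $0$ and whose black vertices are the preimages of $1$. More generally, a polynomial $P\in\mathbb Q[z]$ with finite critical values $0$ and $c\in\mathbb Q\setminus\{0\}$ is called a Shabat polynomial of the tree of $P/c$. The Galois orbit of a tree $T$ is the set of the trees of all $\gamma(p)$, where $p$ is a Shabat polynomial of $T$ with algebraic coefficients and $\gamma\in\mathrm{Gal}(\overline{\mathbb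 Q}/\mathbb Q)$ acts on the coefficients; an orbit with $k$ elements is a Galois $k$-orbit. The definition field of $T$ is the smallest field over which some Shabat polynomial of $T$ (with critical values $0,1$) is defined; $T$ is rational if this field is $\mathbb Q$. For two different elements $k,l$ of $\{1,2,3,1',2',3'\}$ let $D(k,l)$ be the following ten-edge tree. Two white vertices $u,u'$ of valency 4 are joined through a black vertex $v$ of valency 2. The other edges at $u$, in counterclockwise order starting from $uv$, are $1,2,3$, and the other edges at $u'$, in counterclockwise order starting from $u'v$, are $1',2',3'$. One white leaf is attached to the black end of the edge $k$ and one to the black end of the edge $l$. **Theorem.** The type $\langle 4,4,1,1\,|\,2,2,2,1,1,1,1\rangle$ contains exactly nine trees. It is the disjoint union of the following three Galois orbits. - Exactly three of the trees are 2-symmetric, namely $D(1,1')$, $D(2,2')$ and $D(3,3')$. They form a Galois 3-orbit, and the rotation group of each of them has order 3840. - The tree $D(1,3)$ is rational, with Shabat polynomial $$\left(x^2-\tfrac{500}{441}\right)^4\left(x^2+\tfrac{500}{189}x+\tfrac{500}{189}\right),$$ and forms a Galois 1-orbit. It is special: its rotation group is primitive, of order $1440<10!/2$. - The remaining five trees form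 a Galois 5-orbit, and the rotation group of each of them is $S_{10}$. -/

import Mathlib

open Polynomial Filter Topology

/-- A plane binary tree with `n` edges (numbered by `Fin n`), given by its rotation system:
`white` (resp. `black`) sends an edge to the next edge in counterclockwise order around its white
(resp. black) end. The white (black) vertices are the cycles of `white` (`black`), fixed points
included; their lengths are the valencies. The bipartite graph so described is
connected and has one vertex more than it has edges, that is, it is a tree. -/
structure PlaneTree (n : ℕ) where
  white : Equiv.Perm (Fin n)
  black : Equiv.Perm (Fin n)
  connected : MulAction.IsPretransitive (Subgroup.closure {white, black}) (Fin n)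
  card_vertices : white.partition.parts.card + black.partition.parts.card = n + 1

namespace PlaneTree

variable {n : ℕ}

/-- The list of valencies of the white vertices. -/
def whiteValencies (T : PlaneTree n) : Multiset ℕ := T.white.partition.parts

/-- The list of valencies of the black vertices. -/
def blackValencies (T : PlaneTree n) : Multiset ℕ := T.black.partition.parts

/-- The rotation group `⟨a, b⟩ ⊆ S_n`. -/
def rotationGroup (T : PlaneTree n) : Subgroup (Equiv.Perm (Fin n)) :=
  Subgroup.closure {T.white, T.black}

/-- The automorphisms: permutations of the edges that commute with both rotations. -/
def aut (T : PlaneTree n) : Subgroup (Equiv.Perm (Fin n)) :=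
  Subgroup.centralizer {T.white, T.black}

/-- `T` is `k`-symmetric: its automorphism group is nontrivial of order `k`. -/
def IsSymmetric (T : PlaneTree n) (k : ℕ) : Prop :=
  1 < k ∧ Nat.card T.aut = k

/-- A special tree: its rotation group is primitive, of order less than `n! / 2`. -/
def IsSpecial (T : PlaneTree n) : Prop :=
  MulAction.IsPreprimitive T.rotationGroup (Fin n) ∧
    2 * Nat.card T.rotationGroup < n.factorial

/-- Isotopy of plane binary trees: the edges are matched so that both rotations are respected. -/
def Isotopic (T T' : PlaneTree n) : Prop :=
  ∃ σ : Equiv.Perm (Fin n),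
    (∀ i, σ (T.white i) = T'.white (σ i)) ∧ ∀ i, σ (T.black i) = T'.black (σ i)

instance setoid (n : ℕ) : Setoid (PlaneTree n) where
  r := Isotopic
  iseqv :=
    { refl := fun _ => ⟨1, fun _ => rfl, fun _ => rfl⟩
      symm := by
        rintro T T' ⟨σ, hw, hb⟩
        refine ⟨σ⁻¹, fun i => ?_, fun i => ?_⟩
        · rw [Equiv.Perm.inv_eq_iff_eq, hw]
          simp
        · rw [Equiv.Perm.inv_eq_iff_eq, hb]
          simp
      trans := by
        rintro T T' T'' ⟨σ, hw, hb⟩ ⟨τ, hw', hb'⟩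
        refine ⟨τ * σ, fun i => ?_, fun i => ?_⟩
        · rw [Equiv.Perm.mul_apply, hw, hw', Equiv.Perm.mul_apply]
        · rw [Equiv.Perm.mul_apply, hb, hb', Equiv.Perm.mul_apply] }

end PlaneTree

/-- Plane binary trees with `n` edges, two trees being the same if they are isotopic. -/
abbrev TreeClass (n : ℕ) : Type := Quotient (PlaneTree.setoid n)

/-- The type `⟨A | B⟩`: the set of all trees with white valencies `A` and black valencies `B`. -/
def treeType (n : ℕ) (A B : Multiset ℕ) : Set (TreeClass n) :=
  {x | ∃ T : PlaneTree n, ⟦T⟧ = x ∧ T.whiteValencies = A ∧ T.blackValencies = B}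

/-- A Shabat polynomial: its critical values (in `ℂ`) are exactly `0` and `1`. -/
def IsShabat (p : ℂ[X]) : Prop :=
  (fun z => p.eval z) '' {z | p.derivative.eval z = 0} = {0, 1}

/-- The edges of the plane tree `p⁻¹[0,1]`: the arcs which `p` maps homeomorphically onto `[0,1]`,
each of them parametrized by the value of `p`. The white end of the edge `s` is `s 0`,
a preimage of `0`, and its black end is `s 1`, a preimage of `1`. -/
def ShabatEdge (p : ℂ[X]) : Type :=
  {s : C(unitInterval, ℂ) // ∀ t, p.eval (s t) = ((t : ℝ) : ℂ)}

/-- Let `s` and `s'` be edges with the same end `v` at parameter `a` (`a = 0` for a white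
and `a = 1` for a black vertex). At `v`, the angle from `s` to `s'`, measured
counterclockwise, is `θ` (modulo `2π`). -/
def HasAngle {p : ℂ[X]} (a : unitInterval) (s s' : ShabatEdge p) (θ : ℝ) : Prop :=
  Tendsto (fun t : unitInterval =>
      ((Complex.arg ((s'.1 t - s.1 a) / (s.1 t - s.1 a)) : ℝ) : Real.Angle))
    (𝓝[≠] a) (𝓝 (θ : Real.Angle))

/-- `s'` is the next edge after `s` in counterclockwise order around the end of `s` at
parameter `a`: it has the same end, and it is the first edge with this end that is met when `s` is
turned counterclockwise about it (`s` itself, after a full turn, if there is no other). -/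
def IsNextEdge {p : ℂ[X]} (a : unitInterval) (s s' : ShabatEdge p) : Prop :=
  s'.1 a = s.1 a ∧ ∃ θ : ℝ, 0 < θ ∧ θ ≤ 2 * Real.pi ∧ HasAngle a s s' θ ∧
    ∀ s'' : ShabatEdge p, s''.1 a = s.1 a →
      ∀ φ : ℝ, 0 < φ → φ < θ → ¬ HasAngle a s s'' φ

/-- The plane binary tree `p⁻¹[0,1]` is (isotopic to) `T`: the edges of `p⁻¹[0,1]` can be
numbered so that the counterclockwise rotations around its white and black vertices
are those of `T`. -/
def IsTreeOf {n : ℕ} (p : ℂ[X]) (T : PlaneTree n) : Prop :=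
  ∃ e : Fin n ≃ ShabatEdge p,
    (∀ i, IsNextEdge 0 (e i) (e (T.white i))) ∧ ∀ i, IsNextEdge 1 (e i) (e (T.black i))

/-- The set of all Shabat polynomials `p` with `p⁻¹[0,1] = x`. -/
def shabatPolynomials {n : ℕ} (x : TreeClass n) : Set ℂ[X] :=
  {p | IsShabat p ∧ ∃ T : PlaneTree n, ⟦T⟧ = x ∧ IsTreeOf p T}

/-- The field of algebraic numbers. -/
abbrev AlgNum : Type := algebraicClosure ℚ ℂ

/-- The Galois orbit of a tree: the trees of all the polynomials `γ(p)`, where `p` is a Shabat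
polynomial of the tree with algebraic coefficients and `γ` is an element of the
absolute Galois group of `ℚ`, acting on the coefficients. -/
def galoisOrbit {n : ℕ} (x : TreeClass n) : Set (TreeClass n) :=
  {y | ∃ (γ : AlgNum ≃ₐ[ℚ] AlgNum) (p : AlgNum[X]),
    p.map (algebraMap AlgNum ℂ) ∈ shabatPolynomials x ∧
    (p.map (γ : AlgNum →+* AlgNum)).map (algebraMap AlgNum ℂ) ∈ shabatPolynomials y}

/-- `O` is a Galois orbit of cardinality `k`. -/
def IsGaloisOrbit {n : ℕ} (O : Set (TreeClass n)) (k : ℕ) : Prop :=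
  O.Nonempty ∧ O.ncard = k ∧ ∀ x ∈ O, galoisOrbit x = O

/-- `K` is the definition field of the tree `x`: the smallest field over which
some Shabat polynomial of `x` is defined. -/
def IsDefinitionField {n : ℕ} (K : IntermediateField ℚ ℂ) (x : TreeClass n) : Prop :=
  IsLeast {L : IntermediateField ℚ ℂ |
    ∃ p : L[X], p.map (algebraMap L ℂ) ∈ shabatPolynomials x} K

/-- A tree is rational if its definition field is `ℚ`. -/
def IsRationalTree {n : ℕ} (x : TreeClass n) : Prop :=
  IsDefinitionField ⊥ x

/-- The polynomial `P`, with finite critical values `0` and some nonzero rational number `c`,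
is a Shabat polynomial of the tree `x` after normalization, i.e. `P / c` is. -/
def IsRationalShabatPolynomial {n : ℕ} (P : ℚ[X]) (x : TreeClass n) : Prop :=
  ∃ c : ℚ, c ≠ 0 ∧ (C c⁻¹ * P).map (algebraMap ℚ ℂ) ∈ shabatPolynomials x

/-- The following ten-edge tree. Two white vertices `u`, `u'` of valency 4 are joined through a
black vertex `v` of valency 2. The edges at `u`, in counterclockwise order from `uv`, are
`0, 1, 2, 3`, and those at `u'`, in counterclockwise order from `u'v`, are `4, 5, 6, 7`. A white leaf
is attached (by the edge `8`) to the black end of the edge `k`, another one (by the edge `9`)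
to the black end of the edge `l`. -/
def IsDoubleStar (k l : Fin 10) (x : TreeClass 10) : Prop :=
  ∃ T : PlaneTree 10, ⟦T⟧ = x ∧ T.white = c[0, 1, 2, 3] * c[4, 5, 6, 7] ∧
    T.black = Equiv.swap 0 4 * Equiv.swap k 8 * Equiv.swap l 9

/-! The theorem is proved by listing the trees, listing explicit polynomials, and matching the two
lists by counting.

Combinatorics (`isotopic_repTree`, `rep_rigid`): a tree of this type consists of two white stars of
valency 4 joined through a black vertex, with two white leaves hung on two of the six free edges. Of
the 15 choices, 3 are fixed by the half turn, so there are (15 + 3)/2 = 9 trees, all of the form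
D(k, l), and only those 3 have a nontrivial automorphism.

Algebra: with the quadruple white points at 1 and -1, the numerator is P = (x² - 1)⁴ (x² + 10βx +
(5g + 1)/4), and P' = 10 (x² - 1)³ (x³ + 9βx² + gx - β). That P minus a constant be divisible by the
square of this cubic amounts to the two equations `Valid β g`. Elimination leaves two cases: β = 0
with g a root of a cubic, or β ≠ 0 with (3g - 5) times a quintic in g equal to 0. In both, β² is
determined by g. Since β ↦ -β is x ↦ -x, the tree depends on g alone, and g takes 3 + 1 + 5 = 9
values.

Topology: off {0, 1} a Shabat polynomial is a covering, and its edges continue to holomorphic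
branches on a slit plane which are permuted by the two rotations. For a family of branches permuted
by continuation around 0 and 1, the elementary symmetric functions are single-valued with removable
singularities and controlled growth, so they are affine in t (`HasMonodromy.coeff_eq_affine`). A
family of fewer than n branches would therefore be constant, which gives connectedness and hence a
tree for each polynomial (`exists_isTreeOf`). For two polynomials with the same tree, f_i - a g_i is
constant for a suitable a, so the polynomials are affinely equivalent (`exists_comp_of_isTreeOf`).

Matching: different g give different trees (`HasParam.param_unique`), and no existence theorem for a
polynomial with a given tree is needed, because nine parameters exhaust nine trees. If β = 0 the
polynomial is even, so the tree is symmetric. If g = 5/3 then β is real, and complex conjugation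
gives a reflection fixing both quadruple points, which leaves only D(1,3) once the symmetric trees
are used up. The quintic takes the remaining five trees.

Galois orbits are read off from g (`mem_galoisOrbit_iff`): the cubic is irreducible by Eisenstein at
5, the quintic because it is so modulo 11. The rotation groups come from stabilizer chains:
10·8·6·4·2 for permutations commuting with the half turn, and 10·9·8·2 for a group preserving an
inversive plane. For the last five trees, a 10-cycle and a suitable transposition generate S₁₀. -/

/-! ### Sections of a polynomial over slit planes -/

namespace Shabat

/-- The plane slit along `(-∞, 0]` and `[1, ∞)`. -/
def midDomain : Set ℂ := {t | t.im ≠ 0 ∨ (0 < t.re ∧ t.re < 1)}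

/-- The plane slit along `[0, ∞)`. -/
def leftDomain : Set ℂ := {t | t.im ≠ 0 ∨ t.re < 0}

/-- The plane slit along `(-∞, 1]`. -/
def rightDomain : Set ℂ := {t | t.im ≠ 0 ∨ 1 < t.re}

/-- `f` is a continuous branch of the inverse of `p` over `V`. -/
structure IsSection (p : ℂ[X]) (V : Set ℂ) (f : ℂ → ℂ) : Prop where
  continuousOn : ContinuousOn f V
  eval_eq : ∀ t ∈ V, p.eval (f t) = t

theorem IsSection.mono {p : ℂ[X]} {V W : Set ℂ} {f : ℂ → ℂ} (hf : IsSection p V f) (h : W ⊆ V) :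
    IsSection p W f :=
  ⟨hf.continuousOn.mono h, fun t ht => hf.eval_eq t (h ht)⟩

theorem isOpen_im_ne : IsOpen {t : ℂ | t.im ≠ 0} :=
  isOpen_ne_fun Complex.continuous_im continuous_const

theorem isOpen_midDomain : IsOpen midDomain :=
  isOpen_im_ne.union ((isOpen_lt continuous_const Complex.continuous_re).inter
    (isOpen_lt Complex.continuous_re continuous_const))

theorem isOpen_leftDomain : IsOpen leftDomain :=
  isOpen_im_ne.union (isOpen_lt Complex.continuous_re continuous_const)

theorem isOpen_rightDomain : IsOpen rightDomain :=
  isOpen_im_ne.union (isOpen_lt continuous_const Complex.continuous_re)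

theorem midDomain_subset : midDomain ⊆ ({0, 1} : Set ℂ)ᶜ := by
  rintro t ht (rfl | rfl) <;> simp [midDomain] at ht

theorem leftDomain_subset : leftDomain ⊆ ({0, 1} : Set ℂ)ᶜ := by
  rintro t ht (rfl | rfl) <;> simp [leftDomain] at ht
  linarith

theorem rightDomain_subset : rightDomain ⊆ ({0, 1} : Set ℂ)ᶜ := by
  rintro t ht (rfl | rfl) <;> simp [rightDomain] at ht
  linarith

/-- A segment from a real centre to t leaves the real axis at once unless t is real, so
star-convexity of a slit plane only has to be checked for real t. -/
theorem starConvex_of_real {V : Set ℂ} {c : ℝ}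
    (h1 : ∀ t : ℂ, t.im ≠ 0 → t ∈ V)
    (h2 : ∀ t ∈ V, t.im = 0 → ∀ a b : ℝ, 0 ≤ a → 0 ≤ b → a + b = 1 → a * c + b * t.re ∈
      {x : ℝ | (x : ℂ) ∈ V}) (hc : (c : ℂ) ∈ V) : StarConvex ℝ (c : ℂ) V := by
  intro t ht a b ha hb hab
  by_cases him : (b * t.im : ℝ) = 0
  · rcases mul_eq_zero.1 him with hb0 | h0
    · have : a = 1 := by linarith
      simpa [hb0, this] using hc
    · have := h2 t ht h0 a b ha hb hab
      have e : a • (c : ℂ) + b • t = ((a * c + b * t.re : ℝ) : ℂ) := by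
        apply Complex.ext <;> simp [h0]
      rw [e]
      exact this
  · apply h1
    simpa using him

theorem starConvex_midDomain : StarConvex ℝ ((1 / 2 : ℝ) : ℂ) midDomain := by
  refine starConvex_of_real (fun t ht => Or.inl ht) (fun t ht h0 a b ha hb hab => ?_) ?_
  · have h : 0 < t.re ∧ t.re < 1 := ht.resolve_left (by simp [h0])
    refine Or.inr ?_
    rcases ha.eq_or_lt with rfl | ha'
    · have : b = 1 := by linarith
      simpa [this] using h
    · simp only [Complex.ofReal_re]
      constructor
      · nlinarith [mul_nonneg hb h.1.le]
      · nlinarith [mul_nonneg hb (sub_nonneg.2 h.2.le)]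
  · exact Or.inr (by norm_num)

theorem starConvex_leftDomain : StarConvex ℝ ((-1 : ℝ) : ℂ) leftDomain := by
  refine starConvex_of_real (fun t ht => Or.inl ht) (fun t ht h0 a b ha hb hab => ?_) ?_
  · have h : t.re < 0 := ht.resolve_left (by simp [h0])
    refine Or.inr ?_
    rcases ha.eq_or_lt with rfl | ha'
    · have : b = 1 := by linarith
      simpa [this] using h
    · simp only [Complex.ofReal_re]
      nlinarith [mul_nonneg hb (neg_nonneg.2 h.le)]
  · exact Or.inr (by norm_num)

/-- The finite critical values of `p` lie in `{0, 1}`. -/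
theorem isCoveringMapOn_eval {p : ℂ[X]} (hp : IsShabat p) :
    IsCoveringMapOn p.eval ({0, 1} : Set ℂ)ᶜ := by
  have := p.isCoveringMapOn_eval
  rwa [hp] at this

/-- Unique lifting: `f` and `g` lift the same map through the covering `p` over the complement of
{0, 1}. All later identifications of branches and edges go back to this. -/
theorem eqOn_of_eval_eq {p : ℂ[X]} (hp : IsShabat p) {A : Type*} [TopologicalSpace A] {s : Set A}
    (hs : IsPreconnected s) {f g : A → ℂ} (hf : ContinuousOn f s) (hg : ContinuousOn g s)
    (hfg : ∀ a ∈ s, p.eval (f a) = p.eval (g a)) (h0 : ∀ a ∈ s, p.eval (f a) ∈ ({0, 1} : Set ℂ)ᶜ)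
    {a : A} (ha : a ∈ s) (h : f a = g a) : Set.EqOn f g s := by
  have cov := (isCoveringMapOn_eval hp).isCoveringMap_restrictPreimage
  have : PreconnectedSpace s := Subtype.preconnectedSpace hs
  let F : s → (p.eval ⁻¹' ({0, 1} : Set ℂ)ᶜ) := fun x => ⟨f x, h0 x x.2⟩
  let G : s → (p.eval ⁻¹' ({0, 1} : Set ℂ)ᶜ) := fun x => ⟨g x, by
    change p.eval (g x) ∈ ({0, 1} : Set ℂ)ᶜ
    rw [← hfg x x.2]
    exact h0 x x.2⟩
  have hF : Continuous F := Continuous.subtype_mk hf.domRestrict _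
  have hG : Continuous G := Continuous.subtype_mk hg.domRestrict _
  have : F = G := cov.eq_of_comp_eq hF hG (by
    funext x
    exact Subtype.ext (hfg x x.2)) ⟨a, ha⟩ (Subtype.ext h)
  intro x hx
  exact congrArg Subtype.val (congrFun this ⟨x, hx⟩)

theorem IsSection.eqOn {p : ℂ[X]} (hp : IsShabat p) {V : Set ℂ} (hV : IsPreconnected V)
    (hV01 : V ⊆ ({0, 1} : Set ℂ)ᶜ) {f g : ℂ → ℂ} (hf : IsSection p V f) (hg : IsSection p V g)
    {t : ℂ} (ht : t ∈ V) (h : f t = g t) : Set.EqOn f g V :=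
  eqOn_of_eval_eq hp hV hf.continuousOn hg.continuousOn
    (fun a ha => by rw [hf.eval_eq a ha, hg.eval_eq a ha])
    (fun a ha => by rw [hf.eval_eq a ha]; exact hV01 ha) ht h

/-- A star-shaped open set is contractible and locally path connected, so its inclusion lifts
through the covering with any prescribed value over one point. -/
theorem exists_isSection {p : ℂ[X]} (hp : IsShabat p) {V : Set ℂ} (hVo : IsOpen V) {c : ℂ}
    (hV : StarConvex ℝ c V) (hV01 : V ⊆ ({0, 1} : Set ℂ)ᶜ) {t z : ℂ} (ht : t ∈ V)
    (hz : p.eval z = t) : ∃ f, IsSection p V f ∧ f t = z := by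
  have : ContractibleSpace V := hV.contractibleSpace ⟨t, ht⟩
  have : LocallyPathConnectedSpace V := hVo.locallyPathConnectedSpace
  obtain ⟨F, ⟨hF0, hF⟩, -⟩ := (isCoveringMapOn_eval hp).existsUnique_continuousMap_lifts
    (⟨Subtype.val, continuous_subtype_val⟩ : C(V, ℂ)) (a₀ := ⟨t, ht⟩) (e₀ := z) hz
    (fun a => hV01 a.2)
  classical
  refine ⟨fun x => if h : x ∈ V then F ⟨x, h⟩ else 0, ⟨?_, fun x hx => ?_⟩, ?_⟩
  · rw [continuousOn_iff_continuous_domRestrict]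
    convert F.continuous using 1
    funext x
    simp
  · simp only [hx, dif_pos]
    exact congrFun hF ⟨x, hx⟩
  · simp only [ht, dif_pos]
    exact hF0

theorem IsSection.differentiableOn {p : ℂ[X]} (hp : IsShabat p) {V : Set ℂ} (hVo : IsOpen V)
    (hV01 : V ⊆ ({0, 1} : Set ℂ)ᶜ) {f : ℂ → ℂ} (hf : IsSection p V f) :
    DifferentiableOn ℂ f V := by
  intro t ht
  -- A point lying over a noncritical value is not critical, so the local inverse is differentiable.
  have hd : p.derivative.eval (f t) ≠ 0 := by
    intro h
    have : p.eval (f t) ∈ (fun z => p.eval z) '' {z | p.derivative.eval z = 0} := ⟨f t, h, rfl⟩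
    rw [hp, hf.eval_eq t ht] at this
    exact hV01 ht this
  have hc : ContinuousAt f t := hf.continuousOn.continuousAt (hVo.mem_nhds ht)
  exact (HasDerivAt.of_local_left_inverse hc (p.hasDerivAt (f t)) hd
    (by filter_upwards [hVo.mem_nhds ht] with y hy using hf.eval_eq y hy)
    ).differentiableAt.differentiableWithinAt

/-- A root of `p - t` has size `O(1 + |t|)^(1/n)`. -/
theorem exists_growth {p : ℂ[X]} {n : ℕ} (hn : p.natDegree = n) (hn0 : n ≠ 0) :
    ∃ K : ℝ, 1 ≤ K ∧ ∀ z : ℂ, ‖z‖ ^ n ≤ K ^ n * (1 + ‖p.eval z‖) := by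
  have hp0 : p ≠ 0 := by
    rintro rfl
    simp at hn; omega
  obtain ⟨R, hR⟩ : ∃ R : ℝ, ∀ r ∈ p.roots, ‖r‖ ≤ R := by
    obtain ⟨R, hR⟩ := (p.roots.toFinset.image norm).bddAbove
    exact ⟨R, fun r hr => hR (by simpa using ⟨r, ⟨hp0, by simpa [hp0] using hr⟩, rfl⟩)⟩
  have hsp : p.Splits := IsAlgClosed.splits p
  have hlc : 0 < ‖p.leadingCoeff‖ := by simpa using hp0
  have hcard : p.roots.card = n := by rw [← hn, hsp.natDegree_eq_card_roots]
  -- The summand 2|R| covers the disc |z| ≤ 2|R|. Outside it each factor |z - r| is at least |z|/2,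
  -- and the last summand absorbs these halves and the leading coefficient.
  set K : ℝ := 1 + 2 * |R| + 2 * (1 + ‖p.leadingCoeff‖⁻¹) with hK
  have hinv : 0 < ‖p.leadingCoeff‖⁻¹ := inv_pos.2 hlc
  refine ⟨K, by nlinarith [abs_nonneg R], fun z => ?_⟩
  rcases le_or_gt ‖z‖ (2 * |R|) with h | h
  · calc ‖z‖ ^ n ≤ K ^ n := by gcongr; linarith
      _ ≤ K ^ n * (1 + ‖p.eval z‖) :=
        le_mul_of_one_le_right (by positivity) (by linarith [norm_nonneg (p.eval z)])
  · have h1 : ∀ r ∈ p.roots, ‖z‖ / 2 ≤ ‖z - r‖ := fun r hr => by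
      have := norm_sub_norm_le z r
      have := hR r hr
      have := le_abs_self R
      linarith
    have h2 : ‖p.leadingCoeff‖ * (‖z‖ / 2) ^ n ≤ ‖p.eval z‖ := by
      rw [hsp.eval_eq_prod_roots z, norm_mul, ← hcard]
      gcongr
      have : ∀ s : Multiset ℂ, (∀ r ∈ s, ‖z‖ / 2 ≤ ‖z - r‖) →
          (‖z‖ / 2) ^ s.card ≤ ‖(s.map (fun r => z - r)).prod‖ := by
        intro s
        induction s using Multiset.induction with
        | empty => simp
        | cons a s ih =>
          intro hs
          rw [Multiset.card_cons, Multiset.map_cons, Multiset.prod_cons, norm_mul, pow_succ']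
          exact mul_le_mul (hs a (by simp)) (ih fun r hr => hs r (by simp [hr])) (by positivity)
            (norm_nonneg _)
      exact this _ h1
    have h3 : ‖z‖ ^ n ≤ 2 ^ n * ‖p.leadingCoeff‖⁻¹ * ‖p.eval z‖ := by
      have := mul_le_mul_of_nonneg_left h2 (show 0 ≤ 2 ^ n * ‖p.leadingCoeff‖⁻¹ by positivity)
      calc ‖z‖ ^ n = 2 ^ n * ‖p.leadingCoeff‖⁻¹ * (‖p.leadingCoeff‖ * (‖z‖ / 2) ^ n) := by
            rw [div_pow]; field_simp
        _ ≤ _ := this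
    have h4 : 2 ^ n * ‖p.leadingCoeff‖⁻¹ ≤ K ^ n := by
      calc 2 ^ n * ‖p.leadingCoeff‖⁻¹ ≤ 2 ^ n * (1 + ‖p.leadingCoeff‖⁻¹) ^ n := by
            gcongr
            calc ‖p.leadingCoeff‖⁻¹ ≤ 1 + ‖p.leadingCoeff‖⁻¹ := by linarith
              _ ≤ _ := le_self_pow₀ (by linarith) hn0
        _ = (2 * (1 + ‖p.leadingCoeff‖⁻¹)) ^ n := by rw [mul_pow]
        _ ≤ K ^ n := by
          gcongr
          rw [hK]
          linarith [abs_nonneg R]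
    calc ‖z‖ ^ n ≤ 2 ^ n * ‖p.leadingCoeff‖⁻¹ * ‖p.eval z‖ := h3
      _ ≤ K ^ n * (1 + ‖p.eval z‖) := by
        gcongr
        linarith

/-! ### Functions with trivial monodromy around `0` and `1` -/

theorem mem_midDomain_of_im {t : ℂ} (h : t.im ≠ 0) : t ∈ midDomain := Or.inl h

theorem compl_subset_union {t : ℂ} (ht : t ∉ ({0, 1} : Set ℂ)) :
    t ∈ midDomain ∨ t ∈ leftDomain ∨ t ∈ rightDomain := by
  by_cases h : t.im = 0
  · rcases lt_trichotomy t.re 0 with h0 | h0 | h0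
    · exact Or.inr (Or.inl (Or.inr h0))
    · exact absurd (Or.inl (Complex.ext h0 h)) ht
    · rcases lt_trichotomy t.re 1 with h1 | h1 | h1
      · exact Or.inl (Or.inr ⟨h0, h1⟩)
      · exact absurd (Or.inr (Complex.ext h1 h)) ht
      · exact Or.inr (Or.inr (Or.inr h1))
  · exact Or.inl (Or.inl h)

/-- An entire function of linear growth is affine. -/
theorem eq_affine_of_growth {G : ℂ → ℂ} (hG : Differentiable ℂ G) {K : ℝ}
    (hb : ∀ t : ℂ, 2 ≤ ‖t‖ → ‖G t‖ ≤ K * (1 + ‖t‖)) : ∃ a b : ℂ, ∀ t, G t = a + b * t := by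
  -- Linear growth makes the difference quotient at 0 a bounded entire function, so Liouville's
  -- theorem applies to it.
  have hd : Differentiable ℂ (dslope G 0) := by
    rw [← differentiableOn_univ, Complex.differentiableOn_dslope Filter.univ_mem]
    exact hG.differentiableOn
  have hbd : Bornology.IsBounded (Set.range (dslope G 0)) := by
    obtain ⟨R, hR⟩ := (isCompact_closedBall (0 : ℂ) 2).bddAbove_image
      (f := fun t => ‖dslope G 0 t‖) hd.continuous.norm.continuousOn
    rw [isBounded_iff_forall_norm_le]
    refine ⟨max R (2 * |K| + ‖G 0‖), ?_⟩
    rintro _ ⟨t, rfl⟩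
    rcases le_or_gt ‖t‖ 2 with h | h
    · exact le_max_of_le_left (hR ⟨t, by simpa using h, rfl⟩)
    · apply le_max_of_le_right
      have ht0 : t ≠ 0 := by
        rintro rfl
        simp at h
        linarith
      rw [dslope_of_ne _ ht0, slope_def_field, sub_zero, norm_div, div_le_iff₀ (by linarith)]
      have h1 := hb t h.le
      have h2 := norm_sub_le (G t) (G 0)
      have h3 : K * (1 + ‖t‖) ≤ |K| * (1 + ‖t‖) := by
        gcongr
        exact le_abs_self K
      nlinarith [abs_nonneg K, norm_nonneg (G 0)]
  obtain ⟨b, hb⟩ := hd.exists_eq_const_of_bounded hbd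
  refine ⟨G 0, b, fun t => ?_⟩
  have := sub_smul_dslope G 0 t
  rw [hb] at this
  simp only [Function.const_apply, sub_zero, smul_eq_mul] at this
  linear_combination -this

/-- A function on the complement of `{0, 1}` of linear growth, glued from three
slit planes, is affine. -/
theorem eq_affine_of_glue {F F₀ F₁ : ℂ → ℂ} (hF : DifferentiableOn ℂ F midDomain)
    (hF₀ : DifferentiableOn ℂ F₀ leftDomain) (hF₁ : DifferentiableOn ℂ F₁ rightDomain)
    (h0 : ∀ t : ℂ, t.im ≠ 0 → F₀ t = F t) (h1 : ∀ t : ℂ, t.im ≠ 0 → F₁ t = F t) {K : ℝ}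
    (hb : ∀ t ∈ midDomain, ‖F t‖ ≤ K * (1 + ‖t‖))
    (hb₀ : ∀ t ∈ leftDomain, ‖F₀ t‖ ≤ K * (1 + ‖t‖))
    (hb₁ : ∀ t ∈ rightDomain, ‖F₁ t‖ ≤ K * (1 + ‖t‖)) :
    ∃ a b : ℂ, ∀ t ∈ midDomain, F t = a + b * t := by
  classical
  set G : ℂ → ℂ := fun t => if t ∈ midDomain then F t else if t ∈ leftDomain then F₀ t else F₁ t
    with hGdef
  have hGU : ∀ t ∈ midDomain, G t = F t := fun t ht => by simp [hGdef, ht]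
  have hGL : ∀ t ∈ leftDomain, G t = F₀ t := fun t ht => by
    by_cases hU : t ∈ midDomain
    · rw [hGU t hU]
      refine (h0 t ?_).symm
      intro him
      have := hU.resolve_left (by simp [him])
      have := ht.resolve_left (by simp [him])
      linarith
    · simp [hGdef, ht, hU]
  have hGR : ∀ t ∈ rightDomain, G t = F₁ t := fun t ht => by
    by_cases hU : t ∈ midDomain
    · rw [hGU t hU]
      refine (h1 t ?_).symm
      intro him
      have := hU.resolve_left (by simp [him])
      have := ht.resolve_left (by simp [him])
      linarith
    · by_cases hL : t ∈ leftDomain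
      · by_cases him : t.im = 0
        · have := hL.resolve_left (by simp [him])
          have := ht.resolve_left (by simp [him])
          linarith
        · exact absurd (mem_midDomain_of_im him) hU
      · simp [hGdef, hU, hL]
  have hGd : ∀ t, t ∉ ({0, 1} : Set ℂ) → DifferentiableAt ℂ G t := by
    intro t ht
    rcases compl_subset_union ht with h | h | h
    · exact (hF.differentiableAt (isOpen_midDomain.mem_nhds h)).congr_of_eventuallyEq
        (by filter_upwards [isOpen_midDomain.mem_nhds h] with y hy using hGU y hy)
    · exact (hF₀.differentiableAt (isOpen_leftDomain.mem_nhds h)).congr_of_eventuallyEq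
        (by filter_upwards [isOpen_leftDomain.mem_nhds h] with y hy using hGL y hy)
    · exact (hF₁.differentiableAt (isOpen_rightDomain.mem_nhds h)).congr_of_eventuallyEq
        (by filter_upwards [isOpen_rightDomain.mem_nhds h] with y hy using hGR y hy)
  have hGb : ∀ t, t ∉ ({0, 1} : Set ℂ) → ‖G t‖ ≤ K * (1 + ‖t‖) := by
    intro t ht
    rcases compl_subset_union ht with h | h | h
    · rw [hGU t h]
      exact hb t h
    · rw [hGL t h]
      exact hb₀ t h
    · rw [hGR t h]
      exact hb₁ t h
  have hK : 0 ≤ K := by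
    have := (norm_nonneg _).trans (hb Complex.I (by simp [midDomain]))
    rw [Complex.norm_I] at this
    linarith
  -- Riemann's removable singularity theorem. It is applied first at 0 and then to the corrected
  -- function at 1; the punctured unit balls about 0 and 1 contain neither point.
  have key : ∀ (H : ℂ → ℂ) (c : ℂ), (∀ t ∈ Metric.ball c 1 \ {c}, H t = G t) →
      (Metric.ball c 1 \ {c} ⊆ ({0, 1} : Set ℂ)ᶜ) →
      DifferentiableAt ℂ (Function.update H c (limUnder (𝓝[≠] c) H)) c := by
    intro H c hH hc
    refine (Complex.differentiableOn_update_limUnder_of_bddAbove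
      (Metric.ball_mem_nhds c one_pos) ?_ ?_).differentiableAt (Metric.ball_mem_nhds c one_pos)
    · refine DifferentiableOn.congr (f := G) (fun t ht => ?_) hH
      exact (hGd t (hc ht)).differentiableWithinAt
    · refine ⟨K * (1 + (‖c‖ + 1)), ?_⟩
      rintro _ ⟨t, ht, rfl⟩
      simp only [Function.comp]
      rw [hH t ht]
      refine (hGb t (hc ht)).trans ?_
      gcongr
      have : ‖t - c‖ < 1 := by simpa [dist_eq_norm] using ht.1
      have := norm_sub_norm_le t c
      linarith
  set G0 := Function.update G 0 (limUnder (𝓝[≠] 0) G) with hG0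
  set G1 := Function.update G0 1 (limUnder (𝓝[≠] 1) G0) with hG1
  have hb0 : Metric.ball (0 : ℂ) 1 \ {0} ⊆ ({0, 1} : Set ℂ)ᶜ := by
    rintro t ⟨ht, ht0⟩ (rfl | rfl)
    · exact ht0 rfl
    · simp at ht
  have hb1 : Metric.ball (1 : ℂ) 1 \ {1} ⊆ ({0, 1} : Set ℂ)ᶜ := by
    rintro t ⟨ht, ht0⟩ (rfl | rfl)
    · simp at ht
    · exact ht0 rfl
  have e0 : ∀ t ≠ 0, G0 t = G t := fun t ht => by simp [hG0, ht]
  have e1 : ∀ t ≠ 1, G1 t = G0 t := fun t ht => by simp [hG1, ht]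
  have hG1d : Differentiable ℂ G1 := by
    intro t
    by_cases ht1 : t = 1
    · subst ht1
      exact key G0 1 (fun t ht => e0 t fun h => (hb1 ht) (by simp [h])) hb1
    · have hev : G1 =ᶠ[𝓝 t] G0 := by
        filter_upwards [isOpen_ne.mem_nhds ht1] with y hy using e1 y hy
      refine DifferentiableAt.congr_of_eventuallyEq ?_ hev
      by_cases ht0 : t = 0
      · subst ht0
        exact key G 0 (fun _ _ => rfl) hb0
      · exact (hGd t (by simp [ht0, ht1])).congr_of_eventuallyEq
          (by filter_upwards [isOpen_ne.mem_nhds ht0] with y hy using e0 y hy)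
  have hG1e : ∀ t, t ∉ ({0, 1} : Set ℂ) → G1 t = G t := fun t ht => by
    rw [e1 t fun h => ht (by simp [h]), e0 t fun h => ht (by simp [h])]
  obtain ⟨a, b, hab⟩ := eq_affine_of_growth hG1d (K := K) (fun t ht => by
    have : t ∉ ({0, 1} : Set ℂ) := by
      rintro (rfl | rfl)
      · simp at ht
        linarith
      · simp at ht
    rw [hG1e t this]
    exact hGb t this)
  refine ⟨a, b, fun t ht => ?_⟩
  rw [← hab, hG1e t (midDomain_subset ht), hGU t ht]

/-- The size `(1 + |t|)^(1/n)` of the roots of `p - t` for a polynomial `p` of degree `n`. -/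
noncomputable def growth (n : ℕ) (t : ℂ) : ℝ := (1 + ‖t‖) ^ ((n : ℝ)⁻¹)

theorem growth_pow {n : ℕ} (hn : n ≠ 0) (t : ℂ) : growth n t ^ n = 1 + ‖t‖ :=
  Real.rpow_inv_natCast_pow (by positivity) hn

theorem one_le_growth (n : ℕ) (t : ℂ) : 1 ≤ growth n t :=
  Real.one_le_rpow (by linarith [norm_nonneg t]) (by positivity)

/-- The bound is of order (1 + |t|)^((n-1)/n), which is sublinear. It is tested on the imaginary
axis at |t| = Nⁿ - 1, where `growth n t` is exactly the integer N. -/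
theorem slope_eq_zero_of_growth {n : ℕ} (hn : n ≠ 0) {a b : ℂ} {K : ℝ}
    (h : ∀ t ∈ midDomain, ‖a + b * t‖ ≤ K * growth n t ^ (n - 1)) : b = 0 := by
  by_contra hb
  have hb' : 0 < ‖b‖ := norm_pos_iff.2 hb
  obtain ⟨N, hN⟩ := exists_nat_gt (max 1 ((|K| + ‖a‖ + ‖b‖ + 1) / ‖b‖))
  have hN1 : (1 : ℝ) < N := (le_max_left _ _).trans_lt hN
  have hN2 : |K| + ‖a‖ + ‖b‖ + 1 < N * ‖b‖ := by
    rw [← div_lt_iff₀ hb']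
    exact (le_max_right _ _).trans_lt hN
  have hpow : (1 : ℝ) < (N : ℝ) ^ n := one_lt_pow₀ hN1 hn
  set t : ℂ := ((N : ℝ) ^ n - 1 : ℝ) * Complex.I with ht
  have hnt : ‖t‖ = (N : ℝ) ^ n - 1 := by
    rw [ht, norm_mul, Complex.norm_I, mul_one, Complex.norm_real, Real.norm_eq_abs,
      abs_of_pos (by linarith)]
  have hgr : growth n t = N := by
    rw [growth, hnt, add_sub_cancel, Real.pow_rpow_inv_natCast (by positivity) hn]
  have him : t ∈ midDomain := by
    refine mem_midDomain_of_im ?_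
    simp only [ht, Complex.mul_im, Complex.ofReal_re, Complex.I_im, Complex.ofReal_im,
      Complex.I_re]
    intro h0
    linarith
  have h1 := h t him
  rw [hgr] at h1
  have h2 : ‖b‖ * ((N : ℝ) ^ n - 1) ≤ ‖a‖ + K * N ^ (n - 1) := by
    rw [← hnt, ← norm_mul]
    have := norm_sub_le (a + b * t) a
    rw [add_sub_cancel_left] at this
    linarith
  have h3 : (N : ℝ) ^ n = N ^ (n - 1) * N := by rw [← pow_succ]; congr 1; omega
  have h4 : (1 : ℝ) ≤ (N : ℝ) ^ (n - 1) := one_le_pow₀ hN1.le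
  rw [h3] at h2
  nlinarith [le_abs_self K, norm_nonneg a, norm_nonneg b,
    mul_nonneg (sub_nonneg.2 h4) (by positivity : 0 ≤ ‖a‖ + ‖b‖ + 1),
    mul_le_mul_of_nonneg_right (le_abs_self K) (by positivity : (0 : ℝ) ≤ (N : ℝ) ^ (n - 1)),
    mul_lt_mul_of_pos_left hN2 (by positivity : (0 : ℝ) < (N : ℝ) ^ (n - 1))]

/-- The functions `h i` on the middle slit plane are permuted by `α` under analytic continuation
counterclockwise around `0`, and by `β` around `1`, and are `O(1 + |t|)^(1/n)`. -/
structure HasMonodromy {ι : Type*} (n : ℕ) (h : ι → ℂ → ℂ) (α β : Equiv.Perm ι) (K : ℝ) :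
    Prop where
  diff : ∀ i, DifferentiableOn ℂ (h i) midDomain
  bound : ∀ i, ∀ t ∈ midDomain, ‖h i t‖ ≤ K * growth n t
  left : ∀ i, ∃ g, DifferentiableOn ℂ g leftDomain ∧ (∀ t ∈ leftDomain, ‖g t‖ ≤ K * growth n t) ∧
    (∀ t : ℂ, 0 < t.im → g t = h i t) ∧ ∀ t : ℂ, t.im < 0 → g t = h (α i) t
  right : ∀ i, ∃ g, DifferentiableOn ℂ g rightDomain ∧
    (∀ t ∈ rightDomain, ‖g t‖ ≤ K * growth n t) ∧
    (∀ t : ℂ, t.im < 0 → g t = h i t) ∧ ∀ t : ℂ, 0 < t.im → g t = h (β i) t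

namespace HasMonodromy

variable {ι : Type*} {n : ℕ} {h k : ι → ℂ → ℂ} {α β : Equiv.Perm ι} {K L : ℝ}

theorem sub_mul (hh : HasMonodromy n h α β K) (hk : HasMonodromy n k α β L) (c : ℂ) :
    HasMonodromy n (fun i t => h i t - c * k i t) α β (K + ‖c‖ * L) where
  diff i := (hh.diff i).sub ((hk.diff i).const_mul c)
  bound i t ht := by
    refine (norm_sub_le _ _).trans ?_
    rw [norm_mul, add_mul, mul_assoc]
    exact add_le_add (hh.bound i t ht)
      (mul_le_mul_of_nonneg_left (hk.bound i t ht) (norm_nonneg c))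
  left i := by
    obtain ⟨f, h1, h2, h3, h4⟩ := hh.left i
    obtain ⟨g, k1, k2, k3, k4⟩ := hk.left i
    refine ⟨fun t => f t - c * g t, h1.sub (k1.const_mul c), fun t ht => ?_, fun t ht => ?_,
      fun t ht => ?_⟩
    · refine (norm_sub_le _ _).trans ?_
      rw [norm_mul, add_mul, mul_assoc]
      exact add_le_add (h2 t ht) (mul_le_mul_of_nonneg_left (k2 t ht) (norm_nonneg c))
    · simp only [h3 t ht, k3 t ht]
    · simp only [h4 t ht, k4 t ht]
  right i := by
    obtain ⟨f, h1, h2, h3, h4⟩ := hh.right i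
    obtain ⟨g, k1, k2, k3, k4⟩ := hk.right i
    refine ⟨fun t => f t - c * g t, h1.sub (k1.const_mul c), fun t ht => ?_, fun t ht => ?_,
      fun t ht => ?_⟩
    · refine (norm_sub_le _ _).trans ?_
      rw [norm_mul, add_mul, mul_assoc]
      exact add_le_add (h2 t ht) (mul_le_mul_of_nonneg_left (k2 t ht) (norm_nonneg c))
    · simp only [h3 t ht, k3 t ht]
    · simp only [h4 t ht, k4 t ht]

end HasMonodromy

theorem differentiableOn_coeff_prod {ι : Type*} (s : Finset ι) {h : ι → ℂ → ℂ} {V : Set ℂ}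
    (hd : ∀ i, DifferentiableOn ℂ (h i) V) (j : ℕ) :
    DifferentiableOn ℂ (fun t => (∏ i ∈ s, (X - C (h i t))).coeff j) V := by
  classical
  induction s using Finset.induction generalizing j with
  | empty => simp only [Finset.prod_empty]; exact differentiableOn_const _
  | insert a s ha ih =>
    simp only [Finset.prod_insert ha, _root_.sub_mul, coeff_sub, coeff_C_mul]
    cases j with
    | zero =>
      simp only [coeff_X_mul_zero, zero_sub]
      exact ((hd a).mul (ih 0)).neg
    | succ j =>
      simp only [coeff_X_mul]
      exact (ih j).sub ((hd a).mul (ih (j + 1)))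

/-- The coefficient at degree j is, up to sign, the elementary symmetric function of degree card ι -
j in the roots; the factor 2 ^ n absorbs its binomial number of terms. -/
theorem norm_coeff_prod_le {ι : Type*} [Fintype ι] {n : ℕ} (hc : Fintype.card ι ≤ n) {M : ℝ}
    (hM : 1 ≤ M) {r : ι → ℂ} (hr : ∀ i, ‖r i‖ ≤ M) (j : ℕ) :
    ‖(∏ i, (X - C (r i))).coeff j‖ ≤ M ^ (Fintype.card ι - j) * 2 ^ n := by
  have hmon : (∏ i, (X - C (r i))).Monic := monic_prod_of_monic _ _ fun i _ => monic_X_sub_C _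
  have hdeg : (∏ i, (X - C (r i))).natDegree = Fintype.card ι := by
    rw [natDegree_prod_of_monic _ _ fun i _ => monic_X_sub_C _]
    simp
  have hroots : (∏ i, (X - C (r i))).roots = Finset.univ.val.map r := by
    have := roots_multiset_prod_X_sub_C (Finset.univ.val.map r)
    rwa [Multiset.map_map] at this
  have := coeff_le_of_roots_le (p := ∏ i, (X - C (r i))) (f := RingHom.id ℂ) (B := M) j hmon
    (IsAlgClosed.splits _) (by
      rw [Polynomial.map_id, hroots]
      intro z hz
      obtain ⟨i, -, rfl⟩ := Multiset.mem_map.1 hz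
      exact hr i)
  rw [Polynomial.map_id, hdeg] at this
  refine this.trans ?_
  gcongr
  calc ((Fintype.card ι).choose j : ℝ) ≤ 2 ^ Fintype.card ι := by
        exact_mod_cast Nat.choose_le_two_pow _ _
    _ ≤ 2 ^ n := pow_le_pow_right₀ one_le_two hc

namespace HasMonodromy

variable {ι : Type*} [Fintype ι] {n : ℕ} {h : ι → ℂ → ℂ} {α β : Equiv.Perm ι} {K : ℝ}

/-- Continuation around 0 or 1 only permutes the factors, so each coefficient is single-valued. It
is O(growth^(card ι - j)), hence at most linear in t, and sublinear as soon as that exponent is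
below n. -/
theorem coeff_eq_affine (hh : HasMonodromy n h α β K) (hn : n ≠ 0) (hc : Fintype.card ι ≤ n)
    (j : ℕ) : ∃ a b : ℂ, (∀ t ∈ midDomain, (∏ i, (X - C (h i t))).coeff j = a + b * t) ∧
      (Fintype.card ι - j < n → b = 0) := by
  choose f f1 f2 f3 f4 using hh.left
  choose g g1 g2 g3 g4 using hh.right
  set K' := max K 1
  have hK' : 1 ≤ K' := le_max_right _ _
  have hle : ∀ {x : ℂ} {t : ℂ}, ‖x‖ ≤ K * growth n t → ‖x‖ ≤ K' * growth n t := fun {x t} hx =>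
    hx.trans (mul_le_mul_of_nonneg_right (le_max_left _ _)
      (zero_le_one.trans (one_le_growth n t)))
  have hbd : ∀ (t : ℂ) (r : ι → ℂ), (∀ i, ‖r i‖ ≤ K * growth n t) → ∀ m, Fintype.card ι - j ≤ m →
      ‖(∏ i, (X - C (r i))).coeff j‖ ≤ (2 ^ n * K' ^ m) * growth n t ^ m := by
    intro t r hr m hm
    have h1 : 1 ≤ K' * growth n t := one_le_mul_of_one_le_of_one_le hK' (one_le_growth n t)
    refine (norm_coeff_prod_le hc h1 (fun i => hle (hr i)) j).trans ?_
    rw [mul_comm, mul_assoc, ← mul_pow]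
    gcongr
  obtain ⟨a, b, hab⟩ := eq_affine_of_glue (K := 2 ^ n * K' ^ n)
    (differentiableOn_coeff_prod Finset.univ hh.diff j)
    (differentiableOn_coeff_prod Finset.univ f1 j)
    (differentiableOn_coeff_prod Finset.univ g1 j)
    (fun t ht => by
      rcases lt_or_gt_of_ne ht with h0 | h0
      · simp only [f4 _ t h0]
        rw [Equiv.prod_comp α fun i => X - C (h i t)]
      · simp only [f3 _ t h0])
    (fun t ht => by
      rcases lt_or_gt_of_ne ht with h0 | h0
      · simp only [g3 _ t h0]
      · simp only [g4 _ t h0]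
        rw [Equiv.prod_comp β fun i => X - C (h i t)])
    (fun t ht => by
      rw [← growth_pow hn]
      exact hbd t _ (fun i => hh.bound i t ht) n (by omega))
    (fun t ht => by
      rw [← growth_pow hn]
      exact hbd t _ (fun i => f2 i t ht) n (by omega))
    (fun t ht => by
      rw [← growth_pow hn]
      exact hbd t _ (fun i => g2 i t ht) n (by omega))
  refine ⟨a, b, hab, fun hj => slope_eq_zero_of_growth hn (a := a)
    (K := 2 ^ n * K' ^ (n - 1)) fun t ht => ?_⟩
  rw [← hab t ht]
  exact hbd t _ (fun i => hh.bound i t ht) (n - 1) (by omega)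

/-- If the elementary symmetric functions of the `h i` are constant, so are the `h i`. -/
theorem eq_const_of_prod_const (hh : HasMonodromy n h α β K) {P : ℂ[X]}
    (hP : ∀ t ∈ midDomain, ∏ i, (X - C (h i t)) = P) (i : ι) :
    ∀ t ∈ midDomain, ∀ u ∈ midDomain, h i t = h i u := by
  have hP0 : P ≠ 0 := by
    rw [← hP Complex.I (by simp [midDomain])]
    exact (monic_prod_of_monic _ _ fun i _ => monic_X_sub_C _).ne_zero
  have hpre : IsPreconnected midDomain :=
    (starConvex_midDomain.isPathConnected (Or.inr (by norm_num))
      ).isConnected.isPreconnected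
  -- A continuous map from a connected set to the finite set of roots of P is constant.
  have hmaps : Set.MapsTo (h i) midDomain (P.roots.toFinset : Set ℂ) := fun t ht => by
    simp only [Finset.mem_coe, Multiset.mem_toFinset, mem_roots hP0, IsRoot.def]
    rw [← hP t ht, eval_prod]
    exact Finset.prod_eq_zero (Finset.mem_univ i) (by simp)
  intro t ht u hu
  exact hpre.constant_of_mapsTo (Finset.finite_toSet _).isDiscrete
    (hh.diff i).continuousOn hmaps ht hu

/-- With fewer than n branches every coefficient grows sublinearly, so all slopes vanish. This is
what forces the rotations of a polynomial to act transitively. -/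
theorem eq_const_of_card_lt (hh : HasMonodromy n h α β K) (hc : Fintype.card ι < n) (i : ι) :
    ∀ t ∈ midDomain, ∀ u ∈ midDomain, h i t = h i u := by
  have hI : Complex.I ∈ midDomain := by simp [midDomain]
  refine hh.eq_const_of_prod_const (P := ∏ i, (X - C (h i Complex.I))) (fun t ht => ?_) i
  ext j
  obtain ⟨a, b, h1, h2⟩ := hh.coeff_eq_affine (by omega) hc.le j
  rw [h1 t ht, h1 _ hI, h2 (by omega), zero_mul, zero_mul]

/-- With exactly n branches only the constant coefficient, plus or minus the product of the
branches, can have a nonzero slope, and two equal values exclude this. -/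
theorem eq_const_of_prod_eq (hh : HasMonodromy n h α β K) (hn : n ≠ 0) (hc : Fintype.card ι = n)
    {u v : ℂ} (hu : u ∈ midDomain) (hv : v ∈ midDomain) (huv : u ≠ v)
    (huv' : ∏ i, h i u = ∏ i, h i v) (i : ι) :
    ∀ t ∈ midDomain, ∀ u ∈ midDomain, h i t = h i u := by
  have hI : Complex.I ∈ midDomain := by simp [midDomain]
  refine hh.eq_const_of_prod_const (P := ∏ i, (X - C (h i Complex.I))) (fun t ht => ?_) i
  ext j
  obtain ⟨a, b, h1, h2⟩ := hh.coeff_eq_affine hn hc.le j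
  have hb : b = 0 := by
    rcases Nat.eq_zero_or_pos j with rfl | hj
    · have e : ∀ t, (∏ i, (X - C (h i t))).coeff 0 = (-1) ^ n * ∏ i, h i t := fun t => by
        rw [coeff_zero_eq_eval_zero, eval_prod, ← hc, ← Finset.card_univ, ← Finset.prod_const,
          ← Finset.prod_mul_distrib]
        simp
      have h3 : a + b * u = a + b * v := by
        rw [← h1 u hu, ← h1 v hv, e, e, huv']
      have h4 : b * (u - v) = 0 := by linear_combination h3
      exact (mul_eq_zero.1 h4).resolve_right (sub_ne_zero.2 huv)
    · exact h2 (by omega)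
  rw [h1 t ht, h1 _ hI, hb, zero_mul, zero_mul]

/-- Two families with the same monodromy, both with affine product of degree one, are affinely
related. -/
theorem exists_affine {k : ι → ℂ → ℂ} {L : ℝ} (hh : HasMonodromy n h α β K)
    (hk : HasMonodromy n k α β L)
    (hn : n ≠ 0) (hc : Fintype.card ι = n) {u v : ℂ} (hu : u ∈ midDomain) (hv : v ∈ midDomain)
    (huv : ∏ i, k i u ≠ ∏ i, k i v) :
    ∃ a : ℂ, ∀ i, ∃ b : ℂ, ∀ t ∈ midDomain, h i t = a * k i t + b := by
  set Q : ℂ → ℂ[X] := fun t => ∏ i, (C (h i t) - X * C (k i t)) with hQ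
  have hcoeff : ∀ t, (Q t).coeff n = (-1) ^ n * ∏ i, k i t := by
    intro t
    have := coeff_prod_of_natDegree_le (s := Finset.univ)
      (f := fun i => C (h i t) - X * C (k i t)) 1 (fun i _ => by compute_degree)
    rw [mul_one, Finset.card_univ, hc] at this
    rw [hQ]
    simp only
    rw [this, ← hc, ← Finset.card_univ, ← Finset.prod_const, ← Finset.prod_mul_distrib]
    refine Finset.prod_congr rfl fun i _ => ?_
    simp [coeff_C]
  -- Q_u - Q_v is therefore not constant and has a root a. At this a the functions h_i - a k_i have
  -- the same product at u and at v.
  have hcn : (Q u - Q v).coeff n ≠ 0 := by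
    rw [coeff_sub, hcoeff, hcoeff, ← mul_sub]
    exact mul_ne_zero (by simp) (sub_ne_zero.2 huv)
  obtain ⟨a, ha⟩ := IsAlgClosed.exists_root (Q u - Q v) (by
    intro hdeg
    have : (Q u - Q v).natDegree = 0 := natDegree_eq_zero_iff_degree_le_zero.2 hdeg.le
    exact hcn (coeff_eq_zero_of_natDegree_lt (by omega)))
  refine ⟨a, fun i => ?_⟩
  have he : ∀ t, (Q t).eval a = ∏ i, (h i t - a * k i t) := fun t => by
    simp only [hQ, eval_prod, eval_sub, eval_mul, eval_C, eval_X]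
  have := (hh.sub_mul hk a).eq_const_of_prod_eq hn hc hu hv
    (fun h => huv (by rw [h])) (by
      rw [← he, ← he]
      simpa [sub_eq_zero] using ha) i
  refine ⟨h i u - a * k i u, fun t ht => ?_⟩
  have := this t ht u hu
  linear_combination this

end HasMonodromy

/-! ### The local structure at a root -/

/-- `φ` is the inverse of a local coordinate at the root `v` of `p` in which `p` is the `m`-th
power. -/
structure IsLocalForm (p : ℂ[X]) (v : ℂ) (m : ℕ) (φ : ℂ → ℂ) (ρ : ℝ) : Prop where
  pos : 0 < ρ
  zero : φ 0 = v
  deriv : ∃ c ≠ 0, HasDerivAt φ c 0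
  continuousOn : ContinuousOn φ (Metric.ball 0 ρ)
  eval_eq : ∀ w, w ∈ Metric.ball 0 ρ → p.eval (φ w) = w ^ m
  injOn : Set.InjOn φ (Metric.ball 0 ρ)
  surj : ∀ᶠ z in 𝓝 v, ∃ w ∈ Metric.ball 0 ρ, φ w = z

/-- Write p = (z - v)^m q with q(v) ≠ 0. The local coordinate is (z - v) times an m-th root of q;
its derivative at v is nonzero, so it has a local inverse φ. -/
theorem exists_isLocalForm {p : ℂ[X]} (hp : p ≠ 0) {v : ℂ} (hv : p.eval v = 0) :
    ∃ φ ρ, IsLocalForm p v (p.rootMultiplicity v) φ ρ := by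
  set m := p.rootMultiplicity v with hm
  have hm0 : m ≠ 0 := ((rootMultiplicity_pos hp).2 hv).ne'
  obtain ⟨q, hq, hqv⟩ := exists_eq_pow_rootMultiplicity_mul_and_not_dvd p hp v
  have hqv' : q.eval v ≠ 0 := fun h => hqv (dvd_iff_isRoot.2 h)
  rw [← hm] at hq
  set κ : ℂ := (q.eval v) ^ (m : ℂ)⁻¹ with hκ
  have hκm : κ ^ m = q.eval v := Complex.cpow_nat_inv_pow _ hm0
  have hκ0 : κ ≠ 0 := fun h => hqv' (by rw [← hκm, h, zero_pow hm0])
  -- Dividing by q(v) keeps the base of the power near 1, where the principal branch is holomorphic.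
  set g : ℂ → ℂ := fun z => κ * (q.eval z / q.eval v) ^ (m : ℂ)⁻¹ with hg
  have hgv : g v = κ := by simp [hg, hqv']
  set ψ : ℂ → ℂ := fun z => (z - v) * g z with hψ
  have hψm : ∀ z, ψ z ^ m = p.eval z := by
    intro z
    simp only [hψ, hg, mul_pow, hκm, Complex.cpow_nat_inv_pow _ hm0]
    conv_rhs => rw [hq]
    simp only [eval_mul, eval_pow, eval_sub, eval_X, eval_C]
    field_simp
  obtain ⟨g', hg'⟩ : ∃ g', HasStrictDerivAt g g' v := by
    have h1 : HasStrictDerivAt (fun z => q.eval z / q.eval v) (q.derivative.eval v / q.eval v) v :=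
      (q.hasStrictDerivAt v).div_const _
    refine ⟨_, (h1.cpow_const (c := (m : ℂ)⁻¹) ?_).const_mul κ⟩
    rw [div_self hqv']
    exact Complex.one_mem_slitPlane
  have hψd : HasStrictDerivAt ψ κ v := by
    have := HasStrictDerivAt.fun_mul ((hasStrictDerivAt_id v).sub_const v) hg'
    simpa [hgv] using this
  have hψv : ψ v = 0 := by simp [hψ]
  set E := (hψd.hasStrictFDerivAt_equiv hκ0).toOpenPartialHomeomorph ψ with hE
  have hEψ : ∀ z, E z = ψ z := fun z => rfl
  have hvs : v ∈ E.source := (hψd.hasStrictFDerivAt_equiv hκ0).mem_toOpenPartialHomeomorph_source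
  have h0t : (0 : ℂ) ∈ E.target := by
    have := E.map_source hvs
    rwa [hEψ, hψv] at this
  obtain ⟨ρ, hρ, hball⟩ := Metric.isOpen_iff.1 E.open_target 0 h0t
  refine ⟨E.symm, ρ, hρ, ?_, ⟨κ⁻¹, inv_ne_zero hκ0, ?_⟩, E.continuousOn_symm.mono hball,
    fun w hw => ?_, E.symm.injOn.mono hball, ?_⟩
  · rw [← hψv, ← hEψ, E.left_inv hvs]
  · have := (hψd.to_localInverse hκ0).hasDerivAt
    rwa [hψv] at this
  · rw [← hψm, ← hEψ, E.right_inv (hball hw)]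
  · have h1 : ∀ᶠ z in 𝓝 v, E z ∈ Metric.ball (0 : ℂ) ρ :=
      (E.continuousAt hvs).eventually (by
        rw [hEψ, hψv]
        exact Metric.ball_mem_nhds 0 hρ)
    filter_upwards [h1, E.open_source.mem_nhds hvs] with z hz hzs
    exact ⟨E z, hz, E.left_inv hzs⟩

theorem starConvex_slit_ball {ε : ℝ} (hε : 0 < ε) :
    StarConvex ℝ ((ε / 2 : ℝ) : ℂ) (Complex.slitPlane ∩ Metric.ball 0 ε) := by
  refine (Complex.starConvex_ofReal_slitPlane (by positivity)).inter
    ((convex_ball 0 ε).starConvex ?_)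
  simp [abs_of_pos hε, hε]

theorem isPreconnected_slit_ball {ε : ℝ} (hε : 0 < ε) :
    IsPreconnected (Complex.slitPlane ∩ Metric.ball (0 : ℂ) ε) := by
  refine ((starConvex_slit_ball hε).isPathConnected ⟨?_, ?_⟩).isConnected.isPreconnected
  · exact Complex.ofReal_mem_slitPlane.2 (by positivity)
  · simp [abs_of_pos hε, hε]

theorem slit_ball_subset {ε : ℝ} (hε : ε ≤ 1) :
    Complex.slitPlane ∩ Metric.ball (0 : ℂ) ε ⊆ midDomain := by
  rintro t ⟨h1 | h1, h2⟩
  · refine Or.inr ⟨h1, ?_⟩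
    have h3 : ‖t‖ < ε := by simpa using h2
    linarith [(le_abs_self t.re).trans (Complex.abs_re_le_norm t)]
  · exact Or.inl h1

theorem norm_root_lt {m : ℕ} (hm : m ≠ 0) {ρ : ℝ} (hρ : 0 < ρ) {t : ℂ} (ht : ‖t‖ < ρ ^ m) {ω : ℂ}
    (hω : ω ^ m = 1) : ω * t ^ (m : ℂ)⁻¹ ∈ Metric.ball (0 : ℂ) ρ := by
  rw [mem_ball_zero_iff]
  refine lt_of_pow_lt_pow_left₀ m hρ.le ?_
  rw [← norm_pow, mul_pow, hω, one_mul, Complex.cpow_nat_inv_pow _ hm]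
  exact ht

/-- The branch of index `ω` of the inverse of `p` near the root `v`. -/
theorem IsLocalForm.isSection {p : ℂ[X]} {v : ℂ} {m : ℕ} {φ : ℂ → ℂ} {ρ : ℝ}
    (hφ : IsLocalForm p v m φ ρ) (hm : m ≠ 0) {ω : ℂ} (hω : ω ^ m = 1) :
    IsSection p (Complex.slitPlane ∩ Metric.ball 0 (ρ ^ m)) fun t => φ (ω * t ^ (m : ℂ)⁻¹) := by
  refine ⟨hφ.continuousOn.comp (fun t ht => ?_) fun t ht => ?_, fun t ht => ?_⟩
  · exact (continuousAt_const.mul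
      (continuousAt_id.cpow continuousAt_const ht.1)).continuousWithinAt
  · exact norm_root_lt hm hφ.pos (by simpa using ht.2) hω
  · rw [hφ.eval_eq _ (norm_root_lt hm hφ.pos (by simpa using ht.2) hω), mul_pow, hω, one_mul,
      Complex.cpow_nat_inv_pow _ hm]

/-! ### Edges and sheets -/

theorem IsShabat.ne_zero {p : ℂ[X]} (hp : IsShabat p) : p ≠ 0 := by
  rintro rfl
  have h : (1 : ℂ) ∈ (fun z => (0 : ℂ[X]).eval z) '' {z | (0 : ℂ[X]).derivative.eval z = 0} := by
    rw [hp]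
    simp
  obtain ⟨z, -, hz⟩ := h
  simp at hz

/-- Multiplying values by `-1` and adding `1` exchanges the two critical values. -/
theorem IsShabat.reflect {p q : ℂ[X]} (hp : IsShabat p) (h : q = 1 - p) : IsShabat q := by
  subst h
  have e : {z : ℂ | (1 - p).derivative.eval z = 0} = {z | p.derivative.eval z = 0} := by
    ext z
    simp
  unfold IsShabat at *
  rw [e]
  have : (fun z => (1 - p).eval z) = (fun y => 1 - y) ∘ fun z => p.eval z := by
    funext z
    simp
  rw [this, Set.image_comp, hp]
  ext y
  simp only [Set.mem_image, Set.mem_insert_iff, Set.mem_singleton_iff]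
  constructor
  · rintro ⟨x, rfl | rfl, rfl⟩ <;> simp
  · rintro (rfl | rfl)
    · exact ⟨1, by simp⟩
    · exact ⟨0, by simp⟩

/-- A continuous branch of the inverse of a polynomial over `(0, 1)` has a limit at `0`. -/
theorem exists_tendsto_zero {p : ℂ[X]} (hp : p ≠ 0) {f : ℝ → ℂ} (hf : ContinuousOn f (Set.Ioo 0 1))
    (hpf : ∀ t ∈ Set.Ioo (0 : ℝ) 1, p.eval (f t) = t) : ∃ v, Tendsto f (𝓝[>] 0) (𝓝 v) := by
  classical
  have hsp : p.Splits := IsAlgClosed.splits p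
  have hlc : 0 < ‖p.leadingCoeff‖ := by simpa using hp
  -- points with small value are close to roots
  have hclose : ∀ δ > 0, ∃ η > 0, ∀ z : ℂ, ‖p.eval z‖ < η → ∃ r ∈ p.roots, ‖z - r‖ < δ := by
    intro δ hδ
    refine ⟨‖p.leadingCoeff‖ * δ ^ p.roots.card, by positivity, fun z hz => ?_⟩
    by_contra! hcon
    rw [hsp.eval_eq_prod_roots z, norm_mul] at hz
    have hz' := lt_of_mul_lt_mul_left hz hlc.le
    have : ∀ s : Multiset ℂ, (∀ r ∈ s, δ ≤ ‖z - r‖) →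
        δ ^ s.card ≤ ‖(s.map (fun r => z - r)).prod‖ := by
      intro s
      induction s using Multiset.induction with
      | empty => simp
      | cons a s ih =>
        intro hs
        rw [Multiset.card_cons, Multiset.map_cons, Multiset.prod_cons, norm_mul, pow_succ']
        exact mul_le_mul (hs a (by simp)) (ih fun r hr => hs r (by simp [hr])) (by positivity)
          (norm_nonneg _)
    exact absurd (this _ hcon) (not_le.2 hz')
  -- the roots are separated
  obtain ⟨δ₀, hδ₀, hsep⟩ : ∃ δ₀ > 0, ∀ r ∈ p.roots, ∀ r' ∈ p.roots, r ≠ r' →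
      2 * δ₀ ≤ ‖r - r'‖ := by
    by_cases hne : (p.roots.toFinset.offDiag).Nonempty
    · obtain ⟨⟨a, b⟩, hab, hmin⟩ := Finset.exists_min_image _ (fun x : ℂ × ℂ => ‖x.1 - x.2‖) hne
      rw [Finset.mem_offDiag] at hab
      refine ⟨‖a - b‖ / 2, half_pos (norm_pos_iff.2 (sub_ne_zero.2 hab.2.2)), ?_⟩
      intro r hr r' hr' hrr
      have := hmin (r, r') (Finset.mem_offDiag.2
        ⟨Multiset.mem_toFinset.2 hr, Multiset.mem_toFinset.2 hr', hrr⟩)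
      simp only at this
      linarith
    · refine ⟨1, one_pos, fun r hr r' hr' hrr => (hne ⟨(r, r'), Finset.mem_offDiag.2
        ⟨Multiset.mem_toFinset.2 hr, Multiset.mem_toFinset.2 hr', hrr⟩⟩).elim⟩
  obtain ⟨η₀, hη₀, hcl₀⟩ := hclose δ₀ hδ₀
  set η := min η₀ 1
  have hη : 0 < η := lt_min hη₀ one_pos
  have hsub : Set.Ioo 0 η ⊆ Set.Ioo (0 : ℝ) 1 := fun t ht => ⟨ht.1, ht.2.trans_le (min_le_right _ _)⟩
  have hsmall : ∀ t ∈ Set.Ioo 0 η, ‖p.eval (f t)‖ = t := fun t ht => by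
    rw [hpf t (hsub ht), Complex.norm_real, Real.norm_eq_abs, abs_of_pos ht.1]
  have hmid : η / 2 ∈ Set.Ioo 0 η := ⟨by linarith, by linarith⟩
  obtain ⟨v, hv, hv'⟩ := hcl₀ (f (η / 2)) (by
    rw [hsmall _ hmid]
    exact hmid.2.trans_le (min_le_left _ _))
  -- The image is connected and covered by balls about the roots, which are disjoint from the ball
  -- about v, so it cannot leave the latter.
  have hball : f '' Set.Ioo 0 η ⊆ Metric.ball v δ₀ := by
    refine (isPreconnected_Ioo.image f (hf.mono hsub)).subset_left_of_subset_union
      Metric.isOpen_ball (v := ⋃ r ∈ {r | r ∈ p.roots ∧ r ≠ v}, Metric.ball r δ₀)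
      (isOpen_biUnion fun _ _ => Metric.isOpen_ball) ?_ ?_ ?_
    · rw [Set.disjoint_left]
      intro z hz hz'
      simp only [Set.mem_iUnion, Metric.mem_ball, dist_eq_norm] at hz hz'
      obtain ⟨r, ⟨hr, hrv⟩, hzr⟩ := hz'
      have h1 := hsep r hr v hv hrv
      have h2 : ‖r - v‖ ≤ ‖z - v‖ + ‖z - r‖ := by
        rw [show r - v = (z - v) - (z - r) by ring]
        exact norm_sub_le _ _
      linarith
    · rintro _ ⟨t, ht, rfl⟩
      obtain ⟨r, hr, hr'⟩ := hcl₀ (f t) (by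
        rw [hsmall _ ht]
        exact ht.2.trans_le (min_le_left _ _))
      by_cases hrv : r = v
      · left
        subst hrv
        simpa [dist_eq_norm] using hr'
      · right
        simp only [Set.mem_iUnion, Metric.mem_ball, dist_eq_norm]
        exact ⟨r, ⟨hr, hrv⟩, hr'⟩
    · exact ⟨f (η / 2), ⟨_, hmid, rfl⟩, by simpa [dist_eq_norm] using hv'⟩
  refine ⟨v, Metric.tendsto_nhds.2 fun δ hδ => ?_⟩
  obtain ⟨η₁, hη₁, hcl₁⟩ := hclose (min δ δ₀) (lt_min hδ hδ₀)
  have hIoo : Set.Ioo 0 (min η η₁) ∈ 𝓝[>] (0 : ℝ) := Ioo_mem_nhdsGT (lt_min hη hη₁)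
  filter_upwards [hIoo] with t ht
  have htη : t ∈ Set.Ioo 0 η := ⟨ht.1, ht.2.trans_le (min_le_left _ _)⟩
  obtain ⟨r, hr, hr'⟩ := hcl₁ (f t) (by
    rw [hsmall _ htη]
    exact ht.2.trans_le (min_le_right _ _))
  by_cases hrv : r = v
  · subst hrv
    rw [dist_eq_norm]
    exact hr'.trans_le (min_le_left _ _)
  · exfalso
    have h0 : ‖f t - v‖ < δ₀ := by simpa [dist_eq_norm] using hball ⟨t, htη, rfl⟩
    have h1 := hsep r hr v hv hrv
    have h2 : ‖r - v‖ ≤ ‖f t - v‖ + ‖f t - r‖ := by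
      rw [show r - v = (f t - v) - (f t - r) by ring]
      exact norm_sub_le _ _
    linarith [min_le_right δ δ₀]

theorem isPreconnected_midDomain : IsPreconnected midDomain :=
  (starConvex_midDomain.isPathConnected (Or.inr (by norm_num))).isConnected.isPreconnected

/-- `f` is the holomorphic continuation of the edge `s` to the middle slit plane. -/
structure IsSheet {p : ℂ[X]} (s : ShabatEdge p) (f : ℂ → ℂ) : Prop where
  isSection : IsSection p midDomain f
  eq : ∀ t : unitInterval, t ∈ Set.Ioo 0 1 → f ((t : ℝ) : ℂ) = s.1 t

theorem ofReal_mem_midDomain {t : unitInterval} (ht : t ∈ Set.Ioo (0 : unitInterval) 1) :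
    ((t : ℝ) : ℂ) ∈ midDomain :=
  Or.inr ⟨by simpa using! ht.1, by simpa using! ht.2⟩

theorem dense_Ioo : Dense (Set.Ioo (0 : unitInterval) 1) := by
  rw [dense_iff_closure_eq, closure_Ioo (by simp)]
  exact Set.eq_univ_of_forall fun t => ⟨unitInterval.nonneg', unitInterval.le_one'⟩

/-- The middle of the unit interval. -/
noncomputable def half : unitInterval := ⟨1 / 2, by norm_num, by norm_num⟩

theorem half_mem : half ∈ Set.Ioo (0 : unitInterval) 1 := by
  constructor
  · rw [← Subtype.coe_lt_coe]
    norm_num [half]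
  · rw [← Subtype.coe_lt_coe]
    norm_num [half]

/-- Unique lifting holds on the open interval, where the values avoid 0 and 1; density carries the
equality to the end points. -/
theorem IsSheet.edge_eqOn {p : ℂ[X]} (hp : IsShabat p) (s : ShabatEdge p) {f : C(unitInterval, ℂ)}
    (hf : ∀ t ∈ Set.Ioo (0 : unitInterval) 1, p.eval (f t) = ((t : ℝ) : ℂ)) {t : unitInterval}
    (ht : t ∈ Set.Ioo 0 1) (h : s.1 t = f t) : s.1 = f := by
  have : Set.EqOn s.1 f (Set.Ioo 0 1) := eqOn_of_eval_eq hp isPreconnected_Ioo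
    s.1.continuous.continuousOn f.continuous.continuousOn
    (fun a ha => by rw [s.2 a, hf a ha])
    (fun a ha => by rw [s.2 a]; exact midDomain_subset (ofReal_mem_midDomain ha)) ht h
  ext t
  exact congrFun (Continuous.ext_on dense_Ioo s.1.continuous f.continuous this) t

theorem edge_ext {p : ℂ[X]} (hp : IsShabat p) {s s' : ShabatEdge p} {t : unitInterval}
    (ht : t ∈ Set.Ioo 0 1) (h : s.1 t = s'.1 t) : s = s' :=
  Subtype.ext (IsSheet.edge_eqOn hp s (fun t _ => s'.2 t) ht h)

theorem exists_isSheet {p : ℂ[X]} (hp : IsShabat p) (s : ShabatEdge p) : ∃ f, IsSheet s f := by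
  have hm := ofReal_mem_midDomain half_mem
  obtain ⟨f, hf, h0⟩ := exists_isSection hp isOpen_midDomain starConvex_midDomain midDomain_subset
    hm (s.2 half)
  refine ⟨f, hf, fun t ht => ?_⟩
  refine eqOn_of_eval_eq hp (isPreconnected_Ioo (a := (0 : unitInterval)) (b := 1))
    (f := fun t : unitInterval => f ((t : ℝ) : ℂ)) (g := s.1) ?_ s.1.continuous.continuousOn
    (fun a ha => ?_) (fun a ha => ?_) half_mem h0 ht
  · exact hf.continuousOn.comp
      (Complex.continuous_ofReal.comp continuous_subtype_val).continuousOn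
      fun a ha => ofReal_mem_midDomain ha
  · rw [hf.eval_eq _ (ofReal_mem_midDomain ha), s.2 a]
  · rw [hf.eval_eq _ (ofReal_mem_midDomain ha)]
    exact midDomain_subset (ofReal_mem_midDomain ha)

/-- Every section over the middle slit plane continues an edge. -/
theorem exists_edge {p : ℂ[X]} (hp : IsShabat p) {f : ℂ → ℂ} (hf : IsSection p midDomain f) :
    ∃ s : ShabatEdge p, IsSheet s f := by
  have hmem : ∀ t ∈ Set.Ioo (0 : ℝ) 1, ((t : ℝ) : ℂ) ∈ midDomain := fun t ht =>
    Or.inr ⟨by simpa using ht.1, by simpa using ht.2⟩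
  have hcont : ContinuousOn (fun t : ℝ => f t) (Set.Ioo 0 1) :=
    hf.continuousOn.comp Complex.continuous_ofReal.continuousOn hmem
  obtain ⟨v, hv⟩ := exists_tendsto_zero (IsShabat.ne_zero hp) hcont
    (fun t ht => hf.eval_eq _ (hmem t ht))
  have hmaps : Set.MapsTo (fun t : ℝ => 1 - t) (Set.Ioo 0 1) (Set.Ioo 0 1) := fun t ht =>
    ⟨by linarith [ht.2], by linarith [ht.1]⟩
  -- The limit at the black end is the limit at the white end for 1 - p, with the edge run through
  -- backwards.
  obtain ⟨w, hw⟩ := exists_tendsto_zero (p := 1 - p) (f := fun t : ℝ => f ((1 - t : ℝ) : ℂ))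
    (IsShabat.ne_zero (IsShabat.reflect hp rfl))
    (hcont.comp (continuous_const.sub continuous_id).continuousOn hmaps)
    (fun t ht => by
      rw [eval_sub, hf.eval_eq _ (hmem _ (hmaps ht))]
      simp)
  have hw' : Tendsto (fun t : ℝ => f t) (𝓝[<] 1) (𝓝 w) := by
    have h1 : Tendsto (fun t : ℝ => 1 - t) (𝓝[<] 1) (𝓝[>] 0) := by
      refine tendsto_nhdsWithin_iff.2 ⟨?_, ?_⟩
      · have : Tendsto (fun t : ℝ => 1 - t) (𝓝 1) (𝓝 (1 - 1)) :=
          (continuous_const.sub continuous_id).tendsto 1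
        rw [sub_self] at this
        exact this.mono_left nhdsWithin_le_nhds
      · filter_upwards [self_mem_nhdsWithin] with t ht
        simpa using ht
    have := hw.comp h1
    refine this.congr fun t => ?_
    simp
  have hext := continuousOn_Icc_extendFrom_Ioo hcont hv hw'
  have heq : ∀ t ∈ Set.Ioo (0 : ℝ) 1, extendFrom (Set.Ioo 0 1) (fun t : ℝ => f t) t = f t :=
    fun t ht => extendFrom_extends hcont t ht
  let g : C(unitInterval, ℂ) :=
    ⟨fun t => extendFrom (Set.Ioo 0 1) (fun t : ℝ => f t) t, by
      exact continuousOn_iff_continuous_domRestrict.1 hext⟩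
  have hg : ∀ t ∈ Set.Ioo (0 : unitInterval) 1, g t = f ((t : ℝ) : ℂ) := fun t ht =>
    heq t ⟨ht.1, ht.2⟩
  refine ⟨⟨g, fun t => ?_⟩, hf, fun t ht => (hg t ht).symm⟩
  have : (fun t => p.eval (g t)) = fun t : unitInterval => ((t : ℝ) : ℂ) :=
    Continuous.ext_on dense_Ioo (p.continuous.comp g.continuous)
      (Complex.continuous_ofReal.comp continuous_subtype_val) fun t ht => by
        simp only [hg t ht]
        exact hf.eval_eq _ (ofReal_mem_midDomain ht)
  exact congrFun this t

/-- Near its white end, the edge `s` is the image under `φ` of the ray through the root of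
unity `ω`. -/
def HasIndex {p : ℂ[X]} (φ : ℂ → ℂ) (m : ℕ) (ε : ℝ) (s : ShabatEdge p) (ω : ℂ) : Prop :=
  ω ^ m = 1 ∧ ∀ t : unitInterval, 0 < t → (t : ℝ) < ε →
    s.1 t = φ (ω * ((t : ℝ) : ℂ) ^ (m : ℂ)⁻¹)

/-! ### Edges at a white vertex as roots of unity -/

section LocalForm

variable {p : ℂ[X]} {v : ℂ} {m : ℕ} {φ : ℂ → ℂ} {ρ ε : ℝ}

theorem ofReal_mem_slit_ball {t : unitInterval} (h0 : 0 < t) (h1 : (t : ℝ) < ε) :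
    ((t : ℝ) : ℂ) ∈ Complex.slitPlane ∩ Metric.ball (0 : ℂ) ε := by
  have : (0 : ℝ) < t := h0
  refine ⟨Complex.ofReal_mem_slitPlane.2 this, ?_⟩
  simpa [abs_of_pos this] using h1

theorem isPreconnected_Ioo_val (ε : ℝ) :
    IsPreconnected {t : unitInterval | 0 < t ∧ (t : ℝ) < ε} := by
  refine Set.OrdConnected.isPreconnected ⟨fun x hx y hy z hz => ⟨hx.1.trans_le hz.1, ?_⟩⟩
  exact lt_of_le_of_lt hz.2 hy.2

theorem exists_small (hε : 0 < ε) : ∃ t : unitInterval, 0 < t ∧ (t : ℝ) < ε := by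
  refine ⟨⟨min (ε / 2) 1, by positivity, min_le_right _ _⟩, ?_, ?_⟩
  · rw [← Subtype.coe_lt_coe]
    exact lt_min (half_pos hε) one_pos
  · exact (min_le_left _ _).trans_lt (by linarith)

theorem continuousOn_ray (hφ : IsLocalForm p v m φ ρ) (hm : m ≠ 0) (hερ : ε ≤ ρ ^ m) {ω : ℂ}
    (hω : ω ^ m = 1) : ContinuousOn (fun t : unitInterval => φ (ω * ((t : ℝ) : ℂ) ^ (m : ℂ)⁻¹))
      {t : unitInterval | 0 < t ∧ (t : ℝ) < ε} :=
  (hφ.isSection hm hω).continuousOn.comp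
    (Complex.continuous_ofReal.comp continuous_subtype_val).continuousOn
    fun _ ht => Set.inter_subset_inter_right _ (Metric.ball_subset_ball hερ)
      (ofReal_mem_slit_ball ht.1 ht.2)

/-- Close to v the edge has the form φ(w) with w^m = t, so w is a root of unity times the principal
root of t. Unique lifting propagates this from one t to all t < ε. -/
theorem exists_hasIndex (hp : IsShabat p) (hφ : IsLocalForm p v m φ ρ) (hm : m ≠ 0) (hε : 0 < ε)
    (hε1 : ε ≤ 1) (hερ : ε ≤ ρ ^ m) {s : ShabatEdge p} (hs : s.1 0 = v) :
    ∃ ω, HasIndex φ m ε s ω := by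
  have h1 : ∀ᶠ t : unitInterval in 𝓝 (0 : unitInterval), ∃ w ∈ Metric.ball 0 ρ, φ w = s.1 t :=
    (s.1.continuous.tendsto 0).eventually (by rw [hs]; exact hφ.surj)
  have h2 : ∀ᶠ t : unitInterval in 𝓝 (0 : unitInterval), (t : ℝ) < ε :=
    (continuous_subtype_val.tendsto (0 : unitInterval)).eventually (gt_mem_nhds hε)
  have h3 : ∃ᶠ t in 𝓝 (0 : unitInterval), 0 < t := by
    rw [frequently_iff]
    intro U hU
    obtain ⟨t, ht, ht'⟩ := mem_closure_iff_nhds.1 (dense_Ioo 0) U hU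
    exact ⟨t, ht, ht'.1⟩
  obtain ⟨t, ht0, ⟨w, hw, hws⟩, htε⟩ := (h3.and_eventually (h1.and h2)).exists
  have hwm : w ^ m = ((t : ℝ) : ℂ) := by
    rw [← hφ.eval_eq w hw, hws, s.2 t]
  have ht0' : ((t : ℝ) : ℂ) ≠ 0 := by
    have : (0 : ℝ) < t := ht0
    exact_mod_cast this.ne'
  set τ : ℂ := ((t : ℝ) : ℂ) ^ (m : ℂ)⁻¹ with hτ
  have hτm : τ ^ m = ((t : ℝ) : ℂ) := Complex.cpow_nat_inv_pow _ hm
  have hτ0 : τ ≠ 0 := fun h => ht0' (by rw [← hτm, h, zero_pow hm])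
  have hωm : (w / τ) ^ m = 1 := by rw [div_pow, hwm, hτm, div_self ht0']
  refine ⟨w / τ, hωm, fun u hu0 huε => ?_⟩
  have hmem : ∀ a : unitInterval, 0 < a → (a : ℝ) < ε →
      ((a : ℝ) : ℂ) ∈ Complex.slitPlane ∩ Metric.ball (0 : ℂ) (ρ ^ m) := fun a h h' =>
    ofReal_mem_slit_ball h (h'.trans_le hερ)
  refine eqOn_of_eval_eq hp (isPreconnected_Ioo_val ε) s.1.continuous.continuousOn
    (continuousOn_ray hφ hm hερ hωm)
    (fun a ha => ?_) (fun a ha => ?_) (a := t) ⟨ht0, htε⟩ ?_ ⟨hu0, huε⟩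
  · rw [s.2 a]
    exact ((hφ.isSection hm hωm).eval_eq _ (hmem a ha.1 ha.2)).symm
  · rw [s.2 a]
    exact midDomain_subset (slit_ball_subset hε1 (ofReal_mem_slit_ball ha.1 ha.2))
  · rw [← hws, ← hτ, div_mul_cancel₀ _ hτ0]

theorem HasIndex.sheet_eq (hp : IsShabat p) (hφ : IsLocalForm p v m φ ρ) (hm : m ≠ 0) (hε : 0 < ε)
    (hε1 : ε ≤ 1) (hερ : ε ≤ ρ ^ m) {s : ShabatEdge p} {ω : ℂ} (hs : HasIndex φ m ε s ω)
    {f : ℂ → ℂ} (hf : IsSheet s f) :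
    Set.EqOn f (fun t => φ (ω * t ^ (m : ℂ)⁻¹)) (Complex.slitPlane ∩ Metric.ball 0 ε) := by
  obtain ⟨t, ht0, ht1⟩ := exists_small hε
  refine (hf.isSection.mono (slit_ball_subset hε1)).eqOn hp (isPreconnected_slit_ball hε)
    ((slit_ball_subset hε1).trans midDomain_subset) ((hφ.isSection hm hs.1).mono
      (Set.inter_subset_inter_right _ (Metric.ball_subset_ball hερ)))
    (ofReal_mem_slit_ball ht0 ht1) ?_
  rw [hf.eq t ⟨ht0, ht1.trans_le hε1⟩, hs.2 t ht0 ht1]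

theorem tendsto_root (hm : m ≠ 0) : Tendsto (fun t : unitInterval => ((t : ℝ) : ℂ) ^ (m : ℂ)⁻¹)
    (𝓝[≠] 0) (𝓝[≠] 0) := by
  refine tendsto_nhdsWithin_iff.2 ⟨?_, ?_⟩
  · have hre : 0 < ((m : ℂ)⁻¹).re := by
      rw [← Complex.ofReal_natCast, ← Complex.ofReal_inv, Complex.ofReal_re]
      positivity
    have h1 : Continuous fun t : unitInterval => ((t : ℝ) : ℂ) ^ (m : ℂ)⁻¹ :=
      (Complex.continuous_ofReal_cpow_const hre).comp continuous_subtype_val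
    have := h1.tendsto 0
    rw [show ((0 : unitInterval) : ℝ) = 0 from rfl, Complex.ofReal_zero, Complex.zero_cpow
      (by simpa using hm)] at this
    exact this.mono_left nhdsWithin_le_nhds
  · filter_upwards [self_mem_nhdsWithin] with t ht h
    have h2 : ((t : ℝ) : ℂ) = 0 := by
      rw [← Complex.cpow_nat_inv_pow ((t : ℝ) : ℂ) hm, h, zero_pow hm]
    exact ht (Subtype.ext (by exact_mod_cast h2))

theorem eventually_small (hε : 0 < ε) :
    ∀ᶠ t : unitInterval in 𝓝[≠] (0 : unitInterval), 0 < t ∧ (t : ℝ) < ε := by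
  have h2 : ∀ᶠ t : unitInterval in 𝓝 (0 : unitInterval), (t : ℝ) < ε :=
    (continuous_subtype_val.tendsto (0 : unitInterval)).eventually (gt_mem_nhds hε)
  filter_upwards [self_mem_nhdsWithin, h2.filter_mono nhdsWithin_le_nhds] with t ht ht'
  exact ⟨unitInterval.pos_iff_ne_zero.2 ht, ht'⟩

theorem neBot_nhdsNE_zero : (𝓝[≠] (0 : unitInterval)).NeBot := by
  rw [← mem_closure_iff_nhdsWithin_neBot]
  exact closure_mono (fun t ht => ht.1.ne') (dense_Ioo 0)

theorem HasIndex.start (hφ : IsLocalForm p v m φ ρ) (hm : m ≠ 0) (hε : 0 < ε)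
    {s : ShabatEdge p} {ω : ℂ} (hs : HasIndex φ m ε s ω) : s.1 0 = v := by
  have := neBot_nhdsNE_zero
  have h1 : Tendsto s.1 (𝓝[≠] 0) (𝓝 (s.1 0)) :=
    (s.1.continuous.tendsto 0).mono_left nhdsWithin_le_nhds
  have h2 : Tendsto (fun t : unitInterval => φ (ω * ((t : ℝ) : ℂ) ^ (m : ℂ)⁻¹)) (𝓝[≠] 0)
      (𝓝 v) := by
    obtain ⟨c, -, hc⟩ := hφ.deriv
    have h3 := hc.continuousAt.tendsto
    rw [hφ.zero] at h3
    refine h3.comp ?_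
    have := ((tendsto_root hm).mono_right nhdsWithin_le_nhds).const_mul ω
    rwa [mul_zero] at this
  refine tendsto_nhds_unique h1 (h2.congr' ?_)
  filter_upwards [eventually_small hε] with t ht
  exact (hs.2 t ht.1 ht.2).symm

theorem HasIndex.edge_eq (hp : IsShabat p) (hε : 0 < ε) (hε1 : ε ≤ 1)
    {s s' : ShabatEdge p} {ω : ℂ} (hs : HasIndex φ m ε s ω) (hs' : HasIndex φ m ε s' ω) :
    s = s' := by
  obtain ⟨t, ht0, ht1⟩ := exists_small hε
  exact edge_ext hp ⟨ht0, ht1.trans_le hε1⟩ (by rw [hs.2 t ht0 ht1, hs'.2 t ht0 ht1])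

theorem HasIndex.unique (hφ : IsLocalForm p v m φ ρ) (hm : m ≠ 0) (hε : 0 < ε)
    (hερ : ε ≤ ρ ^ m) {s : ShabatEdge p} {ω ω' : ℂ} (hs : HasIndex φ m ε s ω)
    (hs' : HasIndex φ m ε s ω') : ω = ω' := by
  obtain ⟨t, ht0, ht1⟩ := exists_small hε
  have hn : ‖((t : ℝ) : ℂ)‖ < ρ ^ m := by
    have : (0 : ℝ) < t := ht0
    rw [Complex.norm_real, Real.norm_eq_abs, abs_of_pos this]
    exact ht1.trans_le hερ
  have h := hφ.injOn (norm_root_lt hm hφ.pos hn hs.1) (norm_root_lt hm hφ.pos hn hs'.1)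
    (by rw [← hs.2 t ht0 ht1, ← hs'.2 t ht0 ht1])
  refine mul_right_cancel₀ (fun h0 => ?_) h
  have h2 : ((t : ℝ) : ℂ) = 0 := by
    rw [← Complex.cpow_nat_inv_pow ((t : ℝ) : ℂ) hm, h0, zero_pow hm]
  have : (0 : ℝ) < t := ht0
  exact this.ne' (by exact_mod_cast h2)

/-- The local branch of index ω agrees with a section over the whole middle slit plane, and that
section comes from an edge. -/
theorem exists_edge_hasIndex (hp : IsShabat p) (hφ : IsLocalForm p v m φ ρ) (hm : m ≠ 0)
    (hε : 0 < ε) (hε1 : ε ≤ 1) (hερ : ε ≤ ρ ^ m) {ω : ℂ} (hω : ω ^ m = 1) :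
    ∃ s : ShabatEdge p, HasIndex φ m ε s ω := by
  have hsec := (hφ.isSection hm hω).mono
    (Set.inter_subset_inter_right Complex.slitPlane (Metric.ball_subset_ball hερ))
  obtain ⟨t, ht0, ht1⟩ := exists_small hε
  have hmem := ofReal_mem_slit_ball ht0 ht1
  obtain ⟨f, hf, hft⟩ := exists_isSection hp isOpen_midDomain starConvex_midDomain midDomain_subset
    (slit_ball_subset hε1 hmem) (hsec.eval_eq _ hmem)
  obtain ⟨s, hs⟩ := exists_edge hp hf
  refine ⟨s, hω, fun u hu0 hu1 => ?_⟩
  rw [← hs.eq u ⟨hu0, hu1.trans_le hε1⟩]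
  exact (hf.mono (slit_ball_subset hε1)).eqOn hp (isPreconnected_slit_ball hε)
    ((slit_ball_subset hε1).trans midDomain_subset) hsec hmem hft (ofReal_mem_slit_ball hu0 hu1)

theorem norm_eq_one_of_pow {ω : ℂ} (hm : m ≠ 0) (hω : ω ^ m = 1) : ‖ω‖ = 1 :=
  (pow_eq_one_iff_of_nonneg (norm_nonneg _) hm).1 (by rw [← norm_pow, hω, norm_one])

theorem arg_coe_angle_eq_iff_exp {z : ℂ} (hz : ‖z‖ = 1) (θ : ℝ) :
    ((Complex.arg z : ℝ) : Real.Angle) = (θ : Real.Angle) ↔ z = Complex.exp (θ * Complex.I) := by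
  have h : ((Complex.arg (Complex.exp (θ * Complex.I)) : ℝ) : Real.Angle) = θ := by
    rw [Complex.exp_mul_I, ← Complex.ofReal_cos, ← Complex.ofReal_sin]
    exact Complex.arg_cos_add_sin_mul_I_coe_angle θ
  rw [← h, Complex.arg_coe_angle_eq_iff]
  constructor
  · intro h
    exact Complex.ext_norm_arg (by rw [hz, Complex.norm_exp_ofReal_mul_I]) h
  · rintro rfl
    rfl

/-- φ has a nonzero derivative at 0, so it preserves angles: the quotient defining the angle tends
to ω'/ω. -/
theorem HasIndex.hasAngle_iff (hφ : IsLocalForm p v m φ ρ) (hm : m ≠ 0) (hε : 0 < ε)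
    {s s' : ShabatEdge p} {ω ω' : ℂ}
    (hs : HasIndex φ m ε s ω) (hs' : HasIndex φ m ε s' ω') (θ : ℝ) :
    HasAngle 0 s s' θ ↔ ω' = ω * Complex.exp (θ * Complex.I) := by
  have := neBot_nhdsNE_zero
  have hω0 : ω ≠ 0 := fun h => by simpa [h, hm] using hs.1
  have hω0' : ω' ≠ 0 := fun h => by simpa [h, hm] using hs'.1
  obtain ⟨c, hc0, hc⟩ := hφ.deriv
  have hslope : ∀ η : ℂ, η ≠ 0 → Tendsto (fun τ => (φ (η * τ) - v) / τ) (𝓝[≠] 0) (𝓝 (c * η)) := by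
    intro η hη
    have h1 : HasDerivAt (fun τ => φ (η * τ)) (c * η) 0 := by
      have h2 : HasDerivAt (fun τ : ℂ => η * τ) η 0 := by
        simpa using (hasDerivAt_id (0 : ℂ)).const_mul η
      exact HasDerivAt.comp (h₂ := φ) (0 : ℂ) (by simpa using hc) h2
    have h3 := hasDerivAt_iff_tendsto_slope.1 h1
    refine h3.congr fun τ => ?_
    rw [slope_def_field, mul_zero, hφ.zero, sub_zero]
  have hlim : Tendsto (fun t : unitInterval => (s'.1 t - s.1 0) / (s.1 t - s.1 0)) (𝓝[≠] 0)
      (𝓝 (ω' / ω)) := by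
    have h1 := ((hslope ω' hω0').div (hslope ω hω0) (mul_ne_zero hc0 hω0)).comp (tendsto_root hm)
    rw [mul_div_mul_left _ _ hc0] at h1
    refine h1.congr' ?_
    filter_upwards [eventually_small hε, (tendsto_root hm).eventually self_mem_nhdsWithin]
      with t ht ht0
    simp only [Function.comp, Pi.div_apply]
    rw [hs.start hφ hm hε, hs.2 t ht.1 ht.2, hs'.2 t ht.1 ht.2, div_div_div_cancel_right₀ ht0]
  have hne : ω' / ω ≠ 0 := div_ne_zero hω0' hω0
  have hang := (Complex.continuousAt_arg_coe_angle hne).tendsto.comp hlim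
  have hnorm : ‖ω' / ω‖ = 1 := by
    rw [norm_div, norm_eq_one_of_pow hm hs.1, norm_eq_one_of_pow hm hs'.1, div_one]
  have hiff : HasAngle 0 s s' θ ↔
      ((Complex.arg (ω' / ω) : ℝ) : Real.Angle) = (θ : Real.Angle) := by
    constructor
    · intro h
      exact tendsto_nhds_unique hang h
    · intro h
      unfold HasAngle
      rw [← h]
      exact hang
  rw [hiff, arg_coe_angle_eq_iff_exp hnorm, div_eq_iff hω0, mul_comm]

/-- The rotation by `2π/m`. -/
noncomputable def rot (m : ℕ) : ℂ := Complex.exp ((2 * Real.pi / m : ℝ) * Complex.I)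

theorem rot_pow (hm : m ≠ 0) : rot m ^ m = 1 := by
  have hmC : (m : ℂ) ≠ 0 := by exact_mod_cast hm
  rw [rot, ← Complex.exp_nat_mul, ← Complex.exp_two_pi_mul_I]
  congr 1
  push_cast
  field_simp

theorem isPrimitiveRoot_rot (hm : m ≠ 0) : IsPrimitiveRoot (rot m) m := by
  have := Complex.isPrimitiveRoot_exp m hm
  convert this using 1
  rw [rot]
  congr 1
  push_cast
  ring

/-- Positive angles between edges at v are multiples of 2π/m, and 2π/m itself occurs, so the next
edge is one step further among the m-th roots of unity. For m = 1 this step is the full turn back to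
the edge itself. -/
theorem HasIndex.isNextEdge_iff (hp : IsShabat p) (hφ : IsLocalForm p v m φ ρ) (hm : m ≠ 0)
    (hε : 0 < ε) (hε1 : ε ≤ 1) (hερ : ε ≤ ρ ^ m) {s s' : ShabatEdge p} {ω : ℂ}
    (hs : HasIndex φ m ε s ω) :
    IsNextEdge 0 s s' ↔ HasIndex φ m ε s' (ω * rot m) := by
  have hω0 : ω ≠ 0 := fun h => by simpa [h, hm] using hs.1
  have hm0 : (0 : ℝ) < m := by exact_mod_cast Nat.pos_of_ne_zero hm
  have hζ : (ω * rot m) ^ m = 1 := by rw [mul_pow, hs.1, rot_pow hm, one_mul]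
  have hmpos : 0 < 2 * Real.pi / m := div_pos Real.two_pi_pos hm0
  -- an angle between two edges is a multiple of `2π/m`
  have hangle : ∀ s'' : ShabatEdge p, ∀ θ : ℝ, s''.1 0 = s.1 0 → 0 < θ → HasAngle 0 s s'' θ →
      ∃ k : ℕ, 1 ≤ k ∧ θ = k * (2 * Real.pi / m) := by
    intro s'' θ h0 hθ hA
    obtain ⟨ω'', hs''⟩ := exists_hasIndex hp hφ hm hε hε1 hερ (h0.trans (hs.start hφ hm hε))
    rw [hs.hasAngle_iff hφ hm hε hs''] at hA
    have h1 : Complex.exp (θ * Complex.I) ^ m = 1 := by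
      have := hs''.1
      rwa [hA, mul_pow, hs.1, one_mul] at this
    rw [← Complex.exp_nat_mul, Complex.exp_eq_one_iff] at h1
    obtain ⟨k, hk⟩ := h1
    have h2 : (m : ℝ) * θ = k * (2 * Real.pi) := by
      have h3 : ((m : ℝ) * θ : ℂ) * Complex.I = (k * (2 * Real.pi) : ℂ) * Complex.I := by
        push_cast
        linear_combination hk
      exact_mod_cast mul_right_cancel₀ Complex.I_ne_zero h3
    have hk0 : 0 < k := by
      have : (0 : ℝ) < k * (2 * Real.pi) := by rw [← h2]; positivity
      have := pos_of_mul_pos_left this Real.two_pi_pos.le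
      exact_mod_cast this
    lift k to ℕ using hk0.le
    refine ⟨k, by exact_mod_cast hk0, ?_⟩
    push_cast at h2
    field_simp
    linarith
  constructor
  · rintro ⟨h0, θ, hθ0, -, hA, hmin⟩
    obtain ⟨k, hk1, hk⟩ := hangle s' θ h0 hθ0 hA
    obtain ⟨s₁, hs₁⟩ := exists_edge_hasIndex hp hφ hm hε hε1 hερ hζ
    have hk1' : k = 1 := by
      by_contra hne
      have hk2 : (2 : ℝ) ≤ k := by exact_mod_cast (by omega : 2 ≤ k)
      refine hmin s₁ ((hs₁.start hφ hm hε).trans (hs.start hφ hm hε).symm) (2 * Real.pi / m) hmpos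
        ?_ ((hs.hasAngle_iff hφ hm hε hs₁ _).2 rfl)
      rw [hk]
      nlinarith
    obtain ⟨ω', hs'⟩ := exists_hasIndex hp hφ hm hε hε1 hερ (h0.trans (hs.start hφ hm hε))
    have := (hs.hasAngle_iff hφ hm hε hs' θ).1 hA
    rw [hk, hk1', Nat.cast_one, one_mul] at this
    rw [this] at hs'
    exact hs'
  · intro hs'
    refine ⟨(hs'.start hφ hm hε).trans (hs.start hφ hm hε).symm, 2 * Real.pi / m, hmpos, ?_,
      (hs.hasAngle_iff hφ hm hε hs' _).2 rfl, fun s'' h0 θ hθ0 hθ hA => ?_⟩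
    · exact div_le_self Real.two_pi_pos.le (by exact_mod_cast Nat.pos_of_ne_zero hm)
    · obtain ⟨k, hk1, hk⟩ := hangle s'' θ h0 hθ0 hA
      have : (1 : ℝ) ≤ k := by exact_mod_cast hk1
      rw [hk] at hθ
      nlinarith

end LocalForm

/-! ### Turning about a white end -/

/-- The data of a local form at the white end of an edge. -/
theorem exists_localForm_edge {p : ℂ[X]} (hp : IsShabat p) (s : ShabatEdge p) :
    ∃ φ ρ ε ω, p.rootMultiplicity (s.1 0) ≠ 0 ∧
      IsLocalForm p (s.1 0) (p.rootMultiplicity (s.1 0)) φ ρ ∧ 0 < ε ∧ ε ≤ 1 ∧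
      ε ≤ ρ ^ p.rootMultiplicity (s.1 0) ∧
      HasIndex φ (p.rootMultiplicity (s.1 0)) ε s ω := by
  have hv : p.eval (s.1 0) = 0 := by
    rw [s.2 0]
    simp
  have hm : p.rootMultiplicity (s.1 0) ≠ 0 :=
    ((rootMultiplicity_pos (IsShabat.ne_zero hp)).2 hv).ne'
  obtain ⟨φ, ρ, hφ⟩ := exists_isLocalForm (IsShabat.ne_zero hp) hv
  have hε : 0 < min (ρ ^ p.rootMultiplicity (s.1 0)) 1 := lt_min (pow_pos hφ.pos _) one_pos
  obtain ⟨ω, hω⟩ := exists_hasIndex hp hφ hm hε (min_le_right _ _) (min_le_left _ _) (s := s) rfl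
  exact ⟨φ, ρ, _, ω, hm, hφ, hε, min_le_right _ _, min_le_left _ _, hω⟩

theorem exists_isNextEdge_zero {p : ℂ[X]} (hp : IsShabat p) (s : ShabatEdge p) :
    ∃ s', IsNextEdge 0 s s' := by
  obtain ⟨φ, ρ, ε, ω, hm, hφ, hε, hε1, hερ, hω⟩ := exists_localForm_edge hp s
  obtain ⟨s', hs'⟩ := exists_edge_hasIndex hp hφ hm hε hε1 hερ (ω := ω * rot _)
    (by rw [mul_pow, hω.1, rot_pow hm, one_mul])
  exact ⟨s', (hω.isNextEdge_iff hp hφ hm hε hε1 hερ).2 hs'⟩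

theorem isNextEdge_zero_unique {p : ℂ[X]} (hp : IsShabat p) {s s' s'' : ShabatEdge p}
    (h' : IsNextEdge 0 s s') (h'' : IsNextEdge 0 s s'') : s' = s'' := by
  obtain ⟨φ, ρ, ε, ω, hm, hφ, hε, hε1, hερ, hω⟩ := exists_localForm_edge hp s
  exact ((hω.isNextEdge_iff hp hφ hm hε hε1 hερ).1 h').edge_eq hp hε hε1
    ((hω.isNextEdge_iff hp hφ hm hε hε1 hερ).1 h'')

theorem isNextEdge_zero_injective {p : ℂ[X]} (hp : IsShabat p) {s s' r : ShabatEdge p}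
    (h : IsNextEdge 0 s r) (h' : IsNextEdge 0 s' r) : s = s' := by
  obtain ⟨φ, ρ, ε, ω, hm, hφ, hε, hε1, hερ, hω⟩ := exists_localForm_edge hp s
  have h0 : s'.1 0 = s.1 0 := h'.1.symm.trans h.1
  obtain ⟨ω', hω'⟩ := exists_hasIndex hp hφ hm hε hε1 hερ h0
  have h1 := (hω.isNextEdge_iff hp hφ hm hε hε1 hερ).1 h
  have h2 := (hω'.isNextEdge_iff hp hφ hm hε hε1 hερ).1 h'
  have h3 := mul_right_cancel₀ (Complex.exp_ne_zero _) (h1.unique hφ hm hε hερ h2)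
  rw [← h3] at hω'
  exact hω.edge_eq hp hε hε1 hω'

/-- The branch exp(πi/m) (-t)^(1/m) is continuous across the negative axis. Above that axis it is
the principal root; below it is the principal root turned by `rot m`, see `root_neg_of_im_neg`. This
is the monodromy of the m-th root around 0. -/
theorem root_neg_of_im_pos {t : ℂ} (m : ℕ) (ht : 0 < t.im) :
    Complex.exp (Real.pi / m * Complex.I) * (-t) ^ (m : ℂ)⁻¹ = t ^ (m : ℂ)⁻¹ := by
  have ht0 : t ≠ 0 := by
    rintro rfl
    simp at ht
  rw [Complex.cpow_def_of_ne_zero (neg_ne_zero.2 ht0), Complex.cpow_def_of_ne_zero ht0,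
    ← Complex.exp_add]
  congr 1
  simp only [Complex.log, norm_neg, Complex.arg_neg_eq_arg_sub_pi_of_im_pos ht]
  push_cast
  ring

theorem root_neg_of_im_neg {t : ℂ} (m : ℕ) (ht : t.im < 0) :
    Complex.exp (Real.pi / m * Complex.I) * (-t) ^ (m : ℂ)⁻¹ = rot m * t ^ (m : ℂ)⁻¹ := by
  have ht0 : t ≠ 0 := by
    rintro rfl
    simp at ht
  rw [Complex.cpow_def_of_ne_zero (neg_ne_zero.2 ht0), Complex.cpow_def_of_ne_zero ht0,
    ← Complex.exp_add, rot, ← Complex.exp_add]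
  congr 1
  simp only [Complex.log, norm_neg, Complex.arg_neg_eq_arg_add_pi_of_im_neg ht]
  push_cast
  ring

theorem isPreconnected_im_pos : IsPreconnected {t : ℂ | 0 < t.im} :=
  (convex_halfSpace_im_gt 0).isPreconnected

theorem isPreconnected_im_neg : IsPreconnected {t : ℂ | t.im < 0} :=
  (convex_halfSpace_im_lt 0).isPreconnected

/-- Analytic continuation around `0` takes the sheet of an edge to the sheet of the next edge. -/
theorem exists_continuation_zero {p : ℂ[X]} (hp : IsShabat p) {s s' : ShabatEdge p}
    (h : IsNextEdge 0 s s') {f f' : ℂ → ℂ} (hf : IsSheet s f) (hf' : IsSheet s' f') :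
    ∃ g, IsSection p leftDomain g ∧ (∀ t : ℂ, 0 < t.im → g t = f t) ∧
      ∀ t : ℂ, t.im < 0 → g t = f' t := by
  obtain ⟨φ, ρ, ε, ω, hm, hφ, hε, hε1, hερ, hω⟩ := exists_localForm_edge hp s
  have hω' := (hω.isNextEdge_iff hp hφ hm hε hε1 hερ).1 h
  have hs := hω.sheet_eq hp hφ hm hε hε1 hερ hf
  have hs' := hω'.sheet_eq hp hφ hm hε hε1 hερ hf'
  set m := p.rootMultiplicity (s.1 0) with hmdef
  set E : ℂ := Complex.exp (Real.pi / m * Complex.I) with hE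
  have hmC : (m : ℂ) ≠ 0 := by exact_mod_cast hm
  have hEm : E ^ m = -1 := by
    rw [hE, ← Complex.exp_nat_mul, ← Complex.exp_pi_mul_I]
    congr 1
    field_simp
  -- the middle of a small circle about `0`
  have hq : ∀ σ : ℝ, |σ| = 1 → ((σ * (ε / 2) : ℝ) * Complex.I : ℂ) ∈ Metric.ball (0 : ℂ) ε ∧
      ((σ * (ε / 2) : ℝ) * Complex.I : ℂ).im = σ * (ε / 2) := by
    intro σ hσ
    constructor
    · rw [mem_ball_zero_iff, norm_mul, Complex.norm_I, Complex.norm_real, Real.norm_eq_abs,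
        abs_mul, hσ, abs_of_pos (half_pos hε)]
      linarith
    · simp
  obtain ⟨hq1, hq2⟩ := hq 1 (by simp)
  obtain ⟨hr1, hr2⟩ := hq (-1) (by simp)
  set t₀ : ℂ := ((1 * (ε / 2) : ℝ) * Complex.I : ℂ)
  set t₁ : ℂ := ((-1 * (ε / 2) : ℝ) * Complex.I : ℂ)
  have him : 0 < t₀.im := by rw [hq2]; linarith
  have him1 : t₁.im < 0 := by rw [hr2]; linarith
  obtain ⟨g, hg, hg0⟩ := exists_isSection hp isOpen_leftDomain starConvex_leftDomain
    leftDomain_subset (t := t₀) (z := f t₀) (Or.inl him.ne')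
    (hf.isSection.eval_eq _ (Or.inl him.ne'))
  have hgf : ∀ t : ℂ, 0 < t.im → g t = f t := fun t ht =>
    (hg.mono (W := {t : ℂ | 0 < t.im}) fun t ht => Or.inl (ne_of_gt ht)).eqOn hp
      isPreconnected_im_pos (fun t ht => midDomain_subset (Or.inl (ne_of_gt ht)))
      (hf.isSection.mono fun t ht => Or.inl (ne_of_gt ht)) him hg0 ht
  refine ⟨g, hg, hgf, ?_⟩
  -- the branch of the root on the left slit disc
  set W : Set ℂ := {t : ℂ | -t ∈ Complex.slitPlane ∩ Metric.ball 0 ε}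
  have hWpre : IsPreconnected W := by
    have : W = (fun t : ℂ => -t) '' (Complex.slitPlane ∩ Metric.ball 0 ε) := by
      ext t
      constructor
      · intro ht
        exact ⟨-t, ht, neg_neg t⟩
      · rintro ⟨u, hu, rfl⟩
        simpa [W] using hu
    rw [this]
    exact (isPreconnected_slit_ball hε).image _ continuous_neg.continuousOn
  have hWL : W ⊆ leftDomain := by
    rintro t ⟨h1 | h1, -⟩
    · exact Or.inr (by simpa using h1)
    · exact Or.inl (by simpa using h1)
  have hball : ∀ t ∈ W, ω * (E * (-t) ^ (m : ℂ)⁻¹) ∈ Metric.ball (0 : ℂ) ρ := by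
    intro t ht
    rw [mem_ball_zero_iff]
    refine lt_of_pow_lt_pow_left₀ m hφ.pos.le ?_
    rw [← norm_pow, mul_pow, mul_pow, hω.1, hEm, Complex.cpow_nat_inv_pow _ hm]
    have h2 : ‖-t‖ < ε := by simpa using! ht.2
    simpa using h2.trans_le hερ
  have hsec : IsSection p W fun t => φ (ω * (E * (-t) ^ (m : ℂ)⁻¹)) := by
    refine ⟨hφ.continuousOn.comp (fun t ht => ?_) hball, fun t ht => ?_⟩
    · exact (continuousAt_const.mul (continuousAt_const.mul
        (continuousAt_neg.cpow continuousAt_const ht.1))).continuousWithinAt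
    · rw [hφ.eval_eq _ (hball t ht), mul_pow, mul_pow, hω.1, hEm, Complex.cpow_nat_inv_pow _ hm]
      ring
  have ht₀W : t₀ ∈ W := ⟨Or.inr (by simpa using him.ne'), by simpa using hq1⟩
  have ht₁W : t₁ ∈ W := ⟨Or.inr (by simpa using him1.ne), by simpa using hr1⟩
  -- The section g starts as f at t₀ above the axis, so it is this branch on the whole slit disc W.
  -- At t₁ below the axis the branch has index ω · `rot m`, which is the sheet f'.
  have hgW := (hg.mono hWL).eqOn hp hWpre (hWL.trans leftDomain_subset) hsec ht₀W (by
    simp only [root_neg_of_im_pos m him, hE]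
    rw [hg0]
    exact hs ⟨Or.inr him.ne', hq1⟩)
  have hg1 : g t₁ = f' t₁ := by
    rw [hgW ht₁W, hs' ⟨Or.inr him1.ne, hr1⟩]
    simp only [hE, root_neg_of_im_neg m him1, mul_assoc]
  exact fun t ht =>
    (hg.mono (W := {t : ℂ | t.im < 0}) fun t ht => Or.inl (ne_of_lt ht)).eqOn hp
      isPreconnected_im_neg (fun t ht => midDomain_subset (Or.inl (ne_of_lt ht)))
      (hf'.isSection.mono fun t ht => Or.inl (ne_of_lt ht)) him1 hg1 ht

/-! ### Reflection: exchanging white and black -/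

/-- The edges of `1 - p` are those of `p`, run through in the opposite direction. -/
noncomputable def reflectEdge {p q : ℂ[X]} (h : q = 1 - p) : ShabatEdge p ≃ ShabatEdge q where
  toFun s := ⟨s.1.comp ⟨unitInterval.symm, unitInterval.continuous_symm⟩, fun t => by
    subst h
    simp [s.2]⟩
  invFun s := ⟨s.1.comp ⟨unitInterval.symm, unitInterval.continuous_symm⟩, fun t => by
    have hp : p = 1 - q := by rw [h]; ring
    subst hp
    simp [s.2]⟩
  left_inv s := by
    apply Subtype.ext
    ext t
    simp
  right_inv s := by
    apply Subtype.ext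
    ext t
    simp

theorem reflectEdge_apply {p q : ℂ[X]} (h : q = 1 - p) (s : ShabatEdge p) (t : unitInterval) :
    (reflectEdge h s).1 t = s.1 (unitInterval.symm t) := rfl

theorem hasAngle_reflectEdge {p q : ℂ[X]} (h : q = 1 - p) (s s' : ShabatEdge p) (θ : ℝ) :
    HasAngle 0 (reflectEdge h s) (reflectEdge h s') θ ↔ HasAngle 1 s s' θ := by
  have hmap : Filter.map unitInterval.symm (𝓝[≠] 1) = 𝓝[≠] 0 := by
    have := unitInterval.symmHomeomorph.isEmbedding.map_nhdsWithin_eq {(1 : unitInterval)}ᶜ 1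
    have hset : unitInterval.symmHomeomorph '' {(1 : unitInterval)}ᶜ = {0}ᶜ := by
      rw [Set.image_compl_eq unitInterval.symmHomeomorph.bijective]
      simp
    rw [hset] at this
    have h1 : unitInterval.symmHomeomorph 1 = 0 := unitInterval.symm_one
    rwa [h1] at this
  unfold HasAngle
  rw [← hmap, tendsto_map'_iff]
  simp only [Function.comp_def, reflectEdge_apply, unitInterval.symm_symm, unitInterval.symm_zero]

theorem isNextEdge_reflectEdge {p q : ℂ[X]} (h : q = 1 - p) (s s' : ShabatEdge p) :
    IsNextEdge 0 (reflectEdge h s) (reflectEdge h s') ↔ IsNextEdge 1 s s' := by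
  unfold IsNextEdge
  simp only [hasAngle_reflectEdge, ← (reflectEdge h).forall_congr_right, reflectEdge_apply,
    unitInterval.symm_zero]

theorem exists_isNextEdge_one {p : ℂ[X]} (hp : IsShabat p) (s : ShabatEdge p) :
    ∃ s', IsNextEdge 1 s s' := by
  obtain ⟨s', hs'⟩ := exists_isNextEdge_zero (IsShabat.reflect hp rfl) (reflectEdge rfl s)
  obtain ⟨s', rfl⟩ := (reflectEdge rfl).surjective s'
  exact ⟨s', (isNextEdge_reflectEdge rfl s s').1 hs'⟩

theorem isNextEdge_one_unique {p : ℂ[X]} (hp : IsShabat p) {s s' s'' : ShabatEdge p}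
    (h' : IsNextEdge 1 s s') (h'' : IsNextEdge 1 s s'') : s' = s'' :=
  (reflectEdge rfl).injective (isNextEdge_zero_unique (IsShabat.reflect hp rfl)
    ((isNextEdge_reflectEdge rfl _ _).2 h') ((isNextEdge_reflectEdge rfl _ _).2 h''))

theorem isNextEdge_one_injective {p : ℂ[X]} (hp : IsShabat p) {s s' r : ShabatEdge p}
    (h : IsNextEdge 1 s r) (h' : IsNextEdge 1 s' r) : s = s' :=
  (reflectEdge rfl).injective (isNextEdge_zero_injective (IsShabat.reflect hp rfl)
    ((isNextEdge_reflectEdge rfl _ _).2 h) ((isNextEdge_reflectEdge rfl _ _).2 h'))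

theorem one_sub_mem_midDomain {t : ℂ} (ht : t ∈ midDomain) : 1 - t ∈ midDomain := by
  rcases ht with h | h
  · exact Or.inl (by simpa using h)
  · exact Or.inr ⟨by simpa using h.2, by simpa using h.1⟩

theorem IsSection.reflect {p q : ℂ[X]} (h : q = 1 - p) {V W : Set ℂ} {f : ℂ → ℂ}
    (hf : IsSection p V f) (hVW : ∀ t ∈ W, 1 - t ∈ V) : IsSection q W fun t => f (1 - t) where
  continuousOn := hf.continuousOn.comp (continuous_const.sub continuous_id).continuousOn hVW
  eval_eq t ht := by
    subst h
    simp [hf.eval_eq _ (hVW t ht)]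

theorem IsSheet.reflect {p q : ℂ[X]} (h : q = 1 - p) {s : ShabatEdge p} {f : ℂ → ℂ}
    (hf : IsSheet s f) : IsSheet (reflectEdge h s) fun t => f (1 - t) where
  isSection := hf.isSection.reflect h fun _ => one_sub_mem_midDomain
  eq t ht := by
    have := hf.eq (unitInterval.symm t) ⟨by
      rw [← Subtype.coe_lt_coe]
      have : (t : ℝ) < 1 := ht.2
      simpa using this, by
      rw [← Subtype.coe_lt_coe]
      have : (0 : ℝ) < t := ht.1
      simpa using this⟩
    rw [reflectEdge_apply, ← this]
    simp

/-- Obtained from the white case by t ↦ 1 - t, which exchanges the half planes; hence the path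
around 1 crosses from below to above. -/
theorem exists_continuation_one {p : ℂ[X]} (hp : IsShabat p) {s s' : ShabatEdge p}
    (h : IsNextEdge 1 s s') {f f' : ℂ → ℂ} (hf : IsSheet s f) (hf' : IsSheet s' f') :
    ∃ g, IsSection p rightDomain g ∧ (∀ t : ℂ, t.im < 0 → g t = f t) ∧
      ∀ t : ℂ, 0 < t.im → g t = f' t := by
  obtain ⟨g, h1, h2, h3⟩ := exists_continuation_zero (IsShabat.reflect hp rfl)
    ((isNextEdge_reflectEdge rfl _ _).2 h) (hf.reflect rfl) (hf'.reflect rfl)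
  refine ⟨fun t => g (1 - t), h1.reflect (by ring) fun t ht => ?_, fun t ht => ?_, fun t ht => ?_⟩
  · rcases ht with h | h
    · exact Or.inl (by simpa using h)
    · exact Or.inr (by simpa using h)
  · simp only [h2 (1 - t) (by simpa using ht), sub_sub_cancel]
  · simp only [h3 (1 - t) (by simpa using ht), sub_sub_cancel]

/-! ### The number of edges, and the monodromy of the sheets -/

theorem IsShabat.eval_derivative_ne_zero {p : ℂ[X]} (hp : IsShabat p) {z : ℂ}
    (h : p.eval z ∉ ({0, 1} : Set ℂ)) : p.derivative.eval z ≠ 0 := by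
  intro h0
  have : p.eval z ∈ (fun z => p.eval z) '' {z | p.derivative.eval z = 0} := ⟨z, h0, rfl⟩
  rw [hp] at this
  exact h this

theorem IsShabat.natDegree_ne_zero {p : ℂ[X]} (hp : IsShabat p) : p.natDegree ≠ 0 := by
  intro h
  obtain ⟨c, rfl⟩ := natDegree_eq_zero.1 h
  have h0 : (0 : ℂ) ∈ (fun z => (C c).eval z) '' {z | (C c).derivative.eval z = 0} := by
    rw [hp]
    simp
  have h1 : (1 : ℂ) ∈ (fun z => (C c).eval z) '' {z | (C c).derivative.eval z = 0} := by
    rw [hp]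
    simp
  obtain ⟨z, -, hz⟩ := h0
  obtain ⟨w, -, hw⟩ := h1
  simp only [eval_C] at hz hw
  rw [hz] at hw
  exact zero_ne_one hw

/-- An edge is determined by its midpoint, which can be any preimage of `1/2`. -/
noncomputable def edgeEquiv {p : ℂ[X]} (hp : IsShabat p) :
    ShabatEdge p ≃ ((p - C (1 / 2)).roots.toFinset : Set ℂ) := by
  have hne : p - C (1 / 2) ≠ 0 := by
    intro h
    refine IsShabat.natDegree_ne_zero hp ?_
    rw [sub_eq_zero.1 h, natDegree_C]
  refine Equiv.ofBijective (fun s => ⟨s.1 half, ?_⟩) ⟨fun s s' h => ?_, fun z => ?_⟩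
  · simp only [Finset.mem_coe, Multiset.mem_toFinset, mem_roots hne, IsRoot.def, eval_sub, eval_C,
      s.2]
    simp [half]
  · exact edge_ext hp half_mem (congrArg Subtype.val h)
  · have hz := z.2
    simp only [Finset.mem_coe, Multiset.mem_toFinset, mem_roots hne, IsRoot.def, eval_sub, eval_C,
      sub_eq_zero] at hz
    obtain ⟨f, hf, hfz⟩ := exists_isSection hp isOpen_midDomain starConvex_midDomain
      midDomain_subset (ofReal_mem_midDomain half_mem) (z := z.1) (by rw [hz]; simp [half])
    obtain ⟨s, hs⟩ := exists_edge hp hf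
    refine ⟨s, Subtype.ext ?_⟩
    rw [← hfz]
    exact (hs.eq half half_mem).symm

/-- Edges correspond to preimages of 1/2, which is not a critical value, so all roots of p - 1/2 are
simple. -/
theorem card_edge {p : ℂ[X]} (hp : IsShabat p) : Nat.card (ShabatEdge p) = p.natDegree := by
  have hne : p - C (1 / 2) ≠ 0 := by
    intro h
    refine IsShabat.natDegree_ne_zero hp ?_
    rw [sub_eq_zero.1 h, natDegree_C]
  rw [Nat.card_congr (edgeEquiv hp), Nat.card_coe_set_eq, Set.ncard_coe_finset,
    Multiset.toFinset_card_of_nodup, ← (IsAlgClosed.splits _).natDegree_eq_card_roots,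
    natDegree_sub_C]
  rw [Multiset.nodup_iff_count_le_one]
  intro z
  rw [count_roots]
  by_contra! h
  rw [one_lt_rootMultiplicity_iff_isRoot hne] at h
  obtain ⟨h1, h2⟩ := h
  simp only [IsRoot.def, eval_sub, eval_C, derivative_sub, derivative_C, sub_zero,
    sub_eq_zero] at h1 h2
  refine IsShabat.eval_derivative_ne_zero hp ?_ h2
  rw [h1]
  norm_num

theorem natDegree_eq_of_isTreeOf {n : ℕ} {p : ℂ[X]} (hp : IsShabat p) {T : PlaneTree n}
    (h : IsTreeOf p T) : p.natDegree = n := by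
  obtain ⟨e, -⟩ := h
  rw [← card_edge hp, ← Nat.card_congr e, Nat.card_fin]

theorem IsSection.norm_le {p : ℂ[X]} {V : Set ℂ} {f : ℂ → ℂ} (hf : IsSection p V f) {n : ℕ}
    (hn : n ≠ 0) {K : ℝ} (hK1 : 1 ≤ K) (hK : ∀ z : ℂ, ‖z‖ ^ n ≤ K ^ n * (1 + ‖p.eval z‖)) :
    ∀ t ∈ V, ‖f t‖ ≤ K * growth n t := by
  intro t ht
  refine le_of_pow_le_pow_left₀ hn
    (mul_nonneg (zero_le_one.trans hK1) (zero_le_one.trans (one_le_growth n t))) ?_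
  rw [mul_pow, growth_pow hn]
  have := hK (f t)
  rwa [hf.eval_eq t ht] at this

/-- The index type may enumerate only some of the edges, as long as both rotations preserve them;
`exists_isTreeOf` uses it for a single orbit. -/
theorem hasMonodromy_sheets {p : ℂ[X]} (hp : IsShabat p) {ι : Type*} {e : ι → ShabatEdge p}
    {α β : Equiv.Perm ι} (hα : ∀ i, IsNextEdge 0 (e i) (e (α i)))
    (hβ : ∀ i, IsNextEdge 1 (e i) (e (β i))) {f : ι → ℂ → ℂ} (hf : ∀ i, IsSheet (e i) (f i)) :
    ∃ K, HasMonodromy p.natDegree f α β K := by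
  have hn := IsShabat.natDegree_ne_zero hp
  obtain ⟨K, hK1, hK⟩ := exists_growth (p := p) rfl hn
  refine ⟨K, fun i => ?_, fun i => ?_, fun i => ?_, fun i => ?_⟩
  · exact (hf i).isSection.differentiableOn hp isOpen_midDomain midDomain_subset
  · exact (hf i).isSection.norm_le hn hK1 hK
  · obtain ⟨g, h1, h2, h3⟩ := exists_continuation_zero hp (hα i) (hf i) (hf _)
    exact ⟨g, h1.differentiableOn hp isOpen_leftDomain leftDomain_subset,
      h1.norm_le hn hK1 hK, h2, h3⟩
  · obtain ⟨g, h1, h2, h3⟩ := exists_continuation_one hp (hβ i) (hf i) (hf _)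
    exact ⟨g, h1.differentiableOn hp isOpen_rightDomain rightDomain_subset,
      h1.norm_le hn hK1 hK, h2, h3⟩

theorem sheet_injective {p : ℂ[X]} (hp : IsShabat p) {s s' : ShabatEdge p} {f f' : ℂ → ℂ}
    (hf : IsSheet s f) (hf' : IsSheet s' f') {t : ℂ} (ht : t ∈ midDomain) (h : f t = f' t) :
    s = s' := by
  refine edge_ext hp half_mem ?_
  rw [← hf.eq half half_mem, ← hf'.eq half half_mem]
  exact hf.isSection.eqOn hp isPreconnected_midDomain midDomain_subset hf'.isSection ht h
    (ofReal_mem_midDomain half_mem)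

/-- The sheets over t are exactly the roots of p - t, here evaluated at 0. It follows that the
product of the sheets takes different values at different t, as `HasMonodromy.exists_affine`
requires. -/
theorem prod_sheets {p : ℂ[X]} (hp : IsShabat p) {ι : Type*} [Fintype ι] (e : ι ≃ ShabatEdge p)
    {f : ι → ℂ → ℂ} (hf : ∀ i, IsSheet (e i) (f i)) {t : ℂ} (ht : t ∈ midDomain) :
    p.eval 0 - t = p.leadingCoeff * ((-1) ^ p.natDegree * ∏ i, f i t) := by
  classical
  have hn := IsShabat.natDegree_ne_zero hp
  have hcard : Fintype.card ι = p.natDegree := by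
    rw [← card_edge hp, ← Nat.card_congr e, Nat.card_eq_fintype_card]
  have hdeg : (p - C t).natDegree = p.natDegree := natDegree_sub_C
  have hne : p - C t ≠ 0 := by
    intro h
    rw [h, natDegree_zero] at hdeg
    exact hn hdeg.symm
  have hinj : Function.Injective fun i => f i t := fun i j hij =>
    e.injective (sheet_injective hp (hf i) (hf j) ht hij)
  have hle : Finset.univ.val.map (fun i => f i t) ≤ (p - C t).roots := by
    rw [Multiset.le_iff_subset ((Multiset.nodup_map_iff_of_injective hinj).2 Finset.univ.nodup)]
    intro z hz
    obtain ⟨i, -, rfl⟩ := Multiset.mem_map.1 hz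
    rw [mem_roots hne]
    simp [(hf i).isSection.eval_eq t ht]
  have heq := Multiset.eq_of_le_of_card_le hle (by
    rw [Multiset.card_map, Finset.card_val, Finset.card_univ, hcard, ← hdeg]
    exact card_roots' _)
  have h1 := (IsAlgClosed.splits (p - C t)).eval_eq_prod_roots 0
  have hlc : (p - C t).leadingCoeff = p.leadingCoeff := by
    rw [leadingCoeff, hdeg, coeff_sub, coeff_C, if_neg hn, sub_zero, leadingCoeff]
  rw [← heq, hlc, Multiset.map_map] at h1
  rw [eval_sub, eval_C] at h1
  rw [h1]
  congr 1
  simp only [Function.comp_def, zero_sub, Finset.prod_map_val]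
  rw [← hcard, ← Finset.card_univ, ← Finset.prod_const, ← Finset.prod_mul_distrib]
  simp

/-- A Shabat polynomial is determined by its tree up to an affine change of the variable. -/
theorem exists_comp_of_isTreeOf {n : ℕ} {p q : ℂ[X]} (hp : IsShabat p) (hq : IsShabat q)
    {T : PlaneTree n} (hpT : IsTreeOf p T) (hqT : IsTreeOf q T) :
    ∃ a b : ℂ, a ≠ 0 ∧ q = p.comp (C a * X + C b) := by
  have hpn := natDegree_eq_of_isTreeOf hp hpT
  have hqn := natDegree_eq_of_isTreeOf hq hqT
  have hn : n ≠ 0 := hpn ▸ IsShabat.natDegree_ne_zero hp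
  obtain ⟨e, he0, he1⟩ := hpT
  obtain ⟨e', he0', he1'⟩ := hqT
  choose f hf using fun i => exists_isSheet hp (e i)
  choose g hg using fun i => exists_isSheet hq (e' i)
  obtain ⟨K, hK⟩ := hasMonodromy_sheets hp he0 he1 hf
  obtain ⟨L, hL⟩ := hasMonodromy_sheets hq he0' he1' hg
  rw [hpn] at hK
  rw [hqn] at hL
  have hI : Complex.I ∈ midDomain := by simp [midDomain]
  have hI' : -Complex.I ∈ midDomain := by simp [midDomain]
  obtain ⟨a, ha⟩ := hK.exists_affine hL hn (Fintype.card_fin n) hI hI' (by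
    intro h
    have h1 := prod_sheets hq e' hg hI
    rw [h, ← prod_sheets hq e' hg hI'] at h1
    have h2 : (2 : ℂ) * Complex.I = 0 := by linear_combination -h1
    simp at h2)
  obtain ⟨b, hb⟩ := ha ⟨0, Nat.pos_of_ne_zero hn⟩
  set i : Fin n := ⟨0, Nat.pos_of_ne_zero hn⟩
  have hqeq : q = p.comp (C a * X + C b) := by
    -- Over t the relation f_i = a g_i + b gives q(g_i) = t = p(a g_i + b), so the two polynomials
    -- agree on the infinite image of g_i.
    refine eq_of_infinite_eval_eq _ _ (Set.Infinite.mono (s := g i '' midDomain) ?_ ?_)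
    · rintro _ ⟨t, ht, rfl⟩
      simp only [Set.mem_ofPred_eq, eval_comp, eval_add, eval_mul, eval_C, eval_X]
      rw [← hb t ht, (hf i).isSection.eval_eq t ht, (hg i).isSection.eval_eq t ht]
    · refine Set.Infinite.image (fun t ht u hu h => ?_) ?_
      · rw [← (hg i).isSection.eval_eq t ht, h, (hg i).isSection.eval_eq u hu]
      · exact infinite_of_mem_nhds _ (isOpen_midDomain.mem_nhds hI)
  refine ⟨a, b, ?_, hqeq⟩
  rintro rfl
  refine IsShabat.natDegree_ne_zero hq ?_
  rw [hqeq]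
  simp

/-! ### Valencies are multiplicities -/

/-- If the fibres of `V` are the cycles of `α`, then the parts of the cycle partition are the
sizes of these fibres. -/
theorem partition_parts_eq {ι β : Type*} [Fintype ι] [DecidableEq ι] [DecidableEq β]
    (α : Equiv.Perm ι) (V : ι → β) (hV : ∀ i j, V i = V j ↔ α.SameCycle i j) :
    α.partition.parts =
      (Finset.univ.image V).val.map fun v => (Finset.univ.filter fun i => V i = v).card := by
  have hsupp : ∀ i, i ∈ α.support → (α.cycleOf i).support = Finset.univ.filter (V · = V i) := by
    intro i hi
    ext j
    rw [Equiv.Perm.mem_support_cycleOf_iff, Finset.mem_filter, hV j i]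
    constructor
    · rintro ⟨h, -⟩
      exact ⟨Finset.mem_univ _, h.symm⟩
    · rintro ⟨-, h⟩
      exact ⟨h.symm, by simpa using hi⟩
  have hfix : ∀ i, i ∉ α.support → Finset.univ.filter (V · = V i) = {i} := by
    intro i hi
    ext j
    rw [Finset.mem_filter, Finset.mem_singleton, hV j i]
    constructor
    · rintro ⟨-, h⟩
      rw [Equiv.Perm.notMem_support] at hi
      exact (Equiv.Perm.SameCycle.eq_of_right h hi)
    · rintro rfl
      exact ⟨Finset.mem_univ _, Equiv.Perm.SameCycle.refl _ _⟩
  have hsplit : Finset.univ.image V = α.support.image V ∪ α.supportᶜ.image V := by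
    rw [← Finset.image_union, Finset.union_compl]
  have hdisj : Disjoint (α.support.image V) (α.supportᶜ.image V) := by
    rw [Finset.disjoint_left]
    intro v hv hv'
    obtain ⟨i, hi, rfl⟩ := Finset.mem_image.1 hv
    obtain ⟨j, hj, hij⟩ := Finset.mem_image.1 hv'
    have h1 := hfix j (Finset.mem_compl.1 hj)
    have h2 : i ∈ Finset.univ.filter (V · = V j) := by simp [hij]
    rw [h1, Finset.mem_singleton] at h2
    subst h2
    exact (Finset.mem_compl.1 hj) hi
  -- Fibres of moved points give the cycle type, while fibres of fixed points are singletons and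
  -- give the parts equal to 1.
  rw [Equiv.Perm.parts_partition, hsplit, ← Finset.disjUnion_eq_union _ _ hdisj,
    Finset.disjUnion_val, Multiset.map_add]
  congr 1
  · rw [Equiv.Perm.cycleType_def]
    refine (Multiset.map_eq_map_of_bij_of_nodup _ _ (Finset.nodup _) (Finset.nodup _)
      (fun v hv => α.cycleOf (Finset.mem_image.1 hv).choose) ?_ ?_ ?_ ?_).symm
    · intro v hv
      exact Equiv.Perm.cycleOf_mem_cycleFactorsFinset_iff.2 (Finset.mem_image.1 hv).choose_spec.1
    · intro v hv w hw h
      have h1 := (Finset.mem_image.1 hv).choose_spec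
      have h2 := (Finset.mem_image.1 hw).choose_spec
      rw [← h1.2, ← h2.2, hV]
      have h3 : (Finset.mem_image.1 hv).choose ∈ (α.cycleOf (Finset.mem_image.1 hw).choose).support
        := by
        rw [← h, hsupp _ h1.1]
        simp
      exact (Equiv.Perm.mem_support_cycleOf_iff.1 h3).1.symm
    · intro c hc
      obtain ⟨i, hi⟩ := (Equiv.Perm.mem_cycleFactorsFinset_iff.1 hc).1.nonempty_support
      have hic : c = α.cycleOf i := Equiv.Perm.cycle_is_cycleOf hi hc
      have hi' : i ∈ α.support := Equiv.Perm.mem_cycleFactorsFinset_support_le hc hi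
      have hv : V i ∈ (α.support.image V).val := Finset.mem_image_of_mem V hi'
      refine ⟨V i, hv, ?_⟩
      have h1 := (Finset.mem_image.1 hv).choose_spec
      rw [hic]
      exact ((hV _ _).1 h1.2).cycleOf_eq
    · intro v hv
      have h1 := (Finset.mem_image.1 hv).choose_spec
      simp only [Function.comp]
      rw [hsupp _ h1.1, h1.2]
  · have hinj : Set.InjOn V (α.supportᶜ : Finset ι) := by
      intro i hi j hj hij
      have h2 : i ∈ Finset.univ.filter (V · = V j) := by simp [hij]
      rwa [hfix j (Finset.mem_compl.1 hj), Finset.mem_singleton] at h2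
    rw [Multiset.map_congr rfl (g := fun _ => 1), Multiset.map_const', Finset.card_val,
      Finset.card_image_of_injOn hinj, Finset.card_compl]
    intro v hv
    obtain ⟨i, hi, rfl⟩ := Finset.mem_image.1 hv
    rw [hfix i (Finset.mem_compl.1 hi), Finset.card_singleton]

/-- The list of multiplicities of the roots of a polynomial. -/
noncomputable def rootMults (p : ℂ[X]) : Multiset ℕ :=
  p.roots.toFinset.val.map fun v => p.rootMultiplicity v

/-- The cycles of the white rotation are the sets of edges with a common white end. -/
theorem start_eq_iff_sameCycle {p : ℂ[X]} (hp : IsShabat p) {ι : Type*} [Fintype ι]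
    (e : ι ≃ ShabatEdge p) {α : Equiv.Perm ι}
    (hα : ∀ i, IsNextEdge 0 (e i) (e (α i))) (i j : ι) :
    (e i).1 0 = (e j).1 0 ↔ α.SameCycle i j := by
  have hpow : ∀ (i : ι) (k : ℕ), (e ((α ^ k) i)).1 0 = (e i).1 0 := by
    intro i k
    induction k with
    | zero => simp
    | succ k ih => rw [pow_succ', Equiv.Perm.mul_apply, (hα _).1, ih]
  constructor
  · intro hij
    obtain ⟨φ, ρ, ε, ω, hm, hφ, hε, hε1, hερ, hω⟩ := exists_localForm_edge hp (e i)
    obtain ⟨ω', hω'⟩ := exists_hasIndex hp hφ hm hε hε1 hερ hij.symm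
    have hiter : ∀ k : ℕ, HasIndex φ (p.rootMultiplicity ((e i).1 0)) ε (e ((α ^ k) i))
        (ω * rot (p.rootMultiplicity ((e i).1 0)) ^ k) := by
      intro k
      induction k with
      | zero => simpa using hω
      | succ k ih =>
        rw [pow_succ', Equiv.Perm.mul_apply, pow_succ, ← mul_assoc]
        exact (ih.isNextEdge_iff hp hφ hm hε hε1 hερ).1 (hα _)
    have hω0 : ω ≠ 0 := fun h => by simpa [h, hm] using hω.1
    have : NeZero (p.rootMultiplicity ((e i).1 0)) := ⟨hm⟩
    -- The indices of two edges at the same vertex differ by a power of `rot m`, so iterating the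
    -- rotation leads from one to the other.
    obtain ⟨k, -, hk⟩ := (isPrimitiveRoot_rot hm).eq_pow_of_pow_eq_one (ξ := ω' / ω)
      (by rw [div_pow, hω.1, hω'.1, div_one])
    have h2 := hiter k
    rw [hk, mul_div_cancel₀ _ hω0] at h2
    exact ⟨k, by
      rw [zpow_natCast]
      exact e.injective (h2.edge_eq hp hε hε1 hω')⟩
  · intro h
    obtain ⟨k, -, rfl⟩ := h.exists_pow_eq'
    exact (hpow i k).symm

/-- The edges at a root of multiplicity m are indexed by the m-th roots of unity, so the valency
equals the multiplicity. -/
theorem partition_parts_eq_rootMults {p : ℂ[X]} (hp : IsShabat p) {ι : Type*} [Fintype ι]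
    [DecidableEq ι] (e : ι ≃ ShabatEdge p) {α : Equiv.Perm ι}
    (hα : ∀ i, IsNextEdge 0 (e i) (e (α i))) : α.partition.parts = rootMults p := by
  classical
  have hp0 := IsShabat.ne_zero hp
  have hroot : ∀ i, p.eval ((e i).1 0) = 0 := fun i => by
    rw [(e i).2 0]
    simp
  have himg : Finset.univ.image (fun i => (e i).1 0) = p.roots.toFinset := by
    ext v
    simp only [Finset.mem_image, Finset.mem_univ, true_and, Multiset.mem_toFinset, mem_roots hp0,
      IsRoot.def]
    constructor
    · rintro ⟨i, rfl⟩
      exact hroot i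
    · intro hv
      have hm : p.rootMultiplicity v ≠ 0 := ((rootMultiplicity_pos hp0).2 hv).ne'
      obtain ⟨φ, ρ, hφ⟩ := exists_isLocalForm hp0 hv
      have hε : 0 < min (ρ ^ p.rootMultiplicity v) 1 := lt_min (pow_pos hφ.pos _) one_pos
      obtain ⟨s, hs⟩ := exists_edge_hasIndex hp hφ hm hε (min_le_right _ _) (min_le_left _ _)
        (one_pow _)
      exact ⟨e.symm s, by rw [e.apply_symm_apply]; exact hs.start hφ hm hε⟩
  rw [partition_parts_eq α (fun i => (e i).1 0) (fun i j => ?_), himg, rootMults]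
  · refine Multiset.map_congr rfl fun v hv => ?_
    have hv' : p.eval v = 0 := by
      have := Multiset.mem_toFinset.1 (Finset.mem_def.2 hv)
      rwa [mem_roots hp0] at this
    have hm : p.rootMultiplicity v ≠ 0 := ((rootMultiplicity_pos hp0).2 hv').ne'
    obtain ⟨φ, ρ, hφ⟩ := exists_isLocalForm hp0 hv'
    have hε : 0 < min (ρ ^ p.rootMultiplicity v) 1 := lt_min (pow_pos hφ.pos _) one_pos
    have hε1 := min_le_right (ρ ^ p.rootMultiplicity v) 1
    have hερ := min_le_left (ρ ^ p.rootMultiplicity v) 1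
    set ε := min (ρ ^ p.rootMultiplicity v) 1
    rw [← (isPrimitiveRoot_rot hm).card_nthRootsFinset]
    refine (Finset.card_bij (fun ω hω => e.symm (exists_edge_hasIndex hp hφ hm hε hε1 hερ
      ((mem_nthRootsFinset (Nat.pos_of_ne_zero hm) _).1 hω)).choose) ?_ ?_ ?_).symm
    · intro ω hω
      have h1 := (exists_edge_hasIndex hp hφ hm hε hε1 hερ
        ((mem_nthRootsFinset (Nat.pos_of_ne_zero hm) _).1 hω)).choose_spec
      simpa using h1.start hφ hm hε
    · intro ω hω ω' hω' h
      have h1 := (exists_edge_hasIndex hp hφ hm hε hε1 hερ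
        ((mem_nthRootsFinset (Nat.pos_of_ne_zero hm) _).1 hω)).choose_spec
      have h2 := (exists_edge_hasIndex hp hφ hm hε hε1 hερ
        ((mem_nthRootsFinset (Nat.pos_of_ne_zero hm) _).1 hω')).choose_spec
      rw [e.symm.injective h] at h1
      exact h1.unique hφ hm hε hερ h2
    · intro i hi
      obtain ⟨ω, hω⟩ := exists_hasIndex hp hφ hm hε hε1 hερ (Finset.mem_filter.1 hi).2
      have hmem : ω ∈ nthRootsFinset (p.rootMultiplicity v) (1 : ℂ) :=
        (mem_nthRootsFinset (Nat.pos_of_ne_zero hm) _).2 hω.1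
      refine ⟨ω, hmem, ?_⟩
      have h1 := (exists_edge_hasIndex hp hφ hm hε hε1 hερ
        ((mem_nthRootsFinset (Nat.pos_of_ne_zero hm) _).1 hmem)).choose_spec
      rw [h1.edge_eq hp hε hε1 hω, e.symm_apply_apply]
  · exact start_eq_iff_sameCycle hp e hα i j

theorem whiteValencies_eq {n : ℕ} {p : ℂ[X]} (hp : IsShabat p) {T : PlaneTree n}
    (h : IsTreeOf p T) : T.whiteValencies = rootMults p := by
  obtain ⟨e, h0, -⟩ := h
  exact partition_parts_eq_rootMults hp e h0

theorem partition_parts_eq_rootMults_one {p : ℂ[X]} (hp : IsShabat p) {ι : Type*} [Fintype ι]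
    [DecidableEq ι] (e : ι ≃ ShabatEdge p) {β : Equiv.Perm ι}
    (hβ : ∀ i, IsNextEdge 1 (e i) (e (β i))) : β.partition.parts = rootMults (1 - p) :=
  partition_parts_eq_rootMults (IsShabat.reflect hp rfl) (e.trans (reflectEdge rfl))
    fun i => (isNextEdge_reflectEdge rfl _ _).2 (hβ i)

theorem blackValencies_eq {n : ℕ} {p : ℂ[X]} (hp : IsShabat p) {T : PlaneTree n}
    (h : IsTreeOf p T) : T.blackValencies = rootMults (1 - p) := by
  obtain ⟨e, -, h1⟩ := h
  exact partition_parts_eq_rootMults_one hp e h1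

/-! ### Existence and uniqueness of the tree of a polynomial -/

theorem isotopic_of_isTreeOf {n : ℕ} {p : ℂ[X]} (hp : IsShabat p) {T T' : PlaneTree n}
    (h : IsTreeOf p T) (h' : IsTreeOf p T') : T.Isotopic T' := by
  obtain ⟨e, h0, h1⟩ := h
  obtain ⟨e', h0', h1'⟩ := h'
  refine ⟨e.trans e'.symm, fun i => ?_, fun i => ?_⟩
  · apply e'.injective
    have h2 := h0' (e'.symm (e i))
    rw [e'.apply_symm_apply] at h2
    simpa using isNextEdge_zero_unique hp (h0 i) h2
  · apply e'.injective
    have h2 := h1' (e'.symm (e i))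
    rw [e'.apply_symm_apply] at h2
    simpa using isNextEdge_one_unique hp (h1 i) h2

theorem IsTreeOf_of_isotopic {n : ℕ} {p : ℂ[X]} {T T' : PlaneTree n} (h : IsTreeOf p T)
    (hT : T.Isotopic T') : IsTreeOf p T' := by
  obtain ⟨e, h0, h1⟩ := h
  obtain ⟨σ, hw, hb⟩ := hT
  refine ⟨σ.symm.trans e, fun i => ?_, fun i => ?_⟩
  · obtain ⟨j, rfl⟩ := σ.surjective i
    simpa [← hw] using h0 j
  · obtain ⟨j, rfl⟩ := σ.surjective i
    simpa [← hb] using h1 j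

/-- The rotations exist because the next edge is well defined and injective. Connectedness is the
substance: the sheets of a proper orbit would number fewer than n, hence be constant, which
contradicts p(f(t)) = t. The vertex count is taken as a hypothesis and later read off from the
multiplicities. -/
theorem exists_isTreeOf {n : ℕ} {p : ℂ[X]} (hp : IsShabat p) (hn : p.natDegree = n)
    (hcard : (rootMults p).card + (rootMults (1 - p)).card = n + 1) :
    ∃ T : PlaneTree n, IsTreeOf p T := by
  classical
  have hn0 : n ≠ 0 := hn ▸ IsShabat.natDegree_ne_zero hp
  have hc : Nat.card (ShabatEdge p) = n := (card_edge hp).trans hn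
  have : Finite (ShabatEdge p) := Nat.finite_of_card_ne_zero (by rw [hc]; exact hn0)
  let e : Fin n ≃ ShabatEdge p := (Finite.equivFinOfCardEq hc).symm
  choose N₀ hN₀ using exists_isNextEdge_zero hp
  choose N₁ hN₁ using exists_isNextEdge_one hp
  have hinj₀ : Function.Injective fun i => e.symm (N₀ (e i)) := fun i j h => by
    have h1 := e.symm.injective h
    exact e.injective (isNextEdge_zero_injective hp (hN₀ (e i)) (h1 ▸ hN₀ (e j)))
  have hinj₁ : Function.Injective fun i => e.symm (N₁ (e i)) := fun i j h => by
    have h1 := e.symm.injective h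
    exact e.injective (isNextEdge_one_injective hp (hN₁ (e i)) (h1 ▸ hN₁ (e j)))
  let α : Equiv.Perm (Fin n) := Equiv.ofBijective _ (Finite.injective_iff_bijective.1 hinj₀)
  let β : Equiv.Perm (Fin n) := Equiv.ofBijective _ (Finite.injective_iff_bijective.1 hinj₁)
  have hα : ∀ i, IsNextEdge 0 (e i) (e (α i)) := fun i => by simpa [α] using hN₀ (e i)
  have hβ : ∀ i, IsNextEdge 1 (e i) (e (β i)) := fun i => by simpa [β] using hN₁ (e i)
  have hmem : ∀ g ∈ ({α, β} : Set (Equiv.Perm (Fin n))), ∀ x y,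
      y ∈ MulAction.orbit (Subgroup.closure {α, β}) x ↔
        g y ∈ MulAction.orbit (Subgroup.closure {α, β}) x := by
    intro g hg x y
    have h1 := MulAction.orbit_smul (⟨g, Subgroup.subset_closure hg⟩ : Subgroup.closure {α, β}) y
    rw [← MulAction.orbit_eq_iff, ← MulAction.orbit_eq_iff, ← h1]
    rfl
  have hconn : MulAction.IsPretransitive (Subgroup.closure {α, β}) (Fin n) := by
    refine ⟨fun x y => ?_⟩
    by_contra hxy
    set O := MulAction.orbit (Subgroup.closure {α, β}) x with hO
    have hy : y ∉ O := fun h => hxy h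
    choose f hf using fun i : O => exists_isSheet hp (e i)
    obtain ⟨K, hK⟩ := hasMonodromy_sheets hp (e := fun i : O => e i)
      (α := α.subtypePerm fun y => (hmem α (by simp) x y).symm)
      (β := β.subtypePerm fun y => (hmem β (by simp) x y).symm)
      (fun i => hα i) (fun i => hβ i) hf
    have hlt : Fintype.card O < p.natDegree := by
      rw [hn]
      conv_rhs => rw [← Fintype.card_fin n]
      exact Fintype.card_subtype_lt (x := y) hy
    have hI : Complex.I ∈ midDomain := by simp [midDomain]
    have hI' : -Complex.I ∈ midDomain := by simp [midDomain]
    let i₀ : O := ⟨x, MulAction.mem_orbit_self x⟩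
    have h1 := hK.eq_const_of_card_lt hlt i₀ _ hI _ hI'
    have h2 := (hf i₀).isSection.eval_eq _ hI
    rw [h1, (hf i₀).isSection.eval_eq _ hI'] at h2
    have h3 : (2 : ℂ) * Complex.I = 0 := by linear_combination -h2
    simp at h3
  refine ⟨⟨α, β, hconn, ?_⟩, e, hα, hβ⟩
  rw [partition_parts_eq_rootMults hp e hα, partition_parts_eq_rootMults_one hp e hβ, hcard]

/-! ### Affine changes of the variable -/

theorem isShabat_comp {p : ℂ[X]} (hp : IsShabat p) {a b : ℂ} (ha : a ≠ 0) :
    IsShabat (p.comp (C a * X + C b)) := by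
  unfold IsShabat at *
  rw [← hp]
  ext y
  simp only [Set.mem_image, Set.mem_ofPred_eq, derivative_comp, eval_mul, eval_comp, eval_add,
    eval_C, eval_X, derivative_add, derivative_mul, derivative_C, derivative_X, zero_mul, mul_one,
    zero_add, add_zero, mul_eq_zero, ha, false_or]
  constructor
  · rintro ⟨z, hz, rfl⟩
    exact ⟨a * z + b, hz, rfl⟩
  · rintro ⟨z, hz, rfl⟩
    have : a * ((z - b) / a) + b = z := by field_simp; ring
    exact ⟨(z - b) / a, by rw [this]; exact hz, by rw [this]⟩

/-- The edges of an affine transform. -/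
noncomputable def affineEdge {p q : ℂ[X]} {a b : ℂ} (ha : a ≠ 0)
    (h : q = p.comp (C a * X + C b)) : ShabatEdge p ≃ ShabatEdge q where
  toFun s := ⟨⟨fun t => (s.1 t - b) / a, by fun_prop⟩, fun t => by
    subst h
    simp only [ContinuousMap.coe_mk, eval_comp, eval_add, eval_mul, eval_C, eval_X]
    rw [mul_div_cancel₀ _ ha, sub_add_cancel, s.2]⟩
  invFun s := ⟨⟨fun t => a * s.1 t + b, by fun_prop⟩, fun t => by
    have := s.2 t
    subst h
    simpa using this⟩
  left_inv s := by
    apply Subtype.ext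
    ext t
    simp [mul_div_cancel₀ _ ha]
  right_inv s := by
    apply Subtype.ext
    ext t
    simp [mul_div_cancel_left₀ _ ha]

theorem affineEdge_apply {p q : ℂ[X]} {a b : ℂ} (ha : a ≠ 0) (h : q = p.comp (C a * X + C b))
    (s : ShabatEdge p) (t : unitInterval) : (affineEdge ha h s).1 t = (s.1 t - b) / a := rfl

theorem isNextEdge_affineEdge {p q : ℂ[X]} {a b : ℂ} (ha : a ≠ 0)
    (h : q = p.comp (C a * X + C b)) (x : unitInterval) (s s' : ShabatEdge p) :
    IsNextEdge x (affineEdge ha h s) (affineEdge ha h s') ↔ IsNextEdge x s s' := by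
  have hang : ∀ (s s' : ShabatEdge p) (θ : ℝ),
      HasAngle x (affineEdge ha h s) (affineEdge ha h s') θ ↔ HasAngle x s s' θ := by
    intro s s' θ
    unfold HasAngle
    have : ∀ t, ((s'.1 t - b) / a - (s.1 x - b) / a) / ((s.1 t - b) / a - (s.1 x - b) / a) =
        (s'.1 t - s.1 x) / (s.1 t - s.1 x) := fun t => by
      rw [← sub_div, ← sub_div, div_div_div_cancel_right₀ ha, sub_sub_sub_cancel_right,
        sub_sub_sub_cancel_right]
    simp only [affineEdge_apply, this]
  have hend : ∀ s s' : ShabatEdge p, (affineEdge ha h s').1 x = (affineEdge ha h s).1 x ↔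
      s'.1 x = s.1 x := by
    intro s s'
    rw [affineEdge_apply, affineEdge_apply, div_left_inj' ha, sub_left_inj]
  unfold IsNextEdge
  simp only [hang, hend, ← (affineEdge ha h).forall_congr_right]

theorem isTreeOf_comp {n : ℕ} {p : ℂ[X]} {T : PlaneTree n} (h : IsTreeOf p T) {a : ℂ} (b : ℂ)
    (ha : a ≠ 0) : IsTreeOf (p.comp (C a * X + C b)) T := by
  obtain ⟨e, h0, h1⟩ := h
  exact ⟨e.trans (affineEdge ha rfl), fun i => (isNextEdge_affineEdge ha rfl 0 _ _).2 (h0 i),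
    fun i => (isNextEdge_affineEdge ha rfl 1 _ _).2 (h1 i)⟩

/-- The tree of an even polynomial has an automorphism without fixed edges. -/
theorem exists_aut_of_even {n : ℕ} {p : ℂ[X]} (hp : IsShabat p)
    (heven : p = p.comp (C (-1) * X + C 0)) {T : PlaneTree n} (h : IsTreeOf p T) :
    ∃ σ : Equiv.Perm (Fin n), (∀ i, σ i ≠ i) ∧ (∀ i, σ (T.white i) = T.white (σ i)) ∧
      ∀ i, σ (T.black i) = T.black (σ i) := by
  obtain ⟨e, h0, h1⟩ := h
  set A := affineEdge (neg_ne_zero.2 one_ne_zero) heven with hA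
  refine ⟨(e.trans A).trans e.symm, fun i hi => ?_, fun i => ?_, fun i => ?_⟩
  · have h2 : A (e i) = e i := by simpa using congrArg e hi
    -- An edge fixed by z ↦ -z would be identically 0, although p takes the values 0 and 1 at its
    -- two ends.
    have h3 : ∀ t, (e i).1 t = 0 := fun t => by
      have h4 := congrArg (fun s : ShabatEdge p => s.1 t) h2
      simp only [hA, affineEdge_apply] at h4
      have h5 : 2 * (e i).1 t = 0 := by linear_combination -h4
      simpa using h5
    have h6 := (e i).2 0
    have h7 := (e i).2 1
    rw [h3] at h6 h7
    rw [h6] at h7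
    simp at h7
  · apply e.injective
    have h2 := (isNextEdge_affineEdge (neg_ne_zero.2 one_ne_zero) heven 0 _ _).2 (h0 i)
    have h3 := h0 (e.symm (A (e i)))
    rw [e.apply_symm_apply] at h3
    simpa using isNextEdge_zero_unique hp h2 h3
  · apply e.injective
    have h2 := (isNextEdge_affineEdge (neg_ne_zero.2 one_ne_zero) heven 1 _ _).2 (h1 i)
    have h3 := h1 (e.symm (A (e i)))
    rw [e.apply_symm_apply] at h3
    simpa using isNextEdge_one_unique hp h2 h3

/-! ### Complex conjugation -/

/-- Complex conjugation on the edges of a real polynomial. -/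
noncomputable def conjEdge {p : ℂ[X]}
    (h : ∀ z, p.eval (starRingEnd ℂ z) = starRingEnd ℂ (p.eval z)) :
    ShabatEdge p ≃ ShabatEdge p where
  toFun s := ⟨⟨fun t => starRingEnd ℂ (s.1 t), Complex.continuous_conj.comp s.1.continuous⟩,
    fun t => by
      simp only [ContinuousMap.coe_mk, h, s.2, Complex.conj_ofReal]⟩
  invFun s := ⟨⟨fun t => starRingEnd ℂ (s.1 t), Complex.continuous_conj.comp s.1.continuous⟩,
    fun t => by
      simp only [ContinuousMap.coe_mk, h, s.2, Complex.conj_ofReal]⟩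
  left_inv s := by
    apply Subtype.ext
    ext t
    simp
  right_inv s := by
    apply Subtype.ext
    ext t
    simp

theorem conjEdge_apply {p : ℂ[X]} (h : ∀ z, p.eval (starRingEnd ℂ z) = starRingEnd ℂ (p.eval z))
    (s : ShabatEdge p) (t : unitInterval) : (conjEdge h s).1 t = starRingEnd ℂ (s.1 t) := rfl

/-- Conjugation reverses orientation, so the conjugates of an edge and of its successor occur in the
opposite order. -/
theorem isNextEdge_conjEdge {p : ℂ[X]}
    (h : ∀ z, p.eval (starRingEnd ℂ z) = starRingEnd ℂ (p.eval z)) {x : unitInterval}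
    {s s' : ShabatEdge p} (hs : IsNextEdge x s s') :
    IsNextEdge x (conjEdge h s') (conjEdge h s) := by
  have hang : ∀ (s s' : ShabatEdge p) (θ : ℝ), s'.1 x = s.1 x →
      (HasAngle x (conjEdge h s') (conjEdge h s) θ ↔ HasAngle x s s' θ) := by
    intro s s' θ hss
    unfold HasAngle
    refine tendsto_congr fun t => ?_
    have : ((conjEdge h s).1 t - (conjEdge h s').1 x) /
        ((conjEdge h s').1 t - (conjEdge h s').1 x) =
        starRingEnd ℂ ((s'.1 t - s.1 x) / (s.1 t - s.1 x))⁻¹ := by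
      simp only [conjEdge_apply, ← map_sub, hss, ← map_div₀, inv_div]
    rw [this, Complex.arg_conj_coe_angle, Complex.arg_inv_coe_angle, neg_neg]
  obtain ⟨h0, θ, hθ0, hθ, hA, hmin⟩ := hs
  refine ⟨?_, θ, hθ0, hθ, (hang s s' θ h0).2 hA, fun s'' hend φ hφ0 hφ hB => ?_⟩
  · rw [conjEdge_apply, conjEdge_apply, h0]
  · obtain ⟨r, rfl⟩ := (conjEdge h).surjective s''
    have hr : r.1 x = s'.1 x := by
      rw [conjEdge_apply, conjEdge_apply] at hend
      exact (starRingEnd ℂ).injective hend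
    rw [hang r s' φ hr.symm] at hB
    -- An edge r at angle φ before s' lies at angle θ - φ after s, strictly between s and s'.
    refine hmin r (hr.trans h0) (θ - φ) (by linarith) (by linarith) ?_
    have hlim := Filter.Tendsto.sub hA hB
    rw [← Real.Angle.coe_sub] at hlim
    refine hlim.congr' ?_
    filter_upwards [self_mem_nhdsWithin] with t ht
    have hne : ∀ u : ShabatEdge p, u.1 x = s.1 x → u.1 t - s.1 x ≠ 0 := by
      intro u hu h1
      have h2 : u.1 t = u.1 x := by rw [hu]; exact sub_eq_zero.1 h1
      have h3 := u.2 t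
      rw [h2, u.2 x] at h3
      exact ht (Subtype.ext (by exact_mod_cast h3.symm))
    have n1 := hne s rfl
    have n2 := hne s' h0
    have n3 := hne r (hr.trans h0)
    rw [hr.trans h0, Complex.arg_div_coe_angle n2 n1, Complex.arg_div_coe_angle n2 n3,
      Complex.arg_div_coe_angle n3 n1]
    abel

/-- The tree of a real polynomial has a reflection; it preserves the cycles of `white` that
belong to real roots. -/
theorem exists_reflection_of_real {n : ℕ} {p : ℂ[X]} (hp : IsShabat p)
    (h : ∀ z, p.eval (starRingEnd ℂ z) = starRingEnd ℂ (p.eval z)) {T : PlaneTree n}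
    (hT : IsTreeOf p T)
    (hreal : ∀ v, 1 < p.rootMultiplicity v → starRingEnd ℂ v = v) :
    ∃ σ : Equiv.Perm (Fin n), (∀ i, T.white (σ (T.white i)) = σ i) ∧
      (∀ i, T.black (σ (T.black i)) = σ i) ∧
      ∀ i, T.white i ≠ i → T.white.SameCycle i (σ i) := by
  obtain ⟨e, h0, h1⟩ := hT
  set A := conjEdge h with hA
  refine ⟨(e.trans A).trans e.symm, fun i => ?_, fun i => ?_, fun i hi => ?_⟩
  · apply e.injective
    have h2 := isNextEdge_conjEdge h (h0 i)
    have h3 := h0 (e.symm (A (e (T.white i))))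
    rw [e.apply_symm_apply] at h3
    simpa using isNextEdge_zero_unique hp h3 h2
  · apply e.injective
    have h2 := isNextEdge_conjEdge h (h1 i)
    have h3 := h1 (e.symm (A (e (T.black i))))
    rw [e.apply_symm_apply] at h3
    simpa using isNextEdge_one_unique hp h3 h2
  · rw [← start_eq_iff_sameCycle hp e h0]
    have hm : 1 < p.rootMultiplicity ((e i).1 0) := by
      obtain ⟨φ, ρ, ε, ω, hm, hφ, hε, hε1, hερ, hω⟩ := exists_localForm_edge hp (e i)
      by_contra hle
      -- At a simple root the only root of unity is 1, so the edge would be its own successor,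
      -- contrary to `hi`.
      have hm1 : p.rootMultiplicity ((e i).1 0) = 1 := by omega
      have h2 := (hω.isNextEdge_iff hp hφ hm hε hε1 hερ).1 (h0 i)
      have hrot : rot (p.rootMultiplicity ((e i).1 0)) = 1 := by
        have := rot_pow hm
        rw [hm1, pow_one] at this
        rw [hm1, this]
      rw [hrot, mul_one] at h2
      exact hi (e.injective (h2.edge_eq hp hε hε1 hω))
    simp only [Equiv.trans_apply, e.apply_symm_apply, hA, conjEdge_apply]
    exact (hreal _ hm).symm

/-! ### The normal form of the polynomials of the type -/

section NormalForm

variable {K : Type*} [Field K]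

/-- The cubic whose roots are the double points over `1`. -/
noncomputable def normCubic (β g : K) : K[X] := X ^ 3 + C (9 * β) * X ^ 2 + C g * X - C β

/-- The quadratic whose roots are the simple points over `0`. -/
noncomputable def normQuad (β g : K) : K[X] := X ^ 2 + C (10 * β) * X + C ((5 * g + 1) / 4)

/-- The quartic whose roots are the simple points over `1`. -/
noncomputable def normQuartic (β g : K) : K[X] :=
  X ^ 4 + C (-8 * β) * X ^ 3 + C (63 * β ^ 2 - 3 / 4 * g - 15 / 4) * X ^ 2 +
    C (-486 * β ^ 3 + 23 / 2 * β * g + 59 / 2 * β) * X +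
    C (3645 * β ^ 4 - 513 / 4 * β ^ 2 * g - 901 / 4 * β ^ 2 + 1 / 2 * g ^ 2 + 5 / 2 * g + 5)

/-- The numerator of the normal form. -/
noncomputable def normNum (β g : K) : K[X] := (X ^ 2 - 1) ^ 4 * normQuad β g

/-- The second critical value of `normNum`. -/
noncomputable def normConst (β g : K) : K :=
  (5 * g + 1) / 4 - β ^ 2 *
    (3645 * β ^ 4 - 513 / 4 * β ^ 2 * g - 901 / 4 * β ^ 2 + 1 / 2 * g ^ 2 + 5 / 2 * g + 5)

/-- The equations for the parameters of the polynomials of the type. -/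
def Valid (β g : K) : Prop :=
  β * (131220 * (β ^ 2) ^ 2 - (6075 * g + 8235) * β ^ 2 + 105 / 2 * g ^ 2 + 180 * g + 375 / 2) = 0 ∧
  7290 * (β ^ 2) ^ 2 * g + 486 * (β ^ 2) ^ 2 - (513 / 2 * g ^ 2 + 462 * g + 59 / 2) * β ^ 2 +
    g ^ 3 + 5 * g ^ 2 + 10 * g + 10 = 0

/-- The Shabat polynomial with parameters `β`, `g`. -/
noncomputable def normPoly (β g : K) : K[X] := C (normConst β g)⁻¹ * normNum β g

/-- The cubic satisfied by the parameter `g` of a symmetric tree. -/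
def cubicEval (g : K) : K := g ^ 3 + 5 * g ^ 2 + 10 * g + 10

/-- The quintic satisfied by the parameter `g` of the trees that are neither symmetric
nor special. -/
def quinticEval (g : K) : K :=
  162 * g ^ 5 + 405 * g ^ 4 - 720 * g ^ 3 - 1690 * g ^ 2 + 4710 * g + 9533

theorem Valid.quadratic {β g : K} (h : Valid β g) (hβ : β ≠ 0) :
    131220 * (β ^ 2) ^ 2 - (6075 * g + 8235) * β ^ 2 + 105 / 2 * g ^ 2 + 180 * g + 375 / 2 = 0 :=
  (mul_eq_zero.1 h.1).resolve_left hβ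

variable [CharZero K]

/-- The factor (x² - 1)³ comes from the two quadruple roots. The constant (5g + 1)/4 and the
coefficient 10β in `normQuad` are chosen so that the remaining cubic has coefficients this simple in
β and g. -/
theorem derivative_normNum (β g : K) :
    derivative (normNum β g) = C 10 * (X ^ 2 - 1) ^ 3 * normCubic β g := by
  refine Polynomial.funext fun x => ?_
  simp [normNum, normQuad, normCubic, derivative_pow]
  ring

theorem Valid.normNum_eq {β g : K} (h : Valid β g) :
    normNum β g = normCubic β g ^ 2 * normQuartic β g + C (normConst β g) := by
  obtain ⟨h1, h0⟩ := h
  refine Polynomial.funext fun x => ?_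
  simp only [normNum, normQuad, normCubic, normQuartic, normConst, eval_mul, eval_pow, eval_sub,
    eval_add, eval_X, eval_one, eval_C]
  -- The remainder R of P modulo the squared cubic has degree at most 5, and R' is again divisible
  -- by the cubic: R' = -(E₁x + E₀) · cubic, where E₁ and E₀ are the left sides of the two
  -- equations. The multipliers are the primitives of x · cubic and of the cubic.
  linear_combination (-(x ^ 5 / 5 + 9 * β * x ^ 4 / 4 + g * x ^ 3 / 3 - β * x ^ 2 / 2)) * h1 -
    (x ^ 4 / 4 + 3 * β * x ^ 3 + g * x ^ 2 / 2 - β * x) * h0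

theorem valid_zero {g : K} (hg : cubicEval g = 0) : Valid 0 g := by
  unfold cubicEval at hg
  exact ⟨by ring, by linear_combination hg⟩

theorem Valid.cubic {g : K} (h : Valid 0 g) : cubicEval g = 0 := by
  unfold cubicEval
  linear_combination h.2

/-- Both equations are polynomial in β², of degree 2; eliminating the term β⁴ leaves one that is
linear in β². -/
theorem Valid.sq_eq {β g : K} (h : Valid β g) (hβ : β ≠ 0) :
    36 * (9 * g + 1) ^ 2 * β ^ 2 = 69 * g ^ 3 + 187 * g ^ 2 + 39 * g - 335 := by
  have h1 := h.quadratic hβ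
  have h2 := h.2
  linear_combination (-1 / 3645 : K) * ((7290 * g + 486) * h1 - 131220 * h2)

/-- Substitution of the fraction for β² given by `Valid.sq_eq` into the quadratic equation, with
denominators cleared. -/
theorem Valid.product {β g : K} (h : Valid β g) (hβ : β ≠ 0) :
    (3 * g - 5) * quinticEval g = 0 := by
  have h1 := h.quadratic hβ
  have h2 := h.sq_eq hβ
  unfold quinticEval
  linear_combination (-1 / 311040 : K) * ((36 * (9 * g + 1) ^ 2) ^ 2 * h1 -
    (131220 * (36 * (9 * g + 1) ^ 2 * β ^ 2 + (69 * g ^ 3 + 187 * g ^ 2 + 39 * g - 335)) -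
      (6075 * g + 8235) * (36 * (9 * g + 1) ^ 2)) * h2)

theorem valid_of_sq_eq {β g : K} (h9 : 9 * g + 1 ≠ 0)
    (hg : (3 * g - 5) * quinticEval g = 0)
    (h2 : 36 * (9 * g + 1) ^ 2 * β ^ 2 = 69 * g ^ 3 + 187 * g ^ 2 + 39 * g - 335) : Valid β g := by
  unfold quinticEval at hg
  have h1 : 131220 * (β ^ 2) ^ 2 - (6075 * g + 8235) * β ^ 2 + 105 / 2 * g ^ 2 + 180 * g +
      375 / 2 = 0 := by
    refine (mul_eq_zero.1 ?_).resolve_left (pow_ne_zero 2 (mul_ne_zero (by norm_num :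
      (36 : K) ≠ 0) (pow_ne_zero 2 h9)))
    linear_combination (-311040 : K) * hg + (131220 * (36 * (9 * g + 1) ^ 2 * β ^ 2 + (69 * g ^ 3 + 187 * g ^ 2 + 39 * g - 335)) -
      (6075 * g + 8235) * (36 * (9 * g + 1) ^ 2)) * h2
  refine ⟨by rw [h1, mul_zero], ?_⟩
  linear_combination (1 / 131220 : K) * ((7290 * g + 486) * h1) + (3645 / 131220 : K) * h2

/-- The cubic is coprime to both factors: explicit Bézout identities produce a nonzero integer. So
the three families of parameters are disjoint from each other on the side of the cubic. -/
theorem cubicEval_ne_zero_of_product {g : K} (hg : (3 * g - 5) * quinticEval g = 0) :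
    cubicEval g ≠ 0 := by
  intro hc
  unfold cubicEval at hc
  rcases mul_eq_zero.1 hg with h | h
  · have h1 : (1220 : K) = 0 := by
      linear_combination 27 * hc - (9 * g ^ 2 + 60 * g + 190) * h
    norm_num at h1
  · unfold quinticEval at h
    have h1 : (297615532288 : K) = 0 := by
      linear_combination (159379670315 - 15963525645 * g - 20584621557 * g ^ 2 +
        2059235865 * g ^ 3 + 4571794710 * g ^ 4) * hc + (-135967814 - 83263720 * g -
        28220955 * g ^ 2) * h
    norm_num at h1

theorem Valid.eq_zero_iff {β g : K} (h : Valid β g) : β = 0 ↔ cubicEval g = 0 := by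
  constructor
  · rintro rfl
    exact h.cubic
  · intro hc
    by_contra hβ
    exact cubicEval_ne_zero_of_product (h.product hβ) hc

theorem nine_mul_add_one_ne_zero {g : K} (hg : (3 * g - 5) * quinticEval g = 0) :
    9 * g + 1 ≠ 0 := by
  intro h9
  have h1 : g = -1 / 9 := by linear_combination (1 / 9 : K) * h9
  rw [h1] at hg
  unfold quinticEval at hg
  norm_num at hg

/-- The parameter `g` determines `β` up to sign. -/
theorem Valid.sq_eq_sq {β β' g : K} (h : Valid β g) (h' : Valid β' g) : β' = β ∨ β' = -β := by
  by_cases hβ : β = 0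
  · have hc := h.eq_zero_iff.1 hβ
    left
    rw [hβ, h'.eq_zero_iff.2 hc]
  · have hβ' : β' ≠ 0 := fun h0 => hβ (h.eq_zero_iff.2 (h'.eq_zero_iff.1 h0))
    have h9 := nine_mul_add_one_ne_zero (h.product hβ)
    have h1 := h.sq_eq hβ
    have h2 := h'.sq_eq hβ'
    rw [← sq_eq_sq_iff_eq_or_eq_neg]
    refine mul_left_cancel₀ (mul_ne_zero (by norm_num) (pow_ne_zero 2 h9) :
      (36 * (9 * g + 1) ^ 2 : K) ≠ 0) ?_
    rw [h1, h2]

theorem exists_valid [IsAlgClosed K] {g : K}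
    (h : cubicEval g = 0 ∨ 3 * g - 5 = 0 ∨ quinticEval g = 0) : ∃ β, Valid β g := by
  by_cases hc : cubicEval g = 0
  · exact ⟨0, valid_zero hc⟩
  · have hg : (3 * g - 5) * quinticEval g = 0 := by
      rcases h.resolve_left hc with h | h <;> simp [h]
    have h9 := nine_mul_add_one_ne_zero hg
    obtain ⟨β, hβ⟩ := IsAlgClosed.exists_pow_nat_eq
      ((69 * g ^ 3 + 187 * g ^ 2 + 39 * g - 335) / (36 * (9 * g + 1) ^ 2)) two_pos
    refine ⟨β, valid_of_sq_eq h9 hg ?_⟩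
    rw [hβ]
    field_simp

end NormalForm

/-! ### Compatibility of the normal form with field homomorphisms -/

section Map

variable {K L : Type*} [Field K] [Field L] (f : K →+* L)

theorem cubicEval_map (g : K) : cubicEval (f g) = f (cubicEval g) := by
  simp only [cubicEval, map_add, map_mul, map_pow, map_ofNat]

theorem quinticEval_map (g : K) : quinticEval (f g) = f (quinticEval g) := by
  simp only [quinticEval, map_add, map_sub, map_mul, map_pow, map_ofNat]

theorem normConst_map (β g : K) : normConst (f β) (f g) = f (normConst β g) := by
  simp only [normConst, map_add, map_sub, map_mul, map_pow, map_div₀, map_ofNat, map_one]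

theorem normPoly_map (β g : K) : (normPoly β g).map f = normPoly (f β) (f g) := by
  simp only [normPoly, normNum, normQuad, normConst_map, Polynomial.map_mul, Polynomial.map_pow,
    Polynomial.map_sub, Polynomial.map_add, Polynomial.map_X, Polynomial.map_C, Polynomial.map_one,
    Polynomial.map_ofNat,
    map_mul, map_add, map_div₀, map_ofNat, map_one, map_inv₀]

theorem valid_map_iff {β g : K} : Valid (f β) (f g) ↔ Valid β g := by
  unfold Valid
  refine and_congr ?_ ?_ <;>
  · rw [← map_eq_zero_iff f f.injective]
    simp only [map_add, map_sub, map_mul, map_pow, map_div₀, map_ofNat]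

end Map

/-! ### The normal form is a Shabat polynomial -/

theorem natDegree_normNum (β g : ℂ) : (normNum β g).natDegree = 10 := by
  have h1 : (X ^ 2 - 1 : ℂ[X]).natDegree = 2 := by compute_degree!
  have h2 : (normQuad β g).natDegree = 2 := by
    unfold normQuad
    compute_degree!
  have h3 : (X ^ 2 - 1 : ℂ[X]) ≠ 0 := by
    intro h
    rw [h] at h1
    simp at h1
  have h4 : normQuad β g ≠ 0 := by
    intro h
    rw [h] at h2
    simp at h2
  rw [normNum, natDegree_mul (pow_ne_zero 4 h3) h4, natDegree_pow, h1, h2]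

theorem natDegree_normCubic (β g : ℂ) : (normCubic β g).natDegree = 3 := by
  unfold normCubic
  compute_degree!

theorem normCubic_ne_zero (β g : ℂ) : normCubic β g ≠ 0 := by
  intro h
  have := natDegree_normCubic β g
  rw [h] at this
  simp at this

theorem normNum_ne_zero (β g : ℂ) : normNum β g ≠ 0 := by
  intro h
  have := natDegree_normNum β g
  rw [h] at this
  simp at this

theorem sq_sub_one_ne_zero : (X ^ 2 - 1 : ℂ[X]) ≠ 0 := by
  intro h
  have h1 : (X ^ 2 - 1 : ℂ[X]).natDegree = 2 := by compute_degree!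
  rw [h] at h1
  simp at h1

theorem rootMultiplicity_pow_eq (p : ℂ[X]) (k : ℕ) (v : ℂ) :
    (p ^ k).rootMultiplicity v = k * p.rootMultiplicity v := by
  rw [← count_roots, roots_pow, Multiset.count_nsmul, count_roots]

/-- A complex polynomial all of whose critical points are roots has only one root. -/
theorem card_roots_eq_one_of_critical {F : ℂ[X]} (hF : F.natDegree ≠ 0)
    (h : ∀ z, F.derivative.eval z = 0 → F.eval z = 0) : F.roots.toFinset.card = 1 := by
  have hF0 : F ≠ 0 := by
    rintro rfl
    simp at hF
  have hd : F.derivative ≠ 0 := fun h0 => hF (derivative_eq_zero.1 h0)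
  have hsub : F.derivative.roots.toFinset ⊆ F.roots.toFinset := by
    intro z hz
    rw [Multiset.mem_toFinset, mem_roots hd] at hz
    rw [Multiset.mem_toFinset, mem_roots hF0]
    exact h z hz
  have h1 : F.derivative.natDegree = F.natDegree - 1 := natDegree_derivative F
  have h2 := (IsAlgClosed.splits F).natDegree_eq_card_roots
  have h3 := (IsAlgClosed.splits F.derivative).natDegree_eq_card_roots
  -- A root of multiplicity m of F contributes m - 1 to F', and F' has no other roots. Hence deg F -
  -- 1 equals deg F minus the number of distinct roots.
  have h4 : F.derivative.roots.card = ∑ v ∈ F.roots.toFinset, (F.roots.count v - 1) := by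
    rw [← Multiset.toFinset_sum_count_eq, Finset.sum_subset hsub]
    · refine Finset.sum_congr rfl fun v hv => ?_
      rw [Multiset.mem_toFinset, mem_roots hF0] at hv
      rw [count_roots, count_roots, derivative_rootMultiplicity_of_root hv]
    · intro v _ hv
      exact Multiset.count_eq_zero.2 fun h => hv (Multiset.mem_toFinset.2 h)
  have h5 : F.roots.card = ∑ v ∈ F.roots.toFinset, (F.roots.count v - 1) +
      F.roots.toFinset.card := by
    rw [← Multiset.toFinset_sum_count_eq, Finset.card_eq_sum_ones, ← Finset.sum_add_distrib]
    refine Finset.sum_congr rfl fun v hv => ?_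
    have := Multiset.count_pos.2 (Multiset.mem_toFinset.1 hv)
    omega
  omega

theorem eval_derivative_normNum (β g x : ℂ) :
    (normNum β g).derivative.eval x = 10 * (x ^ 2 - 1) ^ 3 * (normCubic β g).eval x := by
  rw [derivative_normNum]
  simp

theorem eval_normNum_one (β g : ℂ) : (normNum β g).eval 1 = 0 := by simp [normNum]

theorem eval_normNum_neg_one (β g : ℂ) : (normNum β g).eval (-1) = 0 := by simp [normNum]

theorem Valid.eval_cubic_root {β g : ℂ} (h : Valid β g) {x : ℂ}
    (hx : (normCubic β g).eval x = 0) : (normNum β g).eval x = normConst β g := by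
  rw [h.normNum_eq]
  simp [hx]

/-- If the second critical value were 0, every critical point would be a root, so there would be
only one root; but 1 and -1 are both roots. -/
theorem Valid.normConst_ne_zero {β g : ℂ} (h : Valid β g) : normConst β g ≠ 0 := by
  intro hk
  have hcard := card_roots_eq_one_of_critical (F := normNum β g)
    (by rw [natDegree_normNum]; norm_num) (fun z hz => by
      rw [eval_derivative_normNum] at hz
      rcases mul_eq_zero.1 hz with h1 | h1
      · have h2 : z ^ 2 - 1 = 0 := by simpa using h1
        simp [normNum, h2]
      · rw [h.eval_cubic_root h1, hk])
  have h1 : (1 : ℂ) ∈ (normNum β g).roots.toFinset := by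
    rw [Multiset.mem_toFinset, mem_roots (normNum_ne_zero β g)]
    exact eval_normNum_one β g
  have h2 : (-1 : ℂ) ∈ (normNum β g).roots.toFinset := by
    rw [Multiset.mem_toFinset, mem_roots (normNum_ne_zero β g)]
    exact eval_normNum_neg_one β g
  have := Finset.card_le_one.1 hcard.le _ h1 _ h2
  norm_num at this

theorem Valid.isShabat {β g : ℂ} (h : Valid β g) : IsShabat (normPoly β g) := by
  have hk := h.normConst_ne_zero
  have hd : ∀ z, (normPoly β g).derivative.eval z = 0 ↔
      z ^ 2 - 1 = 0 ∨ (normCubic β g).eval z = 0 := by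
    intro z
    rw [normPoly, derivative_C_mul, eval_mul, eval_C, eval_derivative_normNum]
    simp [hk]
  have he : ∀ z, (normPoly β g).eval z = (normConst β g)⁻¹ * (normNum β g).eval z := fun z => by
    simp [normPoly]
  ext y
  simp only [Set.mem_image, Set.mem_ofPred_eq, hd, he, Set.mem_insert_iff, Set.mem_singleton_iff]
  constructor
  · rintro ⟨z, hz | hz, rfl⟩
    · left
      simp [normNum, hz]
    · right
      rw [h.eval_cubic_root hz, inv_mul_cancel₀ hk]
  · rintro (rfl | rfl)
    · exact ⟨1, by simp, by simp [eval_normNum_one]⟩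
    · obtain ⟨z, hz⟩ := IsAlgClosed.exists_root (normCubic β g) (by
        intro hdeg
        have := natDegree_eq_of_degree_eq_some hdeg
        rw [natDegree_normCubic] at this
        norm_num at this)
      exact ⟨z, Or.inr hz, by rw [h.eval_cubic_root hz, inv_mul_cancel₀ hk]⟩

/-- The list of multiplicities of a polynomial whose roots in `s` have multiplicity `m`
and whose other roots are simple. -/
theorem rootMults_eq {q : ℂ[X]} {n m : ℕ} (hq0 : q ≠ 0) (hq : q.natDegree = n) {s : Finset ℂ}
    (hm : m ≠ 0) (hs : ∀ v ∈ s, q.rootMultiplicity v = m)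
    (ht : ∀ v, v ∉ s → q.eval v = 0 → q.rootMultiplicity v = 1) :
    rootMults q = Multiset.replicate s.card m + Multiset.replicate (n - m * s.card) 1 := by
  have hsub : s ⊆ q.roots.toFinset := by
    intro v hv
    rw [Multiset.mem_toFinset, mem_roots hq0, ← rootMultiplicity_pos hq0, hs v hv]
    exact Nat.pos_of_ne_zero hm
  have hsplit : q.roots.toFinset = s.disjUnion (q.roots.toFinset \ s) Finset.disjoint_sdiff := by
    rw [Finset.disjUnion_eq_union, Finset.union_sdiff_of_subset hsub]
  have ht' : ∀ v ∈ q.roots.toFinset \ s, q.rootMultiplicity v = 1 := by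
    intro v hv
    rw [Finset.mem_sdiff, Multiset.mem_toFinset, mem_roots hq0] at hv
    exact ht v hv.2 hv.1
  have hcard : n = m * s.card + (q.roots.toFinset \ s).card := by
    rw [← hq, (IsAlgClosed.splits q).natDegree_eq_card_roots, ← Multiset.toFinset_sum_count_eq]
    conv_lhs => rw [hsplit]
    rw [Finset.sum_disjUnion, Finset.sum_congr rfl (g := fun _ => m)
      (fun v hv => by rw [count_roots, hs v hv]),
      Finset.sum_congr rfl (s₁ := q.roots.toFinset \ s) (g := fun _ => 1)
      (fun v hv => by rw [count_roots, ht' v hv])]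
    simp [mul_comm]
  have hcard' : (q.roots.toFinset \ s).card = n - m * s.card := by omega
  rw [rootMults, hsplit, Finset.disjUnion_val, Multiset.map_add,
    Multiset.map_congr rfl (g := fun _ => m) (fun v hv => hs v hv),
    Multiset.map_congr rfl (s := (q.roots.toFinset \ s).val) (g := fun _ => 1)
      (fun v hv => ht' v hv),
    Multiset.map_const', Multiset.map_const', Finset.card_val, Finset.card_val, hcard']

theorem Valid.natDegree_normPoly {β g : ℂ} (h : Valid β g) : (normPoly β g).natDegree = 10 := by
  rw [normPoly, natDegree_C_mul (inv_ne_zero h.normConst_ne_zero), natDegree_normNum]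

theorem rootMultiplicity_C_mul {a : ℂ} (ha : a ≠ 0) {q : ℂ[X]} (hq : q ≠ 0) (v : ℂ) :
    (C a * q).rootMultiplicity v = q.rootMultiplicity v := by
  rw [rootMultiplicity_mul (mul_ne_zero (C_ne_zero.2 ha) hq), rootMultiplicity_C, zero_add]

theorem Valid.rootMultiplicity_derivative {β g : ℂ} (h : Valid β g) (v : ℂ) :
    (normPoly β g).derivative.rootMultiplicity v =
      3 * (X ^ 2 - 1 : ℂ[X]).rootMultiplicity v + (normCubic β g).rootMultiplicity v := by
  have hk := inv_ne_zero h.normConst_ne_zero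
  have hA := pow_ne_zero 3 sq_sub_one_ne_zero
  have h10 : (10 : ℂ) ≠ 0 := by norm_num
  have hne : C 10 * (X ^ 2 - 1) ^ 3 * normCubic β g ≠ 0 :=
    mul_ne_zero (mul_ne_zero (C_ne_zero.2 h10) hA) (normCubic_ne_zero β g)
  rw [normPoly, derivative_C_mul, derivative_normNum, rootMultiplicity_C_mul hk hne,
    rootMultiplicity_mul hne, rootMultiplicity_C_mul h10 hA, rootMultiplicity_pow_eq]

theorem rootMultiplicity_sq_sub_one {v : ℂ} (hv : v = 1 ∨ v = -1) :
    (X ^ 2 - 1 : ℂ[X]).rootMultiplicity v = 1 := by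
  have hroot : (X ^ 2 - 1 : ℂ[X]).IsRoot v := by
    rcases hv with rfl | rfl <;> simp
  have h1 : 0 < (X ^ 2 - 1 : ℂ[X]).rootMultiplicity v :=
    (rootMultiplicity_pos sq_sub_one_ne_zero).2 hroot
  have h2 : ¬ 1 < (X ^ 2 - 1 : ℂ[X]).rootMultiplicity v := by
    rw [one_lt_rootMultiplicity_iff_isRoot sq_sub_one_ne_zero]
    rintro ⟨-, h⟩
    have h3 : 2 * v = 0 := by
      simpa [IsRoot.def, derivative_pow, one_add_one_eq_two] using h
    rcases hv with rfl | rfl <;> norm_num at h3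
  omega

theorem Valid.eval_normPoly {β g : ℂ} (x : ℂ) :
    (normPoly β g).eval x = (normConst β g)⁻¹ * (normNum β g).eval x := by
  simp [normPoly]

/-- The derivative vanishes to order exactly 3 at v: the cubic is nonzero there, since its roots lie
over the other critical value. -/
theorem Valid.rootMultiplicity_quad_root {β g : ℂ} (h : Valid β g) {v : ℂ} (hv : v = 1 ∨ v = -1) :
    (normPoly β g).rootMultiplicity v = 4 := by
  have hp0 := IsShabat.ne_zero h.isShabat
  have hN : (normNum β g).eval v = 0 := by
    rcases hv with rfl | rfl
    · exact eval_normNum_one β g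
    · exact eval_normNum_neg_one β g
  have hroot : (normPoly β g).IsRoot v := by
    rw [IsRoot.def, Valid.eval_normPoly, hN, mul_zero]
  have h1 := derivative_rootMultiplicity_of_root hroot
  rw [h.rootMultiplicity_derivative, rootMultiplicity_sq_sub_one hv,
    rootMultiplicity_eq_zero (p := normCubic β g)] at h1
  · omega
  · intro hc
    exact h.normConst_ne_zero (by rw [← h.eval_cubic_root hc, hN])

theorem Valid.rootMultiplicity_simple_root {β g : ℂ} (h : Valid β g) {v : ℂ}
    (hv : ¬ (v = 1 ∨ v = -1)) (hroot : (normPoly β g).eval v = 0) :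
    (normPoly β g).rootMultiplicity v = 1 := by
  have hp0 := IsShabat.ne_zero h.isShabat
  have hN : (normNum β g).eval v = 0 := by
    rw [Valid.eval_normPoly] at hroot
    exact (mul_eq_zero.1 hroot).resolve_left (inv_ne_zero h.normConst_ne_zero)
  have h1 := derivative_rootMultiplicity_of_root (p := normPoly β g) (t := v) hroot
  have h2 := (rootMultiplicity_pos hp0).2 hroot
  rw [h.rootMultiplicity_derivative, rootMultiplicity_eq_zero (p := normCubic β g),
    rootMultiplicity_eq_zero (p := (X ^ 2 - 1 : ℂ[X]))] at h1
  · omega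
  · intro h3
    apply hv
    have h4 : v ^ 2 = 1 := by simpa [IsRoot.def, sub_eq_zero] using h3
    exact sq_eq_one_iff.1 h4
  · intro hc
    exact h.normConst_ne_zero (by rw [← h.eval_cubic_root hc, hN])

theorem Valid.rootMults_normPoly {β g : ℂ} (h : Valid β g) :
    rootMults (normPoly β g) = {4, 4, 1, 1} := by
  rw [rootMults_eq (IsShabat.ne_zero h.isShabat) h.natDegree_normPoly (s := {1, -1}) (m := 4)
    (by norm_num) (fun v hv => h.rootMultiplicity_quad_root (by simpa using hv))
    (fun v hv => h.rootMultiplicity_simple_root (by simpa using hv))]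
  rw [Finset.card_pair (by norm_num)]
  rfl

theorem Valid.one_sub_normPoly {β g : ℂ} (h : Valid β g) :
    1 - normPoly β g = C (-(normConst β g)⁻¹) * (normCubic β g ^ 2 * normQuartic β g) := by
  have hk := h.normConst_ne_zero
  refine Polynomial.funext fun x => ?_
  simp only [normPoly, h.normNum_eq, eval_sub, eval_one, eval_mul, eval_add, eval_C, eval_pow]
  field_simp
  ring

/-- Let k be the multiplicity of the cubic at a root v of 1 - p. The derivative shows that 1 - p has
multiplicity k + 1 at v, and the factor cubic² shows that it is at least 2k. So k ≤ 1, and the cubic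
has three simple roots. -/
theorem Valid.rootMults_one_sub {β g : ℂ} (h : Valid β g) :
    rootMults (1 - normPoly β g) = {2, 2, 2, 1, 1, 1, 1} := by
  have hk := h.normConst_ne_zero
  have hq0 := IsShabat.ne_zero (IsShabat.reflect h.isShabat rfl)
  have hmult : ∀ v, (1 - normPoly β g).eval v = 0 → (1 - normPoly β g).rootMultiplicity v =
      (normCubic β g).rootMultiplicity v + 1 := by
    intro v hv
    have h1 := derivative_rootMultiplicity_of_root (p := 1 - normPoly β g) (t := v) hv
    have h2 := (rootMultiplicity_pos hq0).2 hv
    have h3 : (1 - normPoly β g).derivative = C (-1) * (normPoly β g).derivative := by simp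
    have hd0 : (normPoly β g).derivative ≠ 0 :=
      fun h0 => by simpa [h.natDegree_normPoly] using derivative_eq_zero.1 h0
    rw [h3, rootMultiplicity_C_mul (by norm_num) hd0, h.rootMultiplicity_derivative,
      rootMultiplicity_eq_zero (p := (X ^ 2 - 1 : ℂ[X]))] at h1
    · omega
    · intro h4
      have h5 : v ^ 2 - 1 = 0 := by simpa [IsRoot.def] using h4
      have h6 : (normPoly β g).eval v = 0 := by simp [Valid.eval_normPoly, normNum, h5]
      rw [eval_sub, h6] at hv
      simp at hv
  have hge : ∀ v, 2 * (normCubic β g).rootMultiplicity v ≤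
      (1 - normPoly β g).rootMultiplicity v := by
    intro v
    rw [h.one_sub_normPoly] at hq0 ⊢
    rw [rootMultiplicity_mul hq0, rootMultiplicity_mul (right_ne_zero_of_mul hq0),
      rootMultiplicity_pow_eq]
    omega
  have hroot : ∀ v, (normCubic β g).eval v = 0 → (1 - normPoly β g).eval v = 0 := by
    intro v hv
    rw [h.one_sub_normPoly]
    simp [hv]
  have hcubic : ∀ v, (normCubic β g).eval v = 0 → (normCubic β g).rootMultiplicity v = 1 := by
    intro v hv
    have h1 := hmult v (hroot v hv)
    have h2 := hge v
    have h3 := (rootMultiplicity_pos (normCubic_ne_zero β g)).2 hv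
    omega
  have hcard : (normCubic β g).roots.toFinset.card = 3 := by
    rw [Multiset.toFinset_card_of_nodup, ← (IsAlgClosed.splits _).natDegree_eq_card_roots,
      natDegree_normCubic]
    rw [Multiset.nodup_iff_count_le_one]
    intro v
    rw [count_roots]
    by_cases hv : (normCubic β g).eval v = 0
    · exact (hcubic v hv).le
    · rw [rootMultiplicity_eq_zero hv]
      exact zero_le_one
  have hdeg : (1 - normPoly β g).natDegree = 10 := by
    rw [← neg_sub, natDegree_neg, ← C_1, natDegree_sub_C, h.natDegree_normPoly]
  rw [rootMults_eq hq0 hdeg (s := (normCubic β g).roots.toFinset) (m := 2) (by norm_num)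
    (fun v hv => ?_) (fun v hv hv' => ?_), hcard]
  · rfl
  · rw [Multiset.mem_toFinset, mem_roots (normCubic_ne_zero β g)] at hv
    rw [hmult v (hroot v hv), hcubic v hv]
  · rw [Multiset.mem_toFinset, mem_roots (normCubic_ne_zero β g)] at hv
    rw [hmult v hv', rootMultiplicity_eq_zero hv]

/-! ### Uniqueness of the normal form -/

/-- This describes the normalizing points ±1 intrinsically, so any affine equivalence of normal
forms must preserve the pair. -/
theorem Valid.double_root_iff {β g : ℂ} (h : Valid β g) (z : ℂ) :
    ((normPoly β g).eval z = 0 ∧ (normPoly β g).derivative.eval z = 0) ↔ z = 1 ∨ z = -1 := by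
  have hk := inv_ne_zero h.normConst_ne_zero
  rw [Valid.eval_normPoly, normPoly, derivative_C_mul, eval_mul, eval_C, eval_derivative_normNum]
  constructor
  · rintro ⟨h1, h2⟩
    have h3 := (mul_eq_zero.1 h1).resolve_left hk
    rcases mul_eq_zero.1 ((mul_eq_zero.1 h2).resolve_left hk) with h4 | h4
    · have h5 : (z - 1) * (z + 1) = 0 := by
        have : z ^ 2 - 1 = 0 := by simpa using h4
        linear_combination this
      rcases mul_eq_zero.1 h5 with h6 | h6
      · exact Or.inl (sub_eq_zero.1 h6)
      · exact Or.inr (eq_neg_of_add_eq_zero_left h6)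
    · exact absurd ((h.eval_cubic_root h4).symm.trans h3) h.normConst_ne_zero
  · rintro (rfl | rfl)
    · simp [eval_normNum_one]
    · simp [eval_normNum_neg_one]

/-- Affinely equivalent normal forms have the same parameter `g`. -/
theorem Valid.eq_of_comp {β g β' g' a b : ℂ} (h : Valid β g) (h' : Valid β' g') (ha : a ≠ 0)
    (hcomp : normPoly β' g' = (normPoly β g).comp (C a * X + C b)) : g' = g := by
  have heval : ∀ z, (normPoly β' g').eval z = (normPoly β g).eval (a * z + b) := by
    intro z
    simp [hcomp]
  have hder : ∀ z, (normPoly β' g').derivative.eval z =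
      a * (normPoly β g).derivative.eval (a * z + b) := by
    intro z
    simp [hcomp, derivative_comp]
  have hmem : ∀ z, z = 1 ∨ z = -1 → a * z + b = 1 ∨ a * z + b = -1 := by
    intro z hz
    obtain ⟨h1, h2⟩ := (h'.double_root_iff z).2 hz
    rw [← h.double_root_iff]
    rw [heval] at h1
    rw [hder] at h2
    exact ⟨h1, (mul_eq_zero.1 h2).resolve_left ha⟩
  -- An affine bijection that preserves {1, -1} is x ↦ x or x ↦ -x.
  have hab : b = 0 ∧ a ^ 2 = 1 := by
    rcases hmem 1 (Or.inl rfl) with h1 | h1 <;> rcases hmem (-1) (Or.inr rfl) with h2 | h2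
    · exact absurd (by linear_combination (h1 - h2) / 2) ha
    · have hb : b = 0 := by linear_combination (h1 + h2) / 2
      have ha1 : a = 1 := by linear_combination (h1 - h2) / 2
      exact ⟨hb, by rw [ha1, one_pow]⟩
    · have hb : b = 0 := by linear_combination (h1 + h2) / 2
      have ha1 : a = -1 := by linear_combination (h1 - h2) / 2
      exact ⟨hb, by rw [ha1]; norm_num⟩
    · exact absurd (by linear_combination (h1 - h2) / 2) ha
  obtain ⟨rfl, ha2⟩ := hab
  have hquad : ∀ x : ℂ, x ^ 2 - 1 ≠ 0 →
      (normConst β' g')⁻¹ * (x ^ 2 + 10 * β' * x + (5 * g' + 1) / 4) =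
      (normConst β g)⁻¹ * (x ^ 2 + 10 * β * (a * x) + (5 * g + 1) / 4) := by
    intro x hx
    have h1 := heval x
    simp only [Valid.eval_normPoly, normNum, normQuad, eval_mul, eval_pow, eval_sub, eval_add,
      eval_X, eval_one, eval_C, add_zero, mul_pow, ha2, one_mul] at h1
    refine mul_left_cancel₀ (pow_ne_zero 4 hx) ?_
    linear_combination h1
  -- The points 0, 2, -2 avoid ±1. The second difference compares the leading coefficients, and the
  -- value at 0 then compares the constant terms, hence g.
  have e0 := hquad 0 (by norm_num)
  have e1 := hquad 2 (by norm_num)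
  have e2 := hquad (-2) (by norm_num)
  have hk : (normConst β' g')⁻¹ = (normConst β g)⁻¹ := by
    linear_combination (e1 + e2 - 2 * e0) / 8
  rw [hk] at e0
  have h3 := mul_left_cancel₀ (inv_ne_zero h.normConst_ne_zero) e0
  linear_combination (4 / 5 : ℂ) * h3

/-! ### The nine trees -/

/-- The white rotation of the trees `D(k, l)`. -/
def starWhite : Equiv.Perm (Fin 10) := c[0, 1, 2, 3] * c[4, 5, 6, 7]

/-- The black rotation of the tree `D(k, l)`. -/
def starBlack (k l : Fin 10) : Equiv.Perm (Fin 10) :=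
  Equiv.swap 0 4 * Equiv.swap k 8 * Equiv.swap l 9

/-- The positions of the extra leaves of the nine trees: first the three symmetric ones, then the
special one, then the others. -/
def starPos : Fin 9 → Fin 10 × Fin 10 :=
  ![(2, 6), (3, 7), (1, 5), (1, 3), (1, 2), (2, 3), (1, 6), (2, 7), (1, 7)]

/-- The black rotation of the `r`-th tree. -/
def repBlack (r : Fin 9) : Equiv.Perm (Fin 10) := starBlack (starPos r).1 (starPos r).2

/-- The edge of a tree that is reached from the edge `j` in the same way as the edge `m`
of `D(k, l)` is reached from the edge `0`. -/
def edgeLabel (k l : Fin 10) (w b : Equiv.Perm (Fin 10)) (j m : Fin 10) : Fin 10 :=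
  if m = 8 then b (starLabel w b j k) else if m = 9 then b (starLabel w b j l) else starLabel w b j m
where
  /-- The label of the edges at the two vertices of valency four. -/
  starLabel (w b : Equiv.Perm (Fin 10)) (j m : Fin 10) : Fin 10 :=
    ![j, w j, w (w j), w (w (w j)), b j, w (b j), w (w (b j)), w (w (w (b j))), j, j] m

theorem repBlack_involutive : ∀ r, ∀ i, repBlack r (repBlack r i) = i := by
  decide +kernel

theorem starPos_spec : ∀ r, repBlack r 0 = 4 ∧ repBlack r (starPos r).1 = 8 ∧
    repBlack r (starPos r).2 = 9 ∧ (starPos r).1 < 8 ∧ (starPos r).2 < 8 := by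
  decide +kernel

theorem starWhite_apply : starWhite 0 = 1 ∧ starWhite 1 = 2 ∧ starWhite 2 = 3 ∧ starWhite 4 = 5 ∧
    starWhite 5 = 6 ∧ starWhite 6 = 7 := by
  decide +kernel

/-- A map that respects the rotations is determined by the image of the edge `0`. -/
theorem eq_edgeLabel {r : Fin 9} {w b : Equiv.Perm (Fin 10)} {σ : Fin 10 → Fin 10}
    (hw : ∀ i, σ (starWhite i) = w (σ i)) (hb : ∀ i, σ (repBlack r i) = b (σ i)) (m : Fin 10) :
    σ m = edgeLabel (starPos r).1 (starPos r).2 w b (σ 0) m := by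
  obtain ⟨h0, h1, h2, h4, h5, h6⟩ := starWhite_apply
  obtain ⟨b0, bk, bl, hk, hl⟩ := starPos_spec r
  have e1 : σ 1 = w (σ 0) := by rw [← hw, h0]
  have e2 : σ 2 = w (w (σ 0)) := by rw [← e1, ← hw, h1]
  have e3 : σ 3 = w (w (w (σ 0))) := by rw [← e2, ← hw, h2]
  have e4 : σ 4 = b (σ 0) := by rw [← hb, b0]
  have e5 : σ 5 = w (b (σ 0)) := by rw [← e4, ← hw, h4]
  have e6 : σ 6 = w (w (b (σ 0))) := by rw [← e5, ← hw, h5]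
  have e7 : σ 7 = w (w (w (b (σ 0)))) := by rw [← e6, ← hw, h6]
  have hs : ∀ m : Fin 10, m < 8 → edgeLabel.starLabel w b (σ 0) m = σ m := by
    intro m hm
    fin_cases m
    · rfl
    · exact e1.symm
    · exact e2.symm
    · exact e3.symm
    · exact e4.symm
    · exact e5.symm
    · exact e6.symm
    · exact e7.symm
    · exact absurd hm (by decide)
    · exact absurd hm (by decide)
  unfold edgeLabel
  split_ifs with h8 h9
  · rw [hs _ hk, ← hb, bk, h8]
  · rw [hs _ hl, ← hb, bl, h9]
  · rw [hs]
    omega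

/-- An isotopy is determined by the image j of the edge 0, which makes this a finite check. It
yields both that the nine trees are distinct and that automorphisms other than the identity occur
only for r < 3. -/
theorem rep_rigid : ∀ r r' : Fin 9, ∀ j : Fin 10,
    (∀ m, edgeLabel (starPos r).1 (starPos r).2 starWhite (repBlack r') j (starWhite m) =
      starWhite (edgeLabel (starPos r).1 (starPos r).2 starWhite (repBlack r') j m)) →
    (∀ m, edgeLabel (starPos r).1 (starPos r).2 starWhite (repBlack r') j (repBlack r m) =
      repBlack r' (edgeLabel (starPos r).1 (starPos r).2 starWhite (repBlack r') j m)) →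
    r = r' ∧ (j = 0 ∨ r < 3 ∧ j = 4) := by
  decide +kernel

/-- A reflection conjugates the rotations to their inverses; the black one is an involution, so only
the white one changes. The condition j < 4 keeps the vertex u fixed and cannot be dropped: D(1,3')
has a reflection exchanging u and u'. -/
theorem rep_chiral : ∀ r : Fin 9, ∀ j : Fin 10, j < 4 →
    (∀ m, edgeLabel (starPos r).1 (starPos r).2 starWhite⁻¹ (repBlack r) j (starWhite m) =
      starWhite⁻¹ (edgeLabel (starPos r).1 (starPos r).2 starWhite⁻¹ (repBlack r) j m)) →
    (∀ m, edgeLabel (starPos r).1 (starPos r).2 starWhite⁻¹ (repBlack r) j (repBlack r m) =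
      repBlack r (edgeLabel (starPos r).1 (starPos r).2 starWhite⁻¹ (repBlack r) j m)) →
    r ≤ 3 := by
  decide +kernel

theorem exists_mem_edgeLabel {H : Subgroup (Equiv.Perm (Fin 10))} {w b : Equiv.Perm (Fin 10)}
    (hw : w ∈ H) (hb : b ∈ H) (k l j m : Fin 10) : ∃ g ∈ H, g j = edgeLabel k l w b j m := by
  have hs : ∀ m, ∃ g ∈ H, g j = edgeLabel.starLabel w b j m := by
    intro m
    have hww := H.mul_mem hw hw
    have hwww := H.mul_mem hw hww
    fin_cases m
    · exact ⟨1, H.one_mem, rfl⟩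
    · exact ⟨_, hw, rfl⟩
    · exact ⟨_, hww, rfl⟩
    · exact ⟨_, hwww, rfl⟩
    · exact ⟨_, hb, rfl⟩
    · exact ⟨_, H.mul_mem hw hb, rfl⟩
    · exact ⟨_, H.mul_mem hww hb, rfl⟩
    · exact ⟨_, H.mul_mem hwww hb, rfl⟩
    · exact ⟨1, H.one_mem, rfl⟩
    · exact ⟨1, H.one_mem, rfl⟩
  unfold edgeLabel
  split_ifs
  · obtain ⟨g, hg, h⟩ := hs k
    exact ⟨b * g, H.mul_mem hb hg, by rw [Equiv.Perm.mul_apply, h]⟩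
  · obtain ⟨g, hg, h⟩ := hs l
    exact ⟨b * g, H.mul_mem hb hg, by rw [Equiv.Perm.mul_apply, h]⟩
  · exact hs m

/-- For the tree itself and j = 0 the labelling `edgeLabel` is the identity, so it exhibits a word
in the rotations leading from the edge 0 to any other. -/
theorem rep_transitive {H : Subgroup (Equiv.Perm (Fin 10))} {r : Fin 9} (hw : starWhite ∈ H)
    (hb : repBlack r ∈ H) (m : Fin 10) : ∃ g ∈ H, g 0 = m := by
  obtain ⟨g, hg, h⟩ := exists_mem_edgeLabel hw hb (starPos r).1 (starPos r).2 0 m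
  exact ⟨g, hg, h.trans (eq_edgeLabel (σ := id) (fun _ => rfl) (fun _ => rfl) m).symm⟩

theorem starWhite_parts : starWhite.partition.parts = {4, 4, 1, 1} := by
  rw [partition_parts_eq starWhite (![0, 0, 0, 0, 1, 1, 1, 1, 2, 3] : Fin 10 → Fin 4)
    (by decide +kernel)]
  decide +kernel

theorem repBlack_parts (r : Fin 9) :
    (repBlack r).partition.parts = {2, 2, 2, 1, 1, 1, 1} := by
  -- The cycles of an involution are labelled by their least elements.
  have hcyc : ∀ i j, min i (repBlack r i) = min j (repBlack r j) ↔
      (repBlack r).SameCycle i j := by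
    intro i j
    have hinv := repBlack_involutive r
    constructor
    · intro h
      have key : j = i ∨ j = repBlack r i := by
        rcases min_choice i (repBlack r i) with h1 | h1 <;>
          rcases min_choice j (repBlack r j) with h2 | h2 <;> rw [h1, h2] at h
        · exact Or.inl h.symm
        · right
          rw [h, hinv]
        · exact Or.inr h.symm
        · exact Or.inl ((repBlack r).injective h).symm
      rcases key with rfl | rfl
      · exact Equiv.Perm.SameCycle.refl _ _
      · exact ⟨1, by simp⟩
    · rintro ⟨n, rfl⟩
      have hsq : repBlack r * repBlack r = 1 := Equiv.ext hinv
      rcases Int.even_or_odd' n with ⟨c, rfl | rfl⟩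
      · rw [zpow_mul, zpow_two, hsq, one_zpow, Equiv.Perm.one_apply]
      · rw [zpow_add, zpow_mul, zpow_two, hsq, one_zpow, one_mul, zpow_one, hinv, min_comm]
  rw [partition_parts_eq (repBlack r) (fun i => min i (repBlack r i)) hcyc]
  clear hcyc
  revert r
  decide +kernel

/-- The `r`-th tree. -/
def repTree (r : Fin 9) : PlaneTree 10 where
  white := starWhite
  black := repBlack r
  connected := by
    have hw : starWhite ∈ Subgroup.closure {starWhite, repBlack r} :=
      Subgroup.subset_closure (Set.mem_insert _ _)
    have hb : repBlack r ∈ Subgroup.closure {starWhite, repBlack r} :=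
      Subgroup.subset_closure (Set.mem_insert_of_mem _ rfl)
    refine ⟨fun x y => ?_⟩
    obtain ⟨g, hg, hx⟩ := rep_transitive hw hb x
    obtain ⟨g', hg', hy⟩ := rep_transitive hw hb y
    refine ⟨⟨g', hg'⟩ * ⟨g, hg⟩⁻¹, ?_⟩
    change (g' * g⁻¹) x = y
    rw [← hx]
    simpa using hy
  card_vertices := by rw [starWhite_parts, repBlack_parts]; rfl

theorem repTree_mem_treeType (r : Fin 9) :
    (⟦repTree r⟧ : TreeClass 10) ∈ treeType 10 {4, 4, 1, 1} {2, 2, 2, 1, 1, 1, 1} :=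
  ⟨repTree r, rfl, starWhite_parts, repBlack_parts r⟩

theorem isDoubleStar_rep_iff (r : Fin 9) (x : TreeClass 10) :
    IsDoubleStar (starPos r).1 (starPos r).2 x ↔ x = ⟦repTree r⟧ := by
  constructor
  · rintro ⟨T, rfl, hw, hb⟩
    refine Quotient.sound ⟨1, fun i => ?_, fun i => ?_⟩
    · exact congrArg (fun w : Equiv.Perm (Fin 10) => w i) hw
    · exact congrArg (fun w : Equiv.Perm (Fin 10) => w i) hb
  · rintro rfl
    exact ⟨repTree r, rfl, rfl, rfl⟩

theorem repTree_isotopic_rigid {r r' : Fin 9} {σ : Equiv.Perm (Fin 10)}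
    (hw : ∀ i, σ (starWhite i) = starWhite (σ i))
    (hb : ∀ i, σ (repBlack r i) = repBlack r' (σ i)) : r = r' ∧ (σ 0 = 0 ∨ r < 3 ∧ σ 0 = 4) := by
  have h := eq_edgeLabel hw hb
  refine rep_rigid r r' (σ 0) (fun m => ?_) (fun m => ?_)
  · rw [← h, ← h, hw]
  · rw [← h, ← h, hb]

theorem repTree_injective : Function.Injective fun r => (⟦repTree r⟧ : TreeClass 10) := by
  intro r r' h
  obtain ⟨σ, hw, hb⟩ := Quotient.exact h
  exact (repTree_isotopic_rigid hw hb).1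

/-- A reversing symmetry that fixes both vertices of valency four exists only for the symmetric
and the special trees. -/
theorem repTree_reflection {r : Fin 9} {σ : Equiv.Perm (Fin 10)}
    (hw : ∀ i, starWhite (σ (starWhite i)) = σ i)
    (hb : ∀ i, repBlack r (σ (repBlack r i)) = σ i)
    (h0 : starWhite.SameCycle 0 (σ 0)) : r ≤ 3 := by
  have hw' : ∀ i, σ (starWhite i) = starWhite⁻¹ (σ i) := fun i => by
    rw [Equiv.Perm.eq_inv_iff_eq, hw]
  have hb' : ∀ i, σ (repBlack r i) = repBlack r (σ i) := fun i => by
    rw [← hb i, repBlack_involutive]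
  have h := eq_edgeLabel hw' hb'
  have h4 : σ 0 < 4 := by
    generalize σ 0 = j at h0
    revert h0 j
    decide +kernel
  refine rep_chiral r (σ 0) h4 (fun m => ?_) (fun m => ?_)
  · rw [← h, ← h, hw']
  · rw [← h, ← h, hb']

/-- The half turn of the double star. -/
def halfTurn : Equiv.Perm (Fin 10) :=
  Equiv.swap 0 4 * Equiv.swap 1 5 * Equiv.swap 2 6 * Equiv.swap 3 7 * Equiv.swap 8 9

theorem halfTurn_white : ∀ i, halfTurn (starWhite i) = starWhite (halfTurn i) := by
  decide +kernel

theorem halfTurn_black : ∀ r : Fin 9, r < 3 → ∀ i,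
    halfTurn (repBlack r i) = repBlack r (halfTurn i) := by
  decide +kernel

theorem mem_aut_iff {n : ℕ} (T : PlaneTree n) (σ : Equiv.Perm (Fin n)) :
    σ ∈ T.aut ↔ (∀ i, σ (T.white i) = T.white (σ i)) ∧ ∀ i, σ (T.black i) = T.black (σ i) := by
  rw [PlaneTree.aut, Subgroup.mem_centralizer_iff]
  constructor
  · intro h
    exact ⟨fun i => (congrArg (fun w : Equiv.Perm (Fin n) => w i) (h _ (Set.mem_insert _ _))).symm,
      fun i => (congrArg (fun w : Equiv.Perm (Fin n) => w i)
        (h _ (Set.mem_insert_of_mem _ rfl))).symm⟩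
  · rintro ⟨h1, h2⟩ g (rfl | rfl)
    · exact Equiv.ext fun i => (h1 i).symm
    · exact Equiv.ext fun i => (h2 i).symm

theorem repTree_isSymmetric_iff (r : Fin 9) : (repTree r).IsSymmetric 2 ↔ r < 3 := by
  have hdet : ∀ σ τ : Equiv.Perm (Fin 10), σ ∈ (repTree r).aut → τ ∈ (repTree r).aut →
      σ 0 = τ 0 → σ = τ := by
    intro σ τ hσ hτ h0
    rw [mem_aut_iff] at hσ hτ
    refine Equiv.ext fun m => ?_
    rw [eq_edgeLabel hσ.1 hσ.2, eq_edgeLabel hτ.1 hτ.2 m, h0]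
  have hone := (repTree r).aut.one_mem
  by_cases hr : r < 3
  · refine iff_of_true ⟨one_lt_two, ?_⟩ hr
    have hmem : halfTurn ∈ (repTree r).aut :=
      (mem_aut_iff _ _).2 ⟨halfTurn_white, halfTurn_black r hr⟩
    have h4 : halfTurn 0 = 4 := by decide +kernel
    have hset : ((repTree r).aut : Set (Equiv.Perm (Fin 10))) = {1, halfTurn} := by
      ext σ
      constructor
      · intro hσ
        have h := (mem_aut_iff _ _).1 hσ
        rcases (repTree_isotopic_rigid h.1 h.2).2 with h0 | ⟨-, h0⟩
        · exact Or.inl (hdet _ _ hσ hone h0)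
        · exact Or.inr (hdet _ _ hσ hmem (h0.trans h4.symm))
      · rintro (rfl | rfl)
        · exact hone
        · exact hmem
    have hne : (1 : Equiv.Perm (Fin 10)) ≠ halfTurn := by
      intro h
      rw [← h] at h4
      exact absurd h4 (by decide)
    rw [← SetLike.coe_sort_coe, Nat.card_coe_set_eq, hset, Set.ncard_pair hne]
  · refine iff_of_false ?_ hr
    rintro ⟨-, hcard⟩
    have hbot : (repTree r).aut = ⊥ := by
      rw [Subgroup.eq_bot_iff_forall]
      intro σ hσ
      have h := (mem_aut_iff _ _).1 hσ
      rcases (repTree_isotopic_rigid h.1 h.2).2 with h0 | ⟨h3, -⟩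
      · exact hdet _ _ hσ hone h0
      · exact absurd h3 hr
    rw [hbot, Subgroup.card_bot] at hcard
    exact absurd hcard (by norm_num)

/-! ### There are no other trees of the type -/

theorem forall_of_invariant {n : ℕ} (T : PlaneTree n) (P : Fin n → Prop)
    (hw : ∀ i, P (T.white i) ↔ P i) (hb : ∀ i, P (T.black i) ↔ P i) {i : Fin n} (hi : P i)
    (j : Fin n) : P j := by
  have hinv : ∀ g ∈ Subgroup.closure {T.white, T.black}, ∀ i, P (g i) ↔ P i := by
    intro g hg
    induction hg using Subgroup.closure_induction with
    | mem x hx =>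
      rcases hx with rfl | rfl
      · exact hw
      · exact hb
    | one => exact fun _ => Iff.rfl
    | mul x y _ _ hx hy => exact fun i => (hx _).trans (hy i)
    | inv x _ hx =>
      intro i
      rw [← hx (x⁻¹ i)]
      simp
  obtain ⟨⟨g, hg⟩, h⟩ := T.connected.exists_smul_eq i j
  have h' : g i = j := h
  rw [← h', hinv g hg]
  exact hi

theorem isConj_of_parts_eq {n : ℕ} {σ τ : Equiv.Perm (Fin n)}
    (h : σ.partition.parts = τ.partition.parts) : IsConj σ τ :=
  Equiv.Perm.partition_eq_of_isConj.2 (Nat.Partition.ext h)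

/-- The two stars can be rotated independently without changing the white rotation, so the edges
that join them may be taken to be 0 and 4. -/
theorem exists_rotation : ∀ x y : Fin 10, x < 4 → 4 ≤ y → y < 8 → ∃ i j : Fin 4,
    (c[0, 1, 2, 3] ^ i.val * c[4, 5, 6, 7] ^ j.val : Equiv.Perm (Fin 10)) x = 0 ∧
    (c[0, 1, 2, 3] ^ i.val * c[4, 5, 6, 7] ^ j.val : Equiv.Perm (Fin 10)) y = 4 ∧
    (c[0, 1, 2, 3] ^ i.val * c[4, 5, 6, 7] ^ j.val : Equiv.Perm (Fin 10)) 8 = 8 ∧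
    (c[0, 1, 2, 3] ^ i.val * c[4, 5, 6, 7] ^ j.val : Equiv.Perm (Fin 10)) 9 = 9 ∧
    ∀ m, (c[0, 1, 2, 3] ^ i.val * c[4, 5, 6, 7] ^ j.val : Equiv.Perm (Fin 10)) (starWhite m) =
      starWhite ((c[0, 1, 2, 3] ^ i.val * c[4, 5, 6, 7] ^ j.val : Equiv.Perm (Fin 10)) m) := by
  decide +kernel

/-- The symmetries of the white rotation that fix the edges `0` and `4` or exchange them. -/
def turn (e f : Fin 2) : Equiv.Perm (Fin 10) := halfTurn ^ e.val * Equiv.swap 8 9 ^ f.val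

/-- After the joining edges are normalized there remain the half turn and the exchange of the two
leaves; every pair of positions can be moved to one of the nine listed ones. -/
theorem exists_rep_of_starBlack : ∀ k l : Fin 10, k < 8 → l < 8 → k ≠ l → k ≠ 0 → k ≠ 4 → l ≠ 0 →
    l ≠ 4 → ∃ (r : Fin 9) (e f : Fin 2), (∀ m, turn e f (starWhite m) = starWhite (turn e f m)) ∧
      ∀ m, turn e f (starBlack k l m) = repBlack r (turn e f m) := by
  decide +kernel

theorem eq_swaps {b : Equiv.Perm (Fin 10)} (hinv : ∀ i, b (b i) = i) (hcard : b.support.card = 6)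
    {x y k l : Fin 10} (hx : b x = y) (h8 : b 8 = k) (h9 : b 9 = l) (hx4 : x < 4) (hy4 : 4 ≤ y)
    (hy8 : y < 8) (hk : k < 8) (hl : l < 8) :
    b = Equiv.swap x y * Equiv.swap k 8 * Equiv.swap l 9 := by
  have hy : b y = x := by rw [← hx, hinv]
  have hk8 : b k = 8 := by rw [← h8, hinv]
  have hl9 : b l = 9 := by rw [← h9, hinv]
  have hxy : x ≠ y := by omega
  have hkl : k ≠ l := fun h => by
    have : (8 : Fin 10) = 9 := by rw [← hk8, ← hl9, h]
    exact absurd this (by decide)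
  have hxk : x ≠ k := fun h => by rw [h, hk8] at hx; omega
  have hyk : y ≠ k := fun h => by rw [h, hk8] at hy; omega
  have hxl : x ≠ l := fun h => by rw [h, hl9] at hx; omega
  have hyl : y ≠ l := fun h => by rw [h, hl9] at hy; omega
  have hx8 : x ≠ 8 := by omega
  have hx9 : x ≠ 9 := by omega
  have hy8' : y ≠ 8 := by omega
  have hy9 : y ≠ 9 := by omega
  have hk8' : k ≠ 8 := by omega
  have hk9 : k ≠ 9 := by omega
  have hl8 : l ≠ 8 := by omega
  have hl9' : l ≠ 9 := by omega
  have h89 : (8 : Fin 10) ≠ 9 := by decide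
  have hsupp : ({x, y, k, l, 8, 9} : Finset (Fin 10)) = b.support := by
    refine Finset.eq_of_subset_of_card_le ?_ ?_
    · intro i hi
      simp only [Finset.mem_insert, Finset.mem_singleton] at hi
      rw [Equiv.Perm.mem_support]
      rcases hi with rfl | rfl | rfl | rfl | rfl | rfl
      · rw [hx]; exact hxy.symm
      · rw [hy]; exact hxy
      · rw [hk8]; exact hk8'.symm
      · rw [hl9]; exact hl9'.symm
      · rw [h8]; exact hk8'
      · rw [h9]; exact hl9'
    · rw [hcard]
      simp [*]
  have hsw := fun (a b c : Fin 10) => @Equiv.swap_apply_of_ne_of_ne (Fin 10) _ a b c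
  refine Equiv.ext fun i => ?_
  rw [Equiv.Perm.mul_apply, Equiv.Perm.mul_apply]
  by_cases hi : i ∈ b.support
  · rw [← hsupp] at hi
    simp only [Finset.mem_insert, Finset.mem_singleton] at hi
    rcases hi with h | h | h | h | h | h <;> rw [h]
    · rw [hx, hsw l 9 x hxl hx9, hsw k 8 x hxk hx8, Equiv.swap_apply_left]
    · rw [hy, hsw l 9 y hyl hy9, hsw k 8 y hyk hy8', Equiv.swap_apply_right]
    · rw [hk8, hsw l 9 k hkl hk9, Equiv.swap_apply_left, hsw x y 8 hx8.symm hy8'.symm]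
    · rw [hl9, Equiv.swap_apply_left, hsw k 8 9 hk9.symm h89.symm, hsw x y 9 hx9.symm hy9.symm]
    · rw [h8, hsw l 9 8 hl8.symm h89, Equiv.swap_apply_right, hsw x y k hxk.symm hyk.symm]
    · rw [h9, Equiv.swap_apply_right, hsw k 8 l hkl.symm hl8, hsw x y l hxl.symm hyl.symm]
  · rw [Equiv.Perm.notMem_support.1 hi]
    rw [← hsupp] at hi
    simp only [Finset.mem_insert, Finset.mem_singleton, not_or] at hi
    obtain ⟨i1, i2, i3, i4, i5, i6⟩ := hi
    rw [hsw l 9 i i4 i6, hsw k 8 i i3 i5, hsw x y i i1 i2]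

/-- Conjugate the white rotation to `starWhite`. The black one is then a product of three disjoint
transpositions. By connectedness each leaf edge 8, 9 is paired with an edge of a star, and some pair
joins the two stars; this uses up all three transpositions. -/
theorem isotopic_repTree (T : PlaneTree 10) (hw : T.whiteValencies = {4, 4, 1, 1})
    (hb : T.blackValencies = {2, 2, 2, 1, 1, 1, 1}) : ∃ r, T.Isotopic (repTree r) := by
  obtain ⟨c, hc⟩ := isConj_iff.1 (isConj_of_parts_eq (hw.trans starWhite_parts.symm))
  obtain ⟨d, hd⟩ := isConj_iff.1 (isConj_of_parts_eq ((repBlack_parts 0).trans hb.symm))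
  set b := c * T.black * c⁻¹ with hbdef
  have hcw : ∀ i, c (T.white i) = starWhite (c i) := fun i => by
    rw [← hc]
    simp
  have hcb : ∀ i, c (T.black i) = b (c i) := fun i => by
    rw [hbdef]
    simp
  have hinv : ∀ i, b (b i) = i := by
    have h1 : b * b = 1 := by
      have h2 : repBlack 0 * repBlack 0 = 1 := Equiv.ext (repBlack_involutive 0)
      calc b * b = c * d * (repBlack 0 * repBlack 0) * d⁻¹ * c⁻¹ := by
            rw [hbdef, ← hd]
            group
        _ = 1 := by
            rw [h2]
            group
    exact fun i => congrArg (fun w : Equiv.Perm (Fin 10) => w i) h1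
  have hcard : b.support.card = 6 := by
    rw [hbdef, Equiv.Perm.card_support_conj, ← hd, Equiv.Perm.card_support_conj]
    decide +kernel
  have hconn : ∀ P : Fin 10 → Prop, (∀ i, P (starWhite i) ↔ P i) → (∀ i, P i → P (b i)) →
      ∀ i, P i → ∀ j, P j := by
    intro P h1 h2 i hi j
    have h3 := forall_of_invariant T (fun i => P (c i)) (fun i => by rw [hcw, h1])
      (fun i => by
        rw [hcb]
        exact ⟨fun h => by simpa [hinv] using h2 _ h, h2 _⟩) (i := c⁻¹ i) (by simpa using hi)
      (c⁻¹ j)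
    simpa using h3
  have hne88 : b 8 ≠ 8 := fun h => absurd (hconn (· = 8) (by decide +kernel)
    (by rintro i rfl; exact h) 8 rfl 0) (by decide)
  have hne99 : b 9 ≠ 9 := fun h => absurd (hconn (· = 9) (by decide +kernel)
    (by rintro i rfl; exact h) 9 rfl 0) (by decide)
  have hne89 : b 8 ≠ 9 := fun h => absurd (hconn (fun i => i = 8 ∨ i = 9) (by decide +kernel)
    (by
      rintro i (rfl | rfl)
      · exact Or.inr h
      · left
        rw [← h, hinv]) 8 (Or.inl rfl) 0) (by decide)
  have hne98 : b 9 ≠ 8 := fun h => hne89 (by rw [← h, hinv])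
  have hk : b 8 < 8 := by omega
  have hl : b 9 < 8 := by omega
  obtain ⟨x, hx4, hy4, hy8⟩ : ∃ x, x < 4 ∧ 4 ≤ b x ∧ b x < 8 := by
    by_contra! hcon
    -- If no black vertex joined the two stars, the edges of the first star together with the leaves
    -- hung on it would form a component without the edge 4.
    have h := hconn (fun i => i < 4 ∨ (i = 8 ∧ b 8 < 4) ∨ (i = 9 ∧ b 9 < 4))
      (fun i => by
        generalize b 8 = k
        generalize b 9 = l
        revert i k l
        decide +kernel)
      (fun i hi => by
        rcases hi with hi | ⟨rfl, hi⟩ | ⟨rfl, hi⟩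
        · by_cases h1 : b i < 4
          · exact Or.inl h1
          · have h2 := hcon i hi (not_lt.1 h1)
            have h3 : b i = 8 ∨ b i = 9 := by omega
            rcases h3 with h3 | h3
            · refine Or.inr (Or.inl ⟨h3, ?_⟩)
              rw [← h3, hinv]
              exact hi
            · refine Or.inr (Or.inr ⟨h3, ?_⟩)
              rw [← h3, hinv]
              exact hi
        · exact Or.inl hi
        · exact Or.inl hi) 0 (Or.inl (by decide)) 4
    rcases h with h | ⟨h, -⟩ | ⟨h, -⟩
    · exact absurd h (by decide)
    · exact absurd h (by decide)
    · exact absurd h (by decide)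
  have hform := eq_swaps hinv hcard rfl rfl rfl hx4 hy4 hy8 hk hl
  obtain ⟨i, j, h0, h4, h8, h9, hcomm⟩ := exists_rotation x (b x) hx4 hy4 hy8
  set ρ : Equiv.Perm (Fin 10) := c[0, 1, 2, 3] ^ i.val * c[4, 5, 6, 7] ^ j.val
  have hswap : ∀ s t, ρ * Equiv.swap s t = Equiv.swap (ρ s) (ρ t) * ρ :=
    Equiv.mul_swap_eq_swap_mul ρ
  have hρb : ρ * b = starBlack (ρ (b 8)) (ρ (b 9)) * ρ := by
    rw [starBlack]
    conv_lhs => rw [hform]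
    rw [← mul_assoc, ← mul_assoc, hswap, mul_assoc _ ρ, hswap, ← mul_assoc, mul_assoc _ ρ, hswap,
      h0, h4, h8, h9, ← mul_assoc]
  have hρ8 : ∀ m, m < 8 → ρ m < 8 := by
    intro m hm
    have h1 : ρ m ≠ 8 := fun h => by
      have := ρ.injective (h.trans h8.symm)
      omega
    have h2 : ρ m ≠ 9 := fun h => by
      have := ρ.injective (h.trans h9.symm)
      omega
    omega
  have hbx : b (b x) = x := hinv x
  have hb8 : b (b 8) = 8 := hinv 8
  have hb9 : b (b 9) = 9 := hinv 9
  obtain ⟨r, e, f, hfw, hfb⟩ := exists_rep_of_starBlack (ρ (b 8)) (ρ (b 9)) (hρ8 _ hk) (hρ8 _ hl)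
    (fun h => absurd (b.injective (ρ.injective h)) (by decide))
    (fun h => by
      have h1 := ρ.injective (h.trans h0.symm)
      rw [h1] at hb8
      omega)
    (fun h => by
      have h1 := b.injective (ρ.injective (h.trans h4.symm))
      omega)
    (fun h => by
      have h1 := ρ.injective (h.trans h0.symm)
      rw [h1] at hb9
      omega)
    (fun h => by
      have h1 := b.injective (ρ.injective (h.trans h4.symm))
      omega)
  refine ⟨r, turn e f * ρ * c, fun m => ?_, fun m => ?_⟩
  · rw [Equiv.Perm.mul_apply, Equiv.Perm.mul_apply, hcw, hcomm, hfw]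
    rfl
  · have h := congrArg (fun w : Equiv.Perm (Fin 10) => w (c m)) hρb
    simp only [Equiv.Perm.mul_apply] at h
    rw [Equiv.Perm.mul_apply, Equiv.Perm.mul_apply, hcb, h, hfb]
    rfl

theorem treeType_eq_range : treeType 10 {4, 4, 1, 1} {2, 2, 2, 1, 1, 1, 1} =
    Set.range fun r => (⟦repTree r⟧ : TreeClass 10) := by
  ext x
  constructor
  · rintro ⟨T, rfl, hw, hb⟩
    obtain ⟨r, h⟩ := isotopic_repTree T hw hb
    exact ⟨r, (Quotient.sound h).symm⟩
  · rintro ⟨r, rfl⟩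
    exact repTree_mem_treeType r

theorem ncard_treeType : (treeType 10 {4, 4, 1, 1} {2, 2, 2, 1, 1, 1, 1}).ncard = 9 := by
  rw [treeType_eq_range, ← Set.image_univ, Set.ncard_image_of_injective _ repTree_injective,
    Set.ncard_univ, Nat.card_eq_fintype_card, Fintype.card_fin]

/-! ### The orders of the rotation groups -/

/-- One step of a stabilizer chain. -/
theorem card_eq_card_mul_card_stabilizer {n : ℕ} (H : Subgroup (Equiv.Perm (Fin n))) (a : Fin n)
    (S : Finset (Fin n)) (h1 : ∀ g ∈ H, g a ∈ S) (h2 : ∀ s ∈ S, ∃ g ∈ H, g a = s) :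
    Nat.card H = S.card *
      Nat.card (MulAction.stabilizer (Equiv.Perm (Fin n)) a ⊓ H : Subgroup (Equiv.Perm (Fin n))) := by
  classical
  have horb : MulAction.orbit H a = S := by
    ext s
    constructor
    · rintro ⟨g, rfl⟩
      exact h1 g g.2
    · intro hs
      obtain ⟨g, hg, h⟩ := h2 s hs
      exact ⟨⟨g, hg⟩, h⟩
  have hstab : MulAction.stabilizer H a =
      (MulAction.stabilizer (Equiv.Perm (Fin n)) a).subgroupOf H := by
    ext g
    rfl
  rw [← Subgroup.subgroupOf_map_subtype, Subgroup.card_map_of_injective H.subtype_injective,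
    ← hstab, ← Set.ncard_coe_finset, ← horb, ← Nat.card_coe_set_eq, ← Nat.card_prod]
  exact (Nat.card_congr (MulAction.orbitProdStabilizerEquivGroup H a)).symm

/-- The product of the permutations `w ^ i * b`, where `i` runs through a list of exponents. -/
def word (w b : Equiv.Perm (Fin 10)) (L : List ℕ) : Equiv.Perm (Fin 10) :=
  (L.map fun i => w ^ i * b).prod

theorem word_mem {H : Subgroup (Equiv.Perm (Fin 10))} {w b : Equiv.Perm (Fin 10)} (hw : w ∈ H)
    (hb : b ∈ H) (L : List ℕ) : word w b L ∈ H := by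
  refine H.list_prod_mem fun x hx => ?_
  obtain ⟨i, -, rfl⟩ := List.mem_map.1 hx
  exact H.mul_mem (H.pow_mem hw i) hb

theorem white_mem {n : ℕ} (T : PlaneTree n) : T.white ∈ T.rotationGroup :=
  Subgroup.subset_closure (Set.mem_insert _ _)

theorem black_mem {n : ℕ} (T : PlaneTree n) : T.black ∈ T.rotationGroup :=
  Subgroup.subset_closure (Set.mem_insert_of_mem _ rfl)

theorem commute_of_mem_aut {n : ℕ} {T : PlaneTree n} {σ g : Equiv.Perm (Fin n)} (hσ : σ ∈ T.aut)
    (hg : g ∈ T.rotationGroup) (i : Fin n) : g (σ i) = σ (g i) := by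
  have h : T.rotationGroup ≤ Subgroup.centralizer {σ} := by
    rw [PlaneTree.rotationGroup, Subgroup.closure_le]
    intro x hx
    rw [SetLike.mem_coe, Subgroup.mem_centralizer_iff]
    rintro _ rfl
    exact (Subgroup.mem_centralizer_iff.1 hσ x hx).symm
  exact congrArg (fun w : Equiv.Perm (Fin n) => w i)
    (Subgroup.mem_centralizer_iff.1 (h hg) σ rfl).symm

/-- Words in the rotations of the symmetric trees that fix one, two, three and four pairs
of opposite edges. -/
def symmWord (r : Fin 9) (t : Fin 4) : Equiv.Perm (Fin 10) :=
  word starWhite (repBlack r)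
    -- One row for each symmetric tree and one word for each level of the stabilizer chain. The
    -- index r is reduced modulo 3, so the rows have this meaning only for r < 3.
    ((![![[0, 1, 1, 2, 2], [0, 2, 1, 1, 1], [1, 2, 1, 2, 2, 3, 1, 2, 2], [1, 2, 1, 3, 3, 1, 2]],
      ![[0, 1, 2, 1, 2], [0, 1, 3, 1, 1, 3, 2], [0, 2, 1, 2, 2, 1, 2], [1, 2, 3, 1, 3, 2, 1]],
      ![[0, 2, 1, 2, 1], [3, 3, 1, 1, 3], [0, 1, 2, 2, 1], [1, 1, 2, 3, 1, 3, 2]]] :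
      Fin 3 → Fin 4 → List ℕ) (Fin.ofNat 3 r) t)

theorem symmWord_mem (r : Fin 9) (t : Fin 4) : symmWord r t ∈ (repTree r).rotationGroup :=
  word_mem (white_mem (repTree r)) (black_mem (repTree r)) _

/-- In this and the next three checks, the powers of a single word that fixes the earlier base
points already move the next base point to every edge not fixed so far. -/
theorem symmWord_zero : ∀ r : Fin 9, r < 3 → symmWord r 0 0 = 0 ∧
    ∀ s ∈ ({1, 2, 3, 5, 6, 7, 8, 9} : Finset (Fin 10)), ∃ i : Fin 10,
      (symmWord r 0 ^ i.val) 1 = s := by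
  decide +kernel

theorem symmWord_one : ∀ r : Fin 9, r < 3 → symmWord r 1 0 = 0 ∧ symmWord r 1 1 = 1 ∧
    ∀ s ∈ ({2, 3, 6, 7, 8, 9} : Finset (Fin 10)), ∃ i : Fin 10,
      (symmWord r 1 ^ i.val) 2 = s := by
  decide +kernel

theorem symmWord_two : ∀ r : Fin 9, r < 3 → symmWord r 2 0 = 0 ∧ symmWord r 2 1 = 1 ∧
    symmWord r 2 2 = 2 ∧ ∀ s ∈ ({3, 7, 8, 9} : Finset (Fin 10)), ∃ i : Fin 10,
      (symmWord r 2 ^ i.val) 3 = s := by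
  decide +kernel

theorem symmWord_three : ∀ r : Fin 9, r < 3 → symmWord r 3 0 = 0 ∧ symmWord r 3 1 = 1 ∧
    symmWord r 3 2 = 2 ∧ symmWord r 3 3 = 3 ∧ ∀ s ∈ ({8, 9} : Finset (Fin 10)), ∃ i : Fin 10,
      (symmWord r 3 ^ i.val) 8 = s := by
  decide +kernel

/-- The group commutes with the half turn, so an element fixing an edge also fixes the opposite one.
Along the base 0, 1, 2, 3, 8 the orbits therefore have at most 10, 8, 6, 4, 2 elements, and the
words attain these sizes; the product is 2⁵ · 5! = 3840. -/
theorem card_rotationGroup_symm {r : Fin 9} (hr : r < 3) :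
    Nat.card (repTree r).rotationGroup = 3840 := by
  set G := (repTree r).rotationGroup
  let St (a : Fin 10) := MulAction.stabilizer (Equiv.Perm (Fin 10)) a
  have hht : halfTurn ∈ (repTree r).aut :=
    (mem_aut_iff _ _).2 ⟨halfTurn_white, halfTurn_black r hr⟩
  have hcomm : ∀ g ∈ G, ∀ i, g (halfTurn i) = halfTurn (g i) := fun g hg =>
    commute_of_mem_aut hht hg
  have hturn : ∀ g ∈ G, ∀ i, g i = i → g (halfTurn i) = halfTurn i := fun g hg i h => by
    rw [hcomm g hg, h]
  have hht0 : halfTurn 0 = 4 ∧ halfTurn 1 = 5 ∧ halfTurn 2 = 6 ∧ halfTurn 3 = 7 ∧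
      halfTurn 8 = 9 := by decide +kernel
  obtain ⟨t0, t1, t2, t3, t8⟩ := hht0
  have hne : ∀ (g : Equiv.Perm (Fin 10)) (i j : Fin 10), g j = j → i ≠ j → g i ≠ j :=
    fun g i j hj hij h => hij (g.injective (h.trans hj.symm))
  obtain ⟨w00, w0⟩ := symmWord_zero r hr
  obtain ⟨w10, w11, w1⟩ := symmWord_one r hr
  obtain ⟨w20, w21, w22, w2⟩ := symmWord_two r hr
  obtain ⟨w30, w31, w32, w33, w3⟩ := symmWord_three r hr
  have c0 := card_eq_card_mul_card_stabilizer G 0 Finset.univ (fun _ _ => Finset.mem_univ _)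
    (fun s _ => rep_transitive (white_mem (repTree r)) (black_mem (repTree r)) s)
  have c1 := card_eq_card_mul_card_stabilizer (St 0 ⊓ G) 1 {1, 2, 3, 5, 6, 7, 8, 9}
    (by
      rintro g ⟨h0 : g 0 = 0, hg⟩
      have h4 := hturn g hg 0 h0
      rw [t0] at h4
      have n0 := hne g 1 0 h0 (by decide)
      have n4 := hne g 1 4 h4 (by decide)
      generalize g 1 = x at n0 n4
      revert x
      decide)
    (fun s hs => by
      obtain ⟨i, hi⟩ := w0 s hs
      exact ⟨_, Subgroup.pow_mem (St 0 ⊓ G) (x := symmWord r 0) ⟨w00, symmWord_mem r 0⟩ _, hi⟩)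
  have c2 := card_eq_card_mul_card_stabilizer (St 1 ⊓ (St 0 ⊓ G)) 2 {2, 3, 6, 7, 8, 9}
    (by
      rintro g ⟨h1 : g 1 = 1, h0 : g 0 = 0, hg⟩
      have h4 := hturn g hg 0 h0
      have h5 := hturn g hg 1 h1
      rw [t0] at h4
      rw [t1] at h5
      have n0 := hne g 2 0 h0 (by decide)
      have n4 := hne g 2 4 h4 (by decide)
      have n1 := hne g 2 1 h1 (by decide)
      have n5 := hne g 2 5 h5 (by decide)
      generalize g 2 = x at n0 n4 n1 n5
      revert x
      decide)
    (fun s hs => by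
      obtain ⟨i, hi⟩ := w1 s hs
      exact ⟨_, Subgroup.pow_mem (St 1 ⊓ (St 0 ⊓ G)) (x := symmWord r 1)
        ⟨w11, w10, symmWord_mem r 1⟩ _, hi⟩)
  have c3 := card_eq_card_mul_card_stabilizer (St 2 ⊓ (St 1 ⊓ (St 0 ⊓ G))) 3 {3, 7, 8, 9}
    (by
      rintro g ⟨h2 : g 2 = 2, h1 : g 1 = 1, h0 : g 0 = 0, hg⟩
      have h4 := hturn g hg 0 h0
      have h5 := hturn g hg 1 h1
      have h6 := hturn g hg 2 h2
      rw [t0] at h4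
      rw [t1] at h5
      rw [t2] at h6
      have n0 := hne g 3 0 h0 (by decide)
      have n4 := hne g 3 4 h4 (by decide)
      have n1 := hne g 3 1 h1 (by decide)
      have n5 := hne g 3 5 h5 (by decide)
      have n2 := hne g 3 2 h2 (by decide)
      have n6 := hne g 3 6 h6 (by decide)
      generalize g 3 = x at n0 n4 n1 n5 n2 n6
      revert x
      decide)
    (fun s hs => by
      obtain ⟨i, hi⟩ := w2 s hs
      exact ⟨_, Subgroup.pow_mem (St 2 ⊓ (St 1 ⊓ (St 0 ⊓ G))) (x := symmWord r 2)
        ⟨w22, w21, w20, symmWord_mem r 2⟩ _, hi⟩)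
  have c4 := card_eq_card_mul_card_stabilizer (St 3 ⊓ (St 2 ⊓ (St 1 ⊓ (St 0 ⊓ G)))) 8 {8, 9}
    (by
      rintro g ⟨h3 : g 3 = 3, h2 : g 2 = 2, h1 : g 1 = 1, h0 : g 0 = 0, hg⟩
      have h4 := hturn g hg 0 h0
      have h5 := hturn g hg 1 h1
      have h6 := hturn g hg 2 h2
      have h7 := hturn g hg 3 h3
      rw [t0] at h4
      rw [t1] at h5
      rw [t2] at h6
      rw [t3] at h7
      have n0 := hne g 8 0 h0 (by decide)
      have n4 := hne g 8 4 h4 (by decide)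
      have n1 := hne g 8 1 h1 (by decide)
      have n5 := hne g 8 5 h5 (by decide)
      have n2 := hne g 8 2 h2 (by decide)
      have n6 := hne g 8 6 h6 (by decide)
      have n3 := hne g 8 3 h3 (by decide)
      have n7 := hne g 8 7 h7 (by decide)
      generalize g 8 = x at n0 n4 n1 n5 n2 n6 n3 n7
      revert x
      decide)
    (fun s hs => by
      obtain ⟨i, hi⟩ := w3 s hs
      exact ⟨_, Subgroup.pow_mem (St 3 ⊓ (St 2 ⊓ (St 1 ⊓ (St 0 ⊓ G)))) (x := symmWord r 3)
        ⟨w33, w32, w31, w30, symmWord_mem r 3⟩ _, hi⟩)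
  have hbot : St 8 ⊓ (St 3 ⊓ (St 2 ⊓ (St 1 ⊓ (St 0 ⊓ G)))) = ⊥ := by
    rw [Subgroup.eq_bot_iff_forall]
    rintro g ⟨h8 : g 8 = 8, h3 : g 3 = 3, h2 : g 2 = 2, h1 : g 1 = 1, h0 : g 0 = 0, hg⟩
    have h4 := hturn g hg 0 h0
    have h5 := hturn g hg 1 h1
    have h6 := hturn g hg 2 h2
    have h7 := hturn g hg 3 h3
    have h9 := hturn g hg 8 h8
    rw [t0] at h4
    rw [t1] at h5
    rw [t2] at h6
    rw [t3] at h7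
    rw [t8] at h9
    refine Equiv.ext fun i => ?_
    fin_cases i <;> assumption
  rw [c0, c1, c2, c3, c4, hbot, Subgroup.card_bot]
  rfl

end Shabat

/-! ### The rotation group of the special tree -/

namespace Shabat

open scoped Pointwise

/-- The blocks of an inversive plane of order three which is preserved by the rotation group
of the special tree. -/
def planeBlocks : Finset (Finset (Fin 10)) :=
  (Finset.univ : Finset (Fin 10)).biUnion fun i =>
    ({{0, 1, 2, 7}, {0, 1, 4, 8}, {0, 2, 3, 5}} : Finset (Finset (Fin 10))).image
      fun s => s.image ((starWhite * repBlack 3) ^ i.val)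

theorem planeBlocks_white : ∀ s ∈ planeBlocks, s.image starWhite ∈ planeBlocks := by
  decide +kernel

theorem planeBlocks_black : ∀ s ∈ planeBlocks, s.image (repBlack 3) ∈ planeBlocks := by
  decide +kernel

/-- A permutation that maps the finite set of blocks into itself stabilizes it, so the check on the
two generators extends to the whole group. -/
theorem image_mem_planeBlocks {g : Equiv.Perm (Fin 10)} (hg : g ∈ (repTree 3).rotationGroup)
    {s : Finset (Fin 10)} (hs : s ∈ planeBlocks) : s.image g ∈ planeBlocks := by
  have hle : (repTree 3).rotationGroup ≤
      MulAction.stabilizer (Equiv.Perm (Fin 10)) planeBlocks := by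
    have key : ∀ x : Equiv.Perm (Fin 10), (∀ s ∈ planeBlocks, s.image x ∈ planeBlocks) →
        x ∈ MulAction.stabilizer (Equiv.Perm (Fin 10)) planeBlocks := by
      intro x hx
      rw [MulAction.mem_stabilizer_iff]
      refine Finset.eq_of_subset_of_card_le (fun s hs => ?_) (Finset.card_smul_finset x _).ge
      obtain ⟨t, ht, rfl⟩ := Finset.mem_smul_finset.1 hs
      exact hx t ht
    rw [PlaneTree.rotationGroup, Subgroup.closure_le]
    rintro x (rfl | rfl)
    · exact key _ planeBlocks_white
    · exact key _ planeBlocks_black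
  have h := MulAction.mem_stabilizer_iff.1 (hle hg)
  rw [← h]
  exact Finset.smul_mem_smul_finset hs

/-- The nontrivial element of the rotation group of the special tree that fixes `0`, `1`
and `2`. -/
def specialInvolution : Equiv.Perm (Fin 10) := word starWhite (repBlack 3) [0, 2, 3, 1, 2]

theorem planeBlocks_spec : {0, 1, 2, 7} ∈ planeBlocks ∧ {0, 1, 3, 6} ∈ planeBlocks ∧
    {0, 2, 3, 5} ∈ planeBlocks ∧ {0, 1, 5, 9} ∈ planeBlocks ∧ {0, 2, 4, 6} ∈ planeBlocks ∧
    {0, 1, 4, 8} ∈ planeBlocks ∧ {1, 4, 5, 6} ∈ planeBlocks := by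
  decide +kernel

theorem planeBlocks_unique : ∀ x, {0, 1, 2, x} ∈ planeBlocks → x = 7 := by
  decide +kernel

set_option synthInstance.maxSize 1000 in
set_option synthInstance.maxHeartbeats 400000 in
-- With 0, 1, 2 fixed, let e be the image of 3. Blocks through points whose images are known
-- restrict the images of 6, 5, 4, 9, 8 in turn, and only e = 3 and e = 5 survive. The order of the
-- quantifiers prunes the search early.
theorem planeBlocks_rigid : ∀ e : Fin 10, ∀ x6, {0, 1, e, x6} ∈ planeBlocks →
    ∀ x5, {0, 2, e, x5} ∈ planeBlocks → ∀ x4, {0, 2, x4, x6} ∈ planeBlocks →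
    {1, x4, x5, x6} ∈ planeBlocks → ∀ x9, {0, 1, x5, x9} ∈ planeBlocks →
    ∀ x8, {0, 1, x4, x8} ∈ planeBlocks →
      (e = 3 ∧ x4 = 4 ∧ x5 = 5 ∧ x6 = 6 ∧ x8 = 8 ∧ x9 = 9) ∨
      (e = 5 ∧ x4 = 8 ∧ x5 = 3 ∧ x6 = 9 ∧ x8 = 4 ∧ x9 = 6) := by
  decide +kernel

theorem specialInvolution_apply : specialInvolution 0 = 0 ∧ specialInvolution 1 = 1 ∧
    specialInvolution 2 = 2 ∧ specialInvolution 3 = 5 ∧ specialInvolution 4 = 8 ∧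
    specialInvolution 5 = 3 ∧ specialInvolution 6 = 9 ∧ specialInvolution 7 = 7 ∧
    specialInvolution 8 = 4 ∧ specialInvolution 9 = 6 := by
  decide +kernel

theorem eq_of_fix_three {g : Equiv.Perm (Fin 10)} (hg : g ∈ (repTree 3).rotationGroup)
    (h0 : g 0 = 0) (h1 : g 1 = 1) (h2 : g 2 = 2) : g = 1 ∨ g = specialInvolution := by
  obtain ⟨b1, b2, b3, b4, b5, b6, b7⟩ := planeBlocks_spec
  have himg := fun {s} => image_mem_planeBlocks hg (s := s)
  replace b1 := himg b1
  replace b2 := himg b2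
  replace b3 := himg b3
  replace b4 := himg b4
  replace b5 := himg b5
  replace b6 := himg b6
  replace b7 := himg b7
  simp only [Finset.image_insert, Finset.image_singleton, h0, h1, h2] at b1 b2 b3 b4 b5 b6 b7
  have h7 := planeBlocks_unique _ b1
  rcases planeBlocks_rigid _ _ b2 _ b3 _ b5 b7 _ b4 _ b6 with
    ⟨h3, h4, h5, h6, h8, h9⟩ | ⟨h3, h4, h5, h6, h8, h9⟩
  · left
    refine Equiv.ext fun i => ?_
    fin_cases i <;> assumption
  · right
    obtain ⟨i0, i1, i2, i3, i4, i5, i6, i7, i8, i9⟩ := specialInvolution_apply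
    refine Equiv.ext fun i => ?_
    fin_cases i
    · exact h0.trans i0.symm
    · exact h1.trans i1.symm
    · exact h2.trans i2.symm
    · exact h3.trans i3.symm
    · exact h4.trans i4.symm
    · exact h5.trans i5.symm
    · exact h6.trans i6.symm
    · exact h7.trans i7.symm
    · exact h8.trans i8.symm
    · exact h9.trans i9.symm

/-- Words in the rotations of the special tree. -/
def specialWord (t : Fin 3) : Equiv.Perm (Fin 10) :=
  word starWhite (repBlack 3) ((![[0, 1, 3], [0, 2, 1, 1], [1, 1, 3, 3, 1]] : Fin 3 → List ℕ) t)

theorem specialWord_mem (t : Fin 3) : specialWord t ∈ (repTree 3).rotationGroup :=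
  word_mem (white_mem (repTree 3)) (black_mem (repTree 3)) _

theorem specialWord_fix_zero : specialWord 0 0 = 0 ∧ specialWord 1 0 = 0 ∧
    ∀ s ∈ ({1, 2, 3, 4, 5, 6, 7, 8, 9} : Finset (Fin 10)), ∃ i j k : Fin 4,
      (specialWord 0 ^ i.val * specialWord 1 ^ j.val * specialWord 0 ^ k.val) 1 = s := by
  decide +kernel

theorem specialWord_fix_one : specialWord 2 0 = 0 ∧ specialWord 2 1 = 1 ∧
    ∀ s ∈ ({2, 3, 4, 5, 6, 7, 8, 9} : Finset (Fin 10)), ∃ i : Fin 10,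
      (specialWord 2 ^ i.val) 2 = s := by
  decide +kernel

theorem special_transitive_fix_zero {s : Fin 10}
    (hs : s ∈ ({1, 2, 3, 4, 5, 6, 7, 8, 9} : Finset (Fin 10))) :
    ∃ g ∈ MulAction.stabilizer (Equiv.Perm (Fin 10)) (0 : Fin 10) ⊓ (repTree 3).rotationGroup,
      g 1 = s := by
  obtain ⟨w00, w10, w⟩ := specialWord_fix_zero
  obtain ⟨i, j, k, h⟩ := w s hs
  have m0 : specialWord 0 ∈
      MulAction.stabilizer (Equiv.Perm (Fin 10)) (0 : Fin 10) ⊓ (repTree 3).rotationGroup :=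
    ⟨w00, specialWord_mem 0⟩
  have m1 : specialWord 1 ∈
      MulAction.stabilizer (Equiv.Perm (Fin 10)) (0 : Fin 10) ⊓ (repTree 3).rotationGroup :=
    ⟨w10, specialWord_mem 1⟩
  exact ⟨_, Subgroup.mul_mem _ (Subgroup.mul_mem _ (Subgroup.pow_mem _ m0 _)
    (Subgroup.pow_mem _ m1 _)) (Subgroup.pow_mem _ m0 _), h⟩

/-- The chain along 0, 1, 2 has full orbits of 10, 9, 8 points. The inversive plane bounds the
stabilizer of the three points by 2, and `specialInvolution` attains the bound. -/
theorem card_rotationGroup_special : Nat.card (repTree 3).rotationGroup = 1440 := by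
  set G := (repTree 3).rotationGroup
  let St (a : Fin 10) := MulAction.stabilizer (Equiv.Perm (Fin 10)) a
  have hne : ∀ (g : Equiv.Perm (Fin 10)) (i j : Fin 10), g j = j → i ≠ j → g i ≠ j :=
    fun g i j hj hij h => hij (g.injective (h.trans hj.symm))
  obtain ⟨w20, w21, w2⟩ := specialWord_fix_one
  have c0 := card_eq_card_mul_card_stabilizer G 0 Finset.univ (fun _ _ => Finset.mem_univ _)
    (fun s _ => rep_transitive (white_mem (repTree 3)) (black_mem (repTree 3)) s)
  have c1 := card_eq_card_mul_card_stabilizer (St 0 ⊓ G) 1 {1, 2, 3, 4, 5, 6, 7, 8, 9}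
    (by
      rintro g ⟨h0 : g 0 = 0, hg⟩
      have n0 := hne g 1 0 h0 (by decide)
      generalize g 1 = x at n0
      revert x
      decide)
    (fun s hs => special_transitive_fix_zero hs)
  have c2 := card_eq_card_mul_card_stabilizer (St 1 ⊓ (St 0 ⊓ G)) 2 {2, 3, 4, 5, 6, 7, 8, 9}
    (by
      rintro g ⟨h1 : g 1 = 1, h0 : g 0 = 0, hg⟩
      have n0 := hne g 2 0 h0 (by decide)
      have n1 := hne g 2 1 h1 (by decide)
      generalize g 2 = x at n0 n1
      revert x
      decide)
    (fun s hs => by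
      obtain ⟨i, hi⟩ := w2 s hs
      exact ⟨_, Subgroup.pow_mem (St 1 ⊓ (St 0 ⊓ G)) (x := specialWord 2)
        ⟨w21, w20, specialWord_mem 2⟩ _, hi⟩)
  obtain ⟨i0, i1, i2, i3, -⟩ := specialInvolution_apply
  have hset : ((St 2 ⊓ (St 1 ⊓ (St 0 ⊓ G)) : Subgroup (Equiv.Perm (Fin 10))) :
      Set (Equiv.Perm (Fin 10))) = {1, specialInvolution} := by
    ext g
    constructor
    · rintro ⟨h2 : g 2 = 2, h1 : g 1 = 1, h0 : g 0 = 0, hg⟩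
      exact eq_of_fix_three hg h0 h1 h2
    · rintro (rfl | rfl)
      · exact Subgroup.one_mem _
      · exact ⟨i2, i1, i0, word_mem (white_mem (repTree 3)) (black_mem (repTree 3)) _⟩
  have hne1 : (1 : Equiv.Perm (Fin 10)) ≠ specialInvolution := by
    intro h
    rw [← h] at i3
    exact absurd i3 (by decide)
  have c3 : Nat.card (St 2 ⊓ (St 1 ⊓ (St 0 ⊓ G)) : Subgroup (Equiv.Perm (Fin 10))) = 2 := by
    rw [← SetLike.coe_sort_coe, Nat.card_coe_set_eq, hset, Set.ncard_pair hne1]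
  rw [c0, c1, c2, c3]
  rfl

theorem special_two_transitive {a b : Fin 10} (h : a ≠ b) :
    ∃ g ∈ (repTree 3).rotationGroup, g 0 = a ∧ g 1 = b := by
  obtain ⟨g, hg, hga⟩ := rep_transitive (white_mem (repTree 3)) (black_mem (repTree 3)) a
  have hs : g⁻¹ b ∈ ({1, 2, 3, 4, 5, 6, 7, 8, 9} : Finset (Fin 10)) := by
    have h0 : g⁻¹ b ≠ 0 := by
      intro h0
      rw [Equiv.Perm.inv_eq_iff_eq] at h0
      exact h (hga.symm.trans h0.symm)
    generalize g⁻¹ b = x at h0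
    revert x
    decide
  obtain ⟨k, ⟨hk0 : k 0 = 0, hk⟩, hk1⟩ := special_transitive_fix_zero hs
  refine ⟨g * k, Subgroup.mul_mem _ hg hk, ?_, ?_⟩
  · rw [Equiv.Perm.mul_apply, hk0, hga]
  · rw [Equiv.Perm.mul_apply, hk1]
    simp

theorem isPreprimitive_special :
    MulAction.IsPreprimitive (repTree 3).rotationGroup (Fin 10) := by
  refine MulAction.isPreprimitive_of_is_two_pretransitive ?_
  rw [MulAction.is_two_pretransitive_iff]
  intro a b c d hab hcd
  obtain ⟨g, hg, rfl, rfl⟩ := special_two_transitive hab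
  obtain ⟨k, hk, rfl, rfl⟩ := special_two_transitive hcd
  refine ⟨⟨k, hk⟩ * ⟨g, hg⟩⁻¹, ?_, ?_⟩
  · change (k * g⁻¹) (g 0) = k 0
    simp
  · change (k * g⁻¹) (g 1) = k 1
    simp

/-! ### The trees with full rotation group -/

/-- Words in the rotations of the last five trees, a power of which is a transposition. -/
def swapWord (r : Fin 9) : Equiv.Perm (Fin 10) :=
  word starWhite (repBlack r)
    -- The empty words and zero exponents for r ≤ 3 are only fillers. The odd exponents 7 and 15
    -- remove the longer cycles and leave a transposition.
    ((![[], [], [], [], [2, 3, 2], [2, 2, 3], [2], [2], [2, 1, 3]] : Fin 9 → List ℕ) r) ^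
      (![0, 0, 0, 0, 7, 7, 15, 15, 7] : Fin 9 → ℕ) r

/-- `starWhite * repBlack r` is a 10-cycle. A transposition of two points whose distance k along it
is coprime to 10 generates S₁₀ together with it. -/
theorem swapWord_eq : ∀ r : Fin 9, 3 < r → ∃ (x : Fin 10) (k : Fin 10),
    Nat.Coprime k.val 10 ∧
    ∀ i, swapWord r i = Equiv.swap x (((starWhite * repBlack r) ^ k.val) x) i := by
  decide +kernel

theorem white_mul_black_pow : ∀ r : Fin 9, ∀ i : Fin 10, ∃ k : Fin 10,
    ((starWhite * repBlack r) ^ k.val) 0 = i := by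
  decide +kernel

theorem rotationGroup_eq_top {r : Fin 9} (hr : 3 < r) : (repTree r).rotationGroup = ⊤ := by
  obtain ⟨x, k, hk, hsw⟩ := swapWord_eq r hr
  have hw := white_mem (repTree r)
  have hb := black_mem (repTree r)
  set σ := starWhite * repBlack r with hσ
  have hσmem : σ ∈ (repTree r).rotationGroup := Subgroup.mul_mem _ hw hb
  have hfix : ∀ i, σ i ≠ i := by
    intro i hi
    obtain ⟨m, hm⟩ := white_mul_black_pow r i
    obtain ⟨m', hm'⟩ := white_mul_black_pow r (i + 1)
    rw [← hσ] at hm hm'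
    have h1 : ∀ n : ℕ, (σ ^ n) i = i := fun n => by
      induction n with
      | zero => rfl
      | succ n ih => rw [pow_succ, Equiv.Perm.mul_apply, hi, ih]
    have h2 : (0 : Fin 10) = i := (σ ^ m.val).injective (hm.trans (h1 _).symm)
    rw [h2, h1] at hm'
    revert hm'
    clear * -
    revert i
    decide
  have hcyc : σ.IsCycle := by
    refine ⟨0, hfix 0, fun y _ => ?_⟩
    obtain ⟨m, hm⟩ := white_mul_black_pow r y
    exact ⟨m.val, by rw [zpow_natCast]; exact hm⟩
  have hsupp : σ.support = Finset.univ := by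
    ext i
    simp [hfix i]
  rw [eq_top_iff, ← Equiv.Perm.closure_cycle_coprime_swap (n := k.val) (by simpa using hk) hcyc
    hsupp x, Subgroup.closure_le]
  rintro g (rfl | rfl)
  · exact hσmem
  · rw [← Equiv.ext hsw]
    exact Subgroup.pow_mem _ (word_mem hw hb _) _

/-! ### Invariance under isotopy -/

theorem closure_image_conj {G : Type*} [Group G] (s : G) (a b : G) :
    (Subgroup.closure {a, b}).map (MulAut.conj s).toMonoidHom =
      Subgroup.closure {s * a * s⁻¹, s * b * s⁻¹} := by
  rw [MonoidHom.map_closure, Set.image_pair]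
  rfl

theorem exists_conj_of_isotopic {n : ℕ} {T T' : PlaneTree n} (h : T.Isotopic T') :
    ∃ σ : Equiv.Perm (Fin n), T'.white = σ * T.white * σ⁻¹ ∧ T'.black = σ * T.black * σ⁻¹ := by
  obtain ⟨σ, hw, hb⟩ := h
  refine ⟨σ, ?_, ?_⟩
  · rw [eq_mul_inv_iff_mul_eq]
    exact Equiv.ext fun i => (hw i).symm
  · rw [eq_mul_inv_iff_mul_eq]
    exact Equiv.ext fun i => (hb i).symm

theorem rotationGroup_eq_map {n : ℕ} {T T' : PlaneTree n} {σ : Equiv.Perm (Fin n)}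
    (hw : T'.white = σ * T.white * σ⁻¹) (hb : T'.black = σ * T.black * σ⁻¹) :
    T'.rotationGroup = T.rotationGroup.map (MulAut.conj σ).toMonoidHom := by
  rw [PlaneTree.rotationGroup, PlaneTree.rotationGroup, closure_image_conj, hw, hb]

theorem card_rotationGroup_eq {n : ℕ} {T T' : PlaneTree n} (h : T.Isotopic T') :
    Nat.card T'.rotationGroup = Nat.card T.rotationGroup := by
  obtain ⟨σ, hw, hb⟩ := exists_conj_of_isotopic h
  rw [rotationGroup_eq_map hw hb]
  exact Subgroup.card_map_of_injective (MulAut.conj σ).injective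

theorem rotationGroup_eq_top_of_isotopic {n : ℕ} {T T' : PlaneTree n} (h : T.Isotopic T')
    (hT : T.rotationGroup = ⊤) : T'.rotationGroup = ⊤ := by
  obtain ⟨σ, hw, hb⟩ := exists_conj_of_isotopic h
  rw [rotationGroup_eq_map hw hb, hT]
  exact Subgroup.map_top_of_surjective _ (MulAut.conj σ).surjective

theorem isPreprimitive_of_isotopic {n : ℕ} {T T' : PlaneTree n} (h : T.Isotopic T')
    (hT : MulAction.IsPreprimitive T.rotationGroup (Fin n)) :
    MulAction.IsPreprimitive T'.rotationGroup (Fin n) := by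
  obtain ⟨σ, hw, hb⟩ := exists_conj_of_isotopic h
  have hmap := rotationGroup_eq_map hw hb
  let φ : T.rotationGroup → T'.rotationGroup := fun g =>
    ⟨σ * g * σ⁻¹, hmap ▸ Subgroup.mem_map_of_mem (MulAut.conj σ).toMonoidHom g.2⟩
  let f : Fin n →ₑ[φ] Fin n :=
    { toFun := σ
      map_smul' := fun g x => by
        change σ (g.1 x) = (σ * g.1 * σ⁻¹) (σ x)
        simp }
  exact MulAction.IsPreprimitive.of_surjective (f := f) σ.surjective

theorem isSymmetric_of_isotopic {n k : ℕ} {T T' : PlaneTree n} (h : T.Isotopic T')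
    (hT : T.IsSymmetric k) : T'.IsSymmetric k := by
  obtain ⟨σ, hw, hb⟩ := exists_conj_of_isotopic h
  have hmap : T'.aut = T.aut.map (MulAut.conj σ).toMonoidHom := by
    ext g
    rw [PlaneTree.aut, PlaneTree.aut, Subgroup.mem_map_equiv, Subgroup.mem_centralizer_iff,
      Subgroup.mem_centralizer_iff, hw, hb]
    have key : ∀ a : Equiv.Perm (Fin n), σ * a * σ⁻¹ * g = g * (σ * a * σ⁻¹) ↔
        a * (MulAut.conj σ).symm g = (MulAut.conj σ).symm g * a := by
      intro a
      rw [MulAut.conj_symm_apply, ← mul_left_cancel_iff (a := σ⁻¹), ← mul_right_cancel_iff (a := σ)]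
      simp only [mul_assoc, inv_mul_cancel_left, inv_mul_cancel, mul_one]
    simp only [Set.mem_insert_iff, Set.mem_singleton_iff, forall_eq_or_imp, forall_eq, key]
  refine ⟨hT.1, ?_⟩
  rw [hmap, ← hT.2]
  exact Subgroup.card_map_of_injective (MulAut.conj σ).injective

theorem isSymmetric_iff_of_isotopic {n k : ℕ} {T T' : PlaneTree n} (h : T.Isotopic T') :
    T.IsSymmetric k ↔ T'.IsSymmetric k :=
  ⟨isSymmetric_of_isotopic h, isSymmetric_of_isotopic ((PlaneTree.setoid n).iseqv.symm h)⟩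

/-! ### Arithmetic of the parameters -/

instance isAlgClosure_algNum : IsAlgClosure ℚ AlgNum := algebraicClosure.isAlgClosure ℚ ℂ

instance isAlgClosed_algNum : IsAlgClosed AlgNum := isAlgClosure_algNum.isAlgClosed

instance normal_algNum : Normal ℚ AlgNum := IsAlgClosure.normal ℚ AlgNum

/-- Two roots of an irreducible monic rational polynomial are conjugate. -/
theorem exists_algEquiv_of_irreducible {f : ℚ[X]} (hf : Irreducible f) (hm : f.Monic)
    {x y : AlgNum} (hx : aeval x f = 0) (hy : aeval y f = 0) :
    ∃ γ : AlgNum ≃ₐ[ℚ] AlgNum, γ x = y := by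
  refine (isConjRoot_iff_exists_algEquiv (K := ℚ)).1 ?_
  rw [isConjRoot_def, ← minpoly.eq_of_irreducible_of_monic hf hx hm,
    ← minpoly.eq_of_irreducible_of_monic hf hy hm]

theorem ncard_roots_of_irreducible {f : ℚ[X]} (hf : Irreducible f) :
    {x : AlgNum | aeval x f = 0}.ncard = f.natDegree := by
  have h := card_rootSet_eq_natDegree (K := AlgNum) hf.separable (IsAlgClosed.splits _)
  rw [← h, ← Nat.card_eq_fintype_card, Nat.card_coe_set_eq]
  congr 1
  ext x
  rw [mem_rootSet_of_ne hf.ne_zero]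
  rfl

/-- The cubic polynomial of the symmetric trees, with integral coefficients. -/
noncomputable def intCubic : ℤ[X] := X ^ 3 + C 5 * X ^ 2 + C 10 * X + C 10

theorem natDegree_intCubic : intCubic.natDegree = 3 := by
  unfold intCubic
  compute_degree!

theorem monic_intCubic : intCubic.Monic := by
  unfold intCubic
  monicity!

/-- Eisenstein's criterion at 5. -/
theorem irreducible_intCubic : Irreducible intCubic := by
  have hprime : (Ideal.span {(5 : ℤ)}).IsPrime :=
    (Ideal.span_singleton_prime (by norm_num)).2 (by norm_num)
  have hc : ∀ n, intCubic.coeff n = if n = 0 then 10 else if n = 1 then 10 else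
      if n = 2 then 5 else if n = 3 then 1 else 0 := by
    intro n
    rcases n with _ | _ | _ | _ | n <;> simp [intCubic, coeff_X, coeff_X_pow]
  refine irreducible_of_eisenstein_criterion hprime ?_ (fun n hn => ?_) ?_ ?_
    monic_intCubic.isPrimitive
  · rw [monic_intCubic.leadingCoeff, Ideal.mem_span_singleton]
    norm_num
  · rw [degree_eq_natDegree monic_intCubic.ne_zero, natDegree_intCubic, Nat.cast_lt] at hn
    rw [hc, Ideal.mem_span_singleton]
    interval_cases n <;> norm_num
  · rw [degree_eq_natDegree monic_intCubic.ne_zero, natDegree_intCubic]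
    norm_num
  · rw [hc, Ideal.span_singleton_pow, Ideal.mem_span_singleton]
    norm_num

/-- The monic integral polynomial with roots `18 * g`, where `g` is a root of `quinticEval`. -/
noncomputable def intQuintic : ℤ[X] :=
  X ^ 5 + C 45 * X ^ 4 + C (-1440) * X ^ 3 + C (-60840) * X ^ 2 + C 3052080 * X + C 111192912

theorem natDegree_intQuintic : intQuintic.natDegree = 5 := by
  unfold intQuintic
  compute_degree!

theorem monic_intQuintic : intQuintic.Monic := by
  unfold intQuintic
  monicity!

instance fact_prime_eleven : Fact (Nat.Prime 11) := ⟨by norm_num⟩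

theorem quintic_no_root_mod : ∀ x : ZMod 11,
    x ^ 5 + x ^ 4 + x ^ 3 + x ^ 2 + 9 * x + 6 ≠ 0 := by
  decide

/-- The two expressions are the coefficients of the remainder of the quintic modulo 11 on division
by x² + bx + c. -/
theorem quintic_no_quadratic_mod : ∀ b c : ZMod 11,
    ¬ (b ^ 4 - b ^ 3 - 3 * b ^ 2 * c + b ^ 2 + 2 * b * c - b + c ^ 2 - c + 9 = 0 ∧
      b ^ 3 * c - b ^ 2 * c - 2 * b * c ^ 2 + b * c + c ^ 2 - c + 6 = 0) := by
  decide

/-- Irreducibility may be tested modulo 11 since the polynomial is monic, and in degree 5 it is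
enough to exclude factors of degree 1 and 2. -/
theorem irreducible_intQuintic : Irreducible intQuintic := by
  refine monic_intQuintic.irreducible_of_irreducible_map (Int.castRingHom (ZMod 11)) _ ?_
  have hmap : intQuintic.map (Int.castRingHom (ZMod 11)) =
      X ^ 5 + X ^ 4 + X ^ 3 + X ^ 2 + C 9 * X + C 6 := by
    have h1 : ((45 : ℤ) : ZMod 11) = 1 := by decide
    have h2 : ((-1440 : ℤ) : ZMod 11) = 1 := by decide
    have h3 : ((-60840 : ℤ) : ZMod 11) = 1 := by decide
    have h4 : ((3052080 : ℤ) : ZMod 11) = 9 := by decide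
    have h5 : ((111192912 : ℤ) : ZMod 11) = 6 := by decide
    simp only [intQuintic, Polynomial.map_add, Polynomial.map_mul, Polynomial.map_pow, map_X,
      map_C, Int.coe_castRingHom, h1, h2, h3, h4, h5, C_1, one_mul]
  have hm : (intQuintic.map (Int.castRingHom (ZMod 11))).Monic := monic_intQuintic.map _
  have hdeg : (intQuintic.map (Int.castRingHom (ZMod 11))).natDegree = 5 := by
    rw [monic_intQuintic.natDegree_map, natDegree_intQuintic]
  rw [hm.irreducible_iff_lt_natDegree_lt (by
    intro h
    rw [h, natDegree_one] at hdeg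
    norm_num at hdeg)]
  rw [hdeg, hmap]
  intro q hq hqd hdvd
  have hq12 : q.natDegree = 1 ∨ q.natDegree = 2 := by
    rw [Finset.mem_Ioc] at hqd
    omega
  rcases hq12 with h1 | h2
  · have hqe := hq.eq_X_add_C h1
    have hroot : eval (-q.coeff 0) (X ^ 5 + X ^ 4 + X ^ 3 + X ^ 2 + C 9 * X + C 6 : (ZMod 11)[X])
        = 0 := by
      refine eval_eq_zero_of_dvd_of_eval_eq_zero hdvd ?_
      rw [hqe]
      simp
    refine quintic_no_root_mod (-q.coeff 0) ?_
    simpa only [eval_add, eval_pow, eval_X, eval_mul, eval_C] using hroot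
  · set b := q.coeff 1
    set c := q.coeff 0
    have hqe : q = X ^ 2 + C b * X + C c := by
      conv_lhs => rw [q.as_sum_range_C_mul_X_pow, h2]
      rw [Finset.sum_range_succ, Finset.sum_range_succ, Finset.sum_range_one]
      have : q.coeff 2 = 1 := by
        rw [← h2]
        exact hq
      rw [this]
      simp only [C_1, pow_zero, mul_one, pow_one, one_mul]
      ring
    set r1 := b ^ 4 - b ^ 3 - 3 * b ^ 2 * c + b ^ 2 + 2 * b * c - b + c ^ 2 - c + 9 with hr1
    set r0 := b ^ 3 * c - b ^ 2 * c - 2 * b * c ^ 2 + b * c + c ^ 2 - c + 6 with hr0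
    have hdiv : (X ^ 5 + X ^ 4 + X ^ 3 + X ^ 2 + C 9 * X + C 6 : (ZMod 11)[X]) =
        q * (X ^ 3 + C (1 - b) * X ^ 2 + C (b ^ 2 - b - c + 1) * X +
          C (-b ^ 3 + b ^ 2 + 2 * b * c - b - c + 1)) + (C r1 * X + C r0) := by
      rw [hqe, hr1, hr0]
      simp only [C_add, C_mul, C_sub, C_pow, C_neg, C_1, C_ofNat]
      ring
    have hrem : C r1 * X + C r0 = 0 := by
      rw [hdiv] at hdvd
      have h3 := (dvd_add_right (dvd_mul_right q _)).1 hdvd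
      refine eq_zero_of_dvd_of_natDegree_lt h3 ?_
      rw [h2]
      exact lt_of_le_of_lt natDegree_linear_le (by norm_num)
    refine quintic_no_quadratic_mod b c ⟨?_, ?_⟩
    · simpa using congrArg (fun f => coeff f 1) hrem
    · simpa using congrArg (fun f => coeff f 0) hrem

theorem aeval_intCubic (x : AlgNum) :
    aeval x (intCubic.map (algebraMap ℤ ℚ)) = cubicEval x := by
  simp only [aeval_map_algebraMap, intCubic, cubicEval, map_add, map_mul, map_pow, aeval_X,
    map_ofNat]

/-- The factor 11664 is 18⁵/162, where 162 is the leading coefficient of the quintic. -/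
theorem aeval_intQuintic (x : AlgNum) :
    aeval (18 * x) (intQuintic.map (algebraMap ℤ ℚ)) = 11664 * quinticEval x := by
  simp only [aeval_map_algebraMap, intQuintic, quinticEval, map_add, map_mul, map_pow, aeval_X,
    map_neg, map_ofNat]
  ring

theorem irreducible_ratCubic : Irreducible (intCubic.map (algebraMap ℤ ℚ)) :=
  (monic_intCubic.irreducible_iff_irreducible_map_fraction_map).1 irreducible_intCubic

theorem irreducible_ratQuintic : Irreducible (intQuintic.map (algebraMap ℤ ℚ)) :=
  (monic_intQuintic.irreducible_iff_irreducible_map_fraction_map).1 irreducible_intQuintic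

theorem exists_algEquiv_cubic {x y : AlgNum} (hx : cubicEval x = 0) (hy : cubicEval y = 0) :
    ∃ γ : AlgNum ≃ₐ[ℚ] AlgNum, γ x = y :=
  exists_algEquiv_of_irreducible irreducible_ratCubic (monic_intCubic.map _)
    (by rw [aeval_intCubic, hx]) (by rw [aeval_intCubic, hy])

theorem exists_algEquiv_quintic {x y : AlgNum} (hx : quinticEval x = 0) (hy : quinticEval y = 0) :
    ∃ γ : AlgNum ≃ₐ[ℚ] AlgNum, γ x = y := by
  obtain ⟨γ, h⟩ := exists_algEquiv_of_irreducible irreducible_ratQuintic (monic_intQuintic.map _)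
    (x := 18 * x) (y := 18 * y) (by rw [aeval_intQuintic, hx, mul_zero])
    (by rw [aeval_intQuintic, hy, mul_zero])
  refine ⟨γ, ?_⟩
  rw [map_mul, map_ofNat] at h
  exact mul_left_cancel₀ (by norm_num) h

theorem ncard_cubic : {x : AlgNum | cubicEval x = 0}.ncard = 3 := by
  simp only [← aeval_intCubic]
  rw [ncard_roots_of_irreducible irreducible_ratCubic, monic_intCubic.natDegree_map,
    natDegree_intCubic]

theorem ncard_quintic : {x : AlgNum | quinticEval x = 0}.ncard = 5 := by
  have h18 : (18 : AlgNum) ≠ 0 := by norm_num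
  rw [← Set.ncard_image_of_injective _ (mul_right_injective₀ h18)]
  have h : (fun x => 18 * x) '' {x : AlgNum | quinticEval x = 0} =
      {x : AlgNum | aeval x (intQuintic.map (algebraMap ℤ ℚ)) = 0} := by
    ext x
    have hx : 18 * (x / 18) = x := mul_div_cancel₀ x h18
    constructor
    · rintro ⟨y, hy, rfl⟩
      exact (aeval_intQuintic y).trans (by rw [show quinticEval y = 0 from hy, mul_zero])
    · intro h
      refine ⟨x / 18, ?_, hx⟩
      have h1 := aeval_intQuintic (x / 18)
      rw [hx, show aeval x _ = 0 from h] at h1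
      exact (mul_eq_zero.1 h1.symm).resolve_left (by norm_num)
  rw [h, ncard_roots_of_irreducible irreducible_ratQuintic, monic_intQuintic.natDegree_map,
    natDegree_intQuintic]

/-! ### The trees of the normal forms -/

/-- The multiplicities give 4 white and 7 black vertices, which is one more than the 10 edges, and
they also are the valencies of the type. -/
theorem exists_repTree_of_valid {β g : ℂ} (h : Valid β g) :
    ∃ r, IsTreeOf (normPoly β g) (repTree r) := by
  have hp := h.isShabat
  obtain ⟨T, hT⟩ := exists_isTreeOf hp h.natDegree_normPoly
    (by rw [h.rootMults_normPoly, h.rootMults_one_sub]; rfl)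
  obtain ⟨r, hr⟩ := isotopic_repTree T ((whiteValencies_eq hp hT).trans h.rootMults_normPoly)
    ((blackValencies_eq hp hT).trans h.rootMults_one_sub)
  exact ⟨r, IsTreeOf_of_isotopic hT hr⟩

theorem normPoly_neg (β g : ℂ) :
    normPoly (-β) g = (normPoly β g).comp (C (-1) * X + C 0) := by
  have hk : normConst (-β) g = normConst β g := by
    unfold normConst
    ring
  refine Polynomial.funext fun x => ?_
  simp [normPoly, normNum, normQuad, hk]

theorem lt_three_of_zero {g : ℂ} (h : Valid 0 g) {r : Fin 9}
    (hT : IsTreeOf (normPoly 0 g) (repTree r)) : r < 3 := by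
  have heven : normPoly 0 g = (normPoly 0 g).comp (C (-1) * X + C 0) := by
    rw [← normPoly_neg, neg_zero]
  obtain ⟨σ, hfix, hw, hb⟩ := exists_aut_of_even h.isShabat heven hT
  rcases (repTree_isotopic_rigid hw hb).2 with h0 | ⟨h3, -⟩
  · exact absurd h0 (hfix 0)
  · exact h3

/-- The multiple roots 1 and -1 are real, so complex conjugation gives a reflection of the tree that
fixes both vertices of valency 4. -/
theorem le_three_of_real {β g : ℂ} (h : Valid β g) (hβ : starRingEnd ℂ β = β)
    (hg : starRingEnd ℂ g = g) {r : Fin 9} (hT : IsTreeOf (normPoly β g) (repTree r)) : r ≤ 3 := by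
  have hreal : ∀ z, (normPoly β g).eval (starRingEnd ℂ z) =
      starRingEnd ℂ ((normPoly β g).eval z) := by
    intro z
    have h1 := normPoly_map (starRingEnd ℂ) β g
    rw [hβ, hg] at h1
    rw [← eval₂_at_apply, ← eval_map, h1]
  have hmult : ∀ v, 1 < (normPoly β g).rootMultiplicity v → starRingEnd ℂ v = v := by
    intro v hv
    by_cases h1 : v = 1 ∨ v = -1
    · rcases h1 with rfl | rfl <;> simp
    · have hroot := (rootMultiplicity_pos (IsShabat.ne_zero h.isShabat)).1 (zero_lt_one.trans hv)
      rw [h.rootMultiplicity_simple_root h1 hroot] at hv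
      exact absurd hv (lt_irrefl _)
  obtain ⟨σ, hw, hb, hc⟩ := exists_reflection_of_real h.isShabat hreal hT hmult
  exact repTree_reflection hw hb (hc 0 (show starWhite 0 ≠ 0 by decide +kernel))

/-- The `r`-th tree belongs to the parameter `g`. -/
def HasParam (g : AlgNum) (r : Fin 9) : Prop :=
  ∃ β : AlgNum, Valid β g ∧
    IsTreeOf (normPoly (algebraMap AlgNum ℂ β) (algebraMap AlgNum ℂ g)) (repTree r)

theorem exists_hasParam_of_valid {β g : AlgNum} (h : Valid β g) : ∃ r, HasParam g r := by
  obtain ⟨r, hr⟩ := exists_repTree_of_valid ((valid_map_iff (algebraMap AlgNum ℂ)).2 h)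
  exact ⟨r, β, h, hr⟩

theorem exists_hasParam {g : AlgNum}
    (h : cubicEval g = 0 ∨ 3 * g - 5 = 0 ∨ quinticEval g = 0) : ∃ r, HasParam g r := by
  obtain ⟨β, hβ⟩ := exists_valid h
  exact exists_hasParam_of_valid hβ

/-- Polynomials with the same tree are affinely equivalent, and g is an invariant of affine
equivalence of normal forms. -/
theorem HasParam.param_unique {g g' : AlgNum} {r : Fin 9} (h : HasParam g r)
    (h' : HasParam g' r) : g = g' := by
  obtain ⟨β, hv, hT⟩ := h
  obtain ⟨β', hv', hT'⟩ := h'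
  replace hv := (valid_map_iff (algebraMap AlgNum ℂ)).2 hv
  replace hv' := (valid_map_iff (algebraMap AlgNum ℂ)).2 hv'
  obtain ⟨a, b, ha, hcomp⟩ := exists_comp_of_isTreeOf hv.isShabat hv'.isShabat hT hT'
  exact ((algebraMap AlgNum ℂ).injective (hv.eq_of_comp hv' ha hcomp)).symm

/-- The other choice of β is its negative, which amounts to z ↦ -z and does not change the tree. -/
theorem HasParam.isTreeOf {g β : AlgNum} {r : Fin 9} (h : HasParam g r) (hv : Valid β g) :
    IsTreeOf (normPoly (algebraMap AlgNum ℂ β) (algebraMap AlgNum ℂ g)) (repTree r) := by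
  obtain ⟨β', hv', hT⟩ := h
  rcases hv'.sq_eq_sq hv with rfl | rfl
  · exact hT
  · rw [map_neg, normPoly_neg]
    exact isTreeOf_comp hT 0 (neg_ne_zero.2 one_ne_zero)

theorem HasParam.lt_three {g : AlgNum} {r : Fin 9} (h : HasParam g r) (hg : cubicEval g = 0) :
    r < 3 := by
  have hT := h.isTreeOf (valid_zero hg)
  rw [map_zero] at hT
  refine lt_three_of_zero (valid_zero ?_) hT
  rw [cubicEval_map, hg, map_zero]

/-- For g = 5/3 the equations give β² = 5/81 > 0, so β is real and the reflection argument applies.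
-/
theorem HasParam.le_three {g : AlgNum} {r : Fin 9} (h : HasParam g r) (hg : 3 * g - 5 = 0) :
    r ≤ 3 := by
  obtain ⟨β, hv, hT⟩ := h
  have hprod : (3 * g - 5) * quinticEval g = 0 := by rw [hg, zero_mul]
  have hβ : β ≠ 0 := fun h0 => cubicEval_ne_zero_of_product hprod (hv.eq_zero_iff.1 h0)
  have hg' : g = 5 / 3 := by linear_combination (1 / 3 : AlgNum) * hg
  have hsq := hv.sq_eq hβ
  rw [hg'] at hsq
  have hβ2 : β ^ 2 = 5 / 81 := by linear_combination (1 / 9216 : AlgNum) * hsq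
  have hβC : (algebraMap AlgNum ℂ β) ^ 2 = 5 / 81 := by
    rw [← map_pow, hβ2, map_div₀, map_ofNat, map_ofNat]
  have hgC : algebraMap AlgNum ℂ g = 5 / 3 := by
    rw [hg', map_div₀, map_ofNat, map_ofNat]
  refine le_three_of_real ((valid_map_iff (algebraMap AlgNum ℂ)).2 hv) ?_ ?_ hT
  · have h5 : ((Real.sqrt 5 / 9 : ℝ) : ℂ) ^ 2 = 5 / 81 := by
      rw [← Complex.ofReal_pow, div_pow, Real.sq_sqrt (by norm_num)]
      norm_num
    rcases sq_eq_sq_iff_eq_or_eq_neg.1 (hβC.trans h5.symm) with h | h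
    · rw [h, Complex.conj_ofReal]
    · rw [h, map_neg, Complex.conj_ofReal]
  · rw [hgC, map_div₀, map_ofNat, map_ofNat]

/-- If `s` is a set of parameters and `t` is a set of trees with as many elements which
contains all trees with parameters in `s`, then it contains no others. -/
theorem exists_hasParam_mem {s : Set AlgNum} {t : Set (Fin 9)} (hs : ∀ g ∈ s, ∃ r, HasParam g r)
    (hst : ∀ g ∈ s, ∀ r, HasParam g r → r ∈ t) (hcard : t.ncard ≤ s.ncard) {r : Fin 9}
    (hr : r ∈ t) : ∃ g ∈ s, HasParam g r := by
  choose! f hf using hs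
  -- Different parameters have different trees, and an injection into a finite set that is no larger
  -- is onto.
  have hinj : Set.InjOn f s := fun g hg g' hg' h => (hf g hg).param_unique (h ▸ hf g' hg')
  have himg : f '' s = t := by
    refine Set.eq_of_subset_of_ncard_le ?_ ?_ (Set.toFinite t)
    · rintro _ ⟨g, hg, rfl⟩
      exact hst g hg _ (hf g hg)
    · rw [hinj.ncard_image]
      exact hcard
  rw [← himg] at hr
  obtain ⟨g, hg, rfl⟩ := hr
  exact ⟨g, hg, hf g hg⟩

theorem exists_cubic_param {r : Fin 9} (hr : r < 3) : ∃ g, cubicEval g = 0 ∧ HasParam g r := by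
  refine exists_hasParam_mem (s := {g | cubicEval g = 0}) (t := {r | r < 3})
    (fun g hg => exists_hasParam (Or.inl hg)) (fun g hg r h => h.lt_three hg) ?_ hr
  rw [ncard_cubic, Set.ncard_eq_toFinset_card']
  exact le_of_eq (by decide)

/-- The three symmetric trees already belong to roots of the cubic, and 5/3 is not one of them. -/
theorem HasParam.eq_three {g : AlgNum} {r : Fin 9} (h : HasParam g r) (hg : 3 * g - 5 = 0) :
    r = 3 := by
  refine le_antisymm (h.le_three hg) (not_lt.1 fun hr => ?_)
  obtain ⟨g', hg', h'⟩ := exists_cubic_param hr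
  rw [h'.param_unique h] at hg'
  exact cubicEval_ne_zero_of_product (by rw [hg, zero_mul]) hg'

theorem special_param : 3 * (5 / 3 : AlgNum) - 5 = 0 := by norm_num

theorem hasParam_three : HasParam (5 / 3) 3 := by
  obtain ⟨r, hr⟩ := exists_hasParam (Or.inr (Or.inl special_param))
  rwa [← hr.eq_three special_param]

theorem HasParam.three_lt {g : AlgNum} {r : Fin 9} (h : HasParam g r) (hg : quinticEval g = 0) :
    3 < r := by
  by_contra hr
  rcases (not_lt.1 hr).lt_or_eq with hr | rfl
  · obtain ⟨g', hg', h'⟩ := exists_cubic_param hr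
    rw [h'.param_unique h] at hg'
    exact cubicEval_ne_zero_of_product (by rw [hg, mul_zero]) hg'
  · rw [h.param_unique hasParam_three, quinticEval] at hg
    norm_num at hg

theorem exists_quintic_param {r : Fin 9} (hr : 3 < r) :
    ∃ g, quinticEval g = 0 ∧ HasParam g r := by
  refine exists_hasParam_mem (s := {g | quinticEval g = 0}) (t := {r | 3 < r})
    (fun g hg => exists_hasParam (Or.inr (Or.inr hg))) (fun g hg r h => h.three_lt hg) ?_ hr
  rw [ncard_quintic, Set.ncard_eq_toFinset_card']
  exact le_of_eq (by decide)

/-! ### Galois orbits -/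

theorem mem_shabatPolynomials_rep_iff {p : ℂ[X]} {r : Fin 9} :
    p ∈ shabatPolynomials (⟦repTree r⟧ : TreeClass 10) ↔ IsShabat p ∧ IsTreeOf p (repTree r) := by
  constructor
  · rintro ⟨hp, T, hT, h⟩
    exact ⟨hp, IsTreeOf_of_isotopic h (Quotient.exact hT)⟩
  · rintro ⟨hp, h⟩
    exact ⟨hp, repTree r, rfl, h⟩

theorem mem_range_of_root {p : AlgNum[X]} (hp : p ≠ 0) {z : ℂ}
    (hz : (p.map (algebraMap AlgNum ℂ)).eval z = 0) : ∃ x, algebraMap AlgNum ℂ x = z := by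
  have h1 : z ∈ (p.map (algebraMap AlgNum ℂ)).roots :=
    (mem_roots ((Polynomial.map_ne_zero_iff (algebraMap AlgNum ℂ).injective).2 hp)).2 hz
  rw [(IsAlgClosed.splits p).roots_map] at h1
  obtain ⟨x, -, hx⟩ := Multiset.mem_map.1 h1
  exact ⟨x, hx⟩

/-- An affine substitution that relates polynomials with algebraic coefficients
has algebraic coefficients. -/
theorem exists_algebraic_comp {p q : AlgNum[X]} (hp : p ≠ 0) (h1 : q.eval 1 = 0)
    (h2 : q.eval (-1) = 0) {a b : ℂ} (ha : a ≠ 0)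
    (h : p.map (algebraMap AlgNum ℂ) = (q.map (algebraMap AlgNum ℂ)).comp (C a * X + C b)) :
    ∃ a' b' : AlgNum, a' ≠ 0 ∧ p = q.comp (C a' * X + C b') := by
  set f := algebraMap AlgNum ℂ
  have hroot : ∀ e : AlgNum, q.eval e = 0 → ∃ x, a * f x + b = f e := by
    intro e he
    obtain ⟨x, hx⟩ := mem_range_of_root (z := (f e - b) / a) hp (by
      rw [h]
      simp only [eval_comp, eval_add, eval_mul, eval_C, eval_X]
      rw [mul_div_cancel₀ _ ha, sub_add_cancel, eval_map_apply, he, map_zero])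
    refine ⟨x, ?_⟩
    rw [hx, mul_div_cancel₀ _ ha, sub_add_cancel]
  -- The points sent to 1 and -1 are roots of p and hence algebraic; they determine a and b.
  obtain ⟨x, hx⟩ := hroot 1 h1
  obtain ⟨y, hy⟩ := hroot (-1) h2
  rw [map_neg] at hy
  rw [map_one] at hx hy
  have hxy : a * f (x - y) = 2 := by
    rw [map_sub]
    linear_combination hx - hy
  have hxy0 : f (x - y) ≠ 0 := by
    intro h0
    rw [h0, mul_zero] at hxy
    norm_num at hxy
  have ha' : f (2 / (x - y)) = a := by
    rw [map_div₀, map_ofNat, div_eq_iff hxy0, hxy]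
  have hb' : f (1 - 2 / (x - y) * x) = b := by
    rw [map_sub, map_mul, ha', map_one]
    linear_combination -hx
  refine ⟨2 / (x - y), 1 - 2 / (x - y) * x, fun h0 => ha ?_, ?_⟩
  · rw [← ha', h0, map_zero]
  · apply map_injective f f.injective
    rw [h, map_comp, Polynomial.map_add, Polynomial.map_mul, map_C, map_X, map_C, ha', hb']

/-- Every algebraic Shabat polynomial of the tree is the normal form composed with an affine map
over the algebraic numbers. So γ sends it to an affine transform of the normal form with parameters
γ(β), γ(g), and the orbit is governed by g alone. -/
theorem mem_galoisOrbit_iff {g : AlgNum} {r : Fin 9} (h : HasParam g r) (y : TreeClass 10) :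
    y ∈ galoisOrbit (⟦repTree r⟧ : TreeClass 10) ↔
      ∃ (γ : AlgNum ≃ₐ[ℚ] AlgNum) (r' : Fin 9), HasParam (γ g) r' ∧ ⟦repTree r'⟧ = y := by
  obtain ⟨β, hv, hT⟩ := h
  have hvC := (valid_map_iff (algebraMap AlgNum ℂ)).2 hv
  have hvγ : ∀ γ : AlgNum ≃ₐ[ℚ] AlgNum, Valid (γ β) (γ g) := fun γ =>
    (valid_map_iff (γ : AlgNum →+* AlgNum)).2 hv
  constructor
  · rintro ⟨γ, p, hp, hy⟩
    obtain ⟨hpS, hpT⟩ := mem_shabatPolynomials_rep_iff.1 hp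
    obtain ⟨hyS, T, rfl, hyT⟩ := hy
    obtain ⟨a, b, ha, hcomp⟩ := exists_comp_of_isTreeOf hvC.isShabat hpS hT hpT
    rw [← normPoly_map] at hcomp
    obtain ⟨a', b', ha', hpe⟩ := exists_algebraic_comp
      (fun h0 => IsShabat.ne_zero hpS (by rw [h0, Polynomial.map_zero]))
      (by simp [normPoly, normNum]) (by simp [normPoly, normNum]) ha hcomp
    obtain ⟨r', hr'⟩ := exists_hasParam_of_valid (hvγ γ)
    refine ⟨γ, r', hr', Quotient.sound ?_⟩
    refine isotopic_of_isTreeOf hyS ?_ hyT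
    rw [hpe, map_comp, normPoly_map, map_comp, normPoly_map]
    simp only [Polynomial.map_add, Polynomial.map_mul, map_C, map_X]
    refine isTreeOf_comp (hr'.isTreeOf (hvγ γ)) _ ?_
    rw [ne_eq, map_eq_zero, map_eq_zero]
    exact ha'
  · rintro ⟨γ, r', hr', rfl⟩
    refine ⟨γ, normPoly β g, ?_, ?_⟩
    · rw [normPoly_map]
      exact mem_shabatPolynomials_rep_iff.2 ⟨hvC.isShabat, hT⟩
    · rw [normPoly_map, normPoly_map]
      exact mem_shabatPolynomials_rep_iff.2
        ⟨((valid_map_iff (algebraMap AlgNum ℂ)).2 (hvγ γ)).isShabat, hr'.isTreeOf (hvγ γ)⟩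

/-- The trees with parameters in a set which is a Galois orbit form a Galois orbit. -/
theorem isGaloisOrbit_of_params {s : Set AlgNum} {t : Set (Fin 9)} (ht : t.Nonempty)
    (hmap : ∀ g ∈ s, ∀ γ : AlgNum ≃ₐ[ℚ] AlgNum, γ g ∈ s)
    (htrans : ∀ g ∈ s, ∀ g' ∈ s, ∃ γ : AlgNum ≃ₐ[ℚ] AlgNum, γ g = g')
    (hst : ∀ g ∈ s, ∀ r, HasParam g r → r ∈ t) (hts : ∀ r ∈ t, ∃ g ∈ s, HasParam g r) :
    IsGaloisOrbit ((fun r => (⟦repTree r⟧ : TreeClass 10)) '' t) t.ncard := by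
  refine ⟨ht.image _, Set.ncard_image_of_injective _ repTree_injective, ?_⟩
  rintro _ ⟨r, hr, rfl⟩
  obtain ⟨g, hg, h⟩ := hts r hr
  ext y
  rw [mem_galoisOrbit_iff h]
  constructor
  · rintro ⟨γ, r', hr', rfl⟩
    exact ⟨r', hst _ (hmap g hg γ) r' hr', rfl⟩
  · rintro ⟨r', hr', rfl⟩
    obtain ⟨g', hg', h'⟩ := hts r' hr'
    obtain ⟨γ, rfl⟩ := htrans g hg g' hg'
    exact ⟨γ, r', h', rfl⟩

/-! ### The special tree is rational -/

theorem normConst_special {β : ℂ} (h : β ^ 2 = 5 / 81) :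
    normConst β (5 / 3) = 16384 / 6561 := by
  have h4 : β ^ 4 = 25 / 6561 := by
    rw [show β ^ 4 = (β ^ 2) ^ 2 by ring, h]
    norm_num
  unfold normConst
  rw [h4, h]
  norm_num

/-- The normal form with g = 5/3 has irrational β. The substitution x = z/l with l² = 500/441 and β
= 50/(189 l) makes 10βl and (7/3)l² both equal to 500/189, so all coefficients become rational; the
critical value is multiplied by l¹⁰ = (500/441)⁵. -/
theorem mem_shabatPolynomials_special :
    (C ((500 / 441 : ℚ) ^ 5 * (16384 / 6561))⁻¹ *
      ((X ^ 2 - C (500 / 441)) ^ 4 * (X ^ 2 + C (500 / 189) * X + C (500 / 189)))).map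
        (algebraMap ℚ ℂ) ∈ shabatPolynomials (⟦repTree 3⟧ : TreeClass 10) := by
  obtain ⟨l, hl⟩ := IsAlgClosed.exists_pow_nat_eq (500 / 441 : AlgNum) two_pos
  have hl0 : l ≠ 0 := by
    rintro rfl
    norm_num at hl
  have hβ : (50 / (189 * l)) ^ 2 = 5 / 81 := by
    rw [div_pow, mul_pow, hl]
    norm_num
  have hv : Valid (50 / (189 * l)) (5 / 3 : AlgNum) := by
    refine valid_of_sq_eq (by norm_num) (by rw [special_param, zero_mul]) ?_
    rw [hβ]
    norm_num
  have hvC := (valid_map_iff (algebraMap AlgNum ℂ)).2 hv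
  have hT := hasParam_three.isTreeOf hv
  have hβC : (algebraMap AlgNum ℂ (50 / (189 * l))) ^ 2 = 5 / 81 := by
    rw [← map_pow, hβ, map_div₀, map_ofNat, map_ofNat]
  have hgC : algebraMap AlgNum ℂ (5 / 3) = 5 / 3 := by
    rw [map_div₀, map_ofNat, map_ofNat]
  have hlC : (algebraMap AlgNum ℂ l) ^ 2 = 500 / 441 := by
    rw [← map_pow, hl, map_div₀, map_ofNat, map_ofNat]
  have hβl : algebraMap AlgNum ℂ (50 / (189 * l)) = 50 / (189 * algebraMap AlgNum ℂ l) := by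
    rw [map_div₀, map_mul, map_ofNat, map_ofNat]
  rw [hgC] at hvC hT
  set L := algebraMap AlgNum ℂ l with hL
  set B := algebraMap AlgNum ℂ (50 / (189 * l))
  have hL0 : L ≠ 0 := by
    rw [hL, ne_eq, map_eq_zero]
    exact hl0
  have hLinv : L⁻¹ ^ 2 = 441 / 500 := by
    rw [inv_pow, hlC]
    norm_num
  have hBL : B * L⁻¹ = 7 / 30 := by
    rw [hβl, div_mul_eq_mul_div, div_eq_iff (mul_ne_zero (by norm_num) hL0)]
    field_simp
    linear_combination (-1323 : ℂ) * hlC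
  have heq : (C ((500 / 441 : ℚ) ^ 5 * (16384 / 6561))⁻¹ *
      ((X ^ 2 - C (500 / 441)) ^ 4 * (X ^ 2 + C (500 / 189) * X + C (500 / 189)))).map
        (algebraMap ℚ ℂ) = (normPoly B (5 / 3)).comp (C L⁻¹ * X + C 0) := by
    refine Polynomial.funext fun x => ?_
    simp only [Polynomial.map_mul, Polynomial.map_pow, Polynomial.map_sub, Polynomial.map_add,
      map_C, map_X, eval_mul, eval_pow, eval_sub, eval_add, eval_C, eval_X, eval_comp, normPoly,
      normNum, normQuad, eval_one, normConst_special hβC, map_inv₀, map_mul, map_pow, map_div₀,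
      map_ofNat, add_zero, eval_ofNat]
    rw [mul_pow, hLinv, show 10 * B * (L⁻¹ * x) = 10 * (B * L⁻¹) * x by ring, hBL]
    ring
  rw [heq, mem_shabatPolynomials_rep_iff]
  exact ⟨isShabat_comp hvC.isShabat (inv_ne_zero hL0), isTreeOf_comp hT 0 (inv_ne_zero hL0)⟩

theorem isRationalTree_of_rational {n : ℕ} {x : TreeClass n} {p : ℚ[X]}
    (h : p.map (algebraMap ℚ ℂ) ∈ shabatPolynomials x) : IsRationalTree x := by
  refine ⟨⟨p.map (algebraMap ℚ (⊥ : IntermediateField ℚ ℂ)), ?_⟩, fun _ _ => bot_le⟩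
  rw [Polynomial.map_map, ← IsScalarTower.algebraMap_eq]
  exact h

/-! ### The three Galois orbits -/

theorem isGaloisOrbit_symm :
    IsGaloisOrbit ((fun r => (⟦repTree r⟧ : TreeClass 10)) '' {r | r < 3}) 3 := by
  have hcard : {r : Fin 9 | r < 3}.ncard = 3 := by
    rw [Set.ncard_eq_toFinset_card']
    decide
  rw [← hcard]
  exact isGaloisOrbit_of_params (s := {g | cubicEval g = 0}) ⟨0, by decide⟩
    (fun g hg γ => by
      have h := cubicEval_map (γ : AlgNum →+* AlgNum) g
      rw [show cubicEval g = 0 from hg, map_zero] at h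
      exact h)
    (fun g hg g' hg' => exists_algEquiv_cubic hg hg') (fun g hg r h => h.lt_three hg)
    (fun r hr => exists_cubic_param hr)

theorem isGaloisOrbit_special :
    IsGaloisOrbit ((fun r => (⟦repTree r⟧ : TreeClass 10)) '' {3}) 1 := by
  rw [← Set.ncard_singleton (3 : Fin 9)]
  refine isGaloisOrbit_of_params (s := {5 / 3}) ⟨3, rfl⟩ ?_ ?_ ?_ ?_
  · rintro _ rfl γ
    rw [map_div₀, map_ofNat, map_ofNat]
    rfl
  · rintro _ rfl _ rfl
    exact ⟨AlgEquiv.refl, rfl⟩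
  · rintro _ rfl r h
    exact h.eq_three special_param
  · rintro _ rfl
    exact ⟨_, rfl, hasParam_three⟩

theorem isGaloisOrbit_generic :
    IsGaloisOrbit ((fun r => (⟦repTree r⟧ : TreeClass 10)) '' {r | 3 < r}) 5 := by
  have hcard : {r : Fin 9 | 3 < r}.ncard = 5 := by
    rw [Set.ncard_eq_toFinset_card']
    decide
  rw [← hcard]
  exact isGaloisOrbit_of_params (s := {g | quinticEval g = 0}) ⟨4, by decide⟩
    (fun g hg γ => by
      have h := quinticEval_map (γ : AlgNum →+* AlgNum) g
      rw [show quinticEval g = 0 from hg, map_zero] at h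
      exact h)
    (fun g hg g' hg' => exists_algEquiv_quintic hg hg') (fun g hg r h => h.three_lt hg)
    (fun r hr => exists_quintic_param hr)

end Shabat

/-! ### The theorem, with S, x₀, R given by r < 3, r = 3, r > 3 -/

theorem mainTheorem4 :
    (treeType 10 {4, 4, 1, 1} {2, 2, 2, 1, 1, 1, 1}).ncard = 9 ∧
    ∃ (S : Set (TreeClass 10)) (x₀ : TreeClass 10) (R : Set (TreeClass 10)),
      treeType 10 {4, 4, 1, 1} {2, 2, 2, 1, 1, 1, 1} = S ∪ {x₀} ∪ R ∧
      Disjoint S {x₀} ∧ Disjoint (S ∪ {x₀}) R ∧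
      -- the three 2-symmetric trees
      (∀ T : PlaneTree 10, ⟦T⟧ ∈ treeType 10 {4, 4, 1, 1} {2, 2, 2, 1, 1, 1, 1} →
        (T.IsSymmetric 2 ↔ ⟦T⟧ ∈ S)) ∧
      S = {x | IsDoubleStar 2 6 x ∨ IsDoubleStar 3 7 x ∨ IsDoubleStar 1 5 x} ∧
      IsGaloisOrbit S 3 ∧
      (∀ T : PlaneTree 10, ⟦T⟧ ∈ S → Nat.card T.rotationGroup = 3840) ∧
      -- the special tree
      IsDoubleStar 1 3 x₀ ∧
      IsRationalTree x₀ ∧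
      IsRationalShabatPolynomial
        ((X ^ 2 - C (500 / 441)) ^ 4 * (X ^ 2 + C (500 / 189) * X + C (500 / 189))) x₀ ∧
      IsGaloisOrbit {x₀} 1 ∧
      (∀ T : PlaneTree 10, ⟦T⟧ = x₀ →
        T.IsSpecial ∧ Nat.card T.rotationGroup = 1440) ∧
      -- the remaining five trees
      IsGaloisOrbit R 5 ∧
      (∀ T : PlaneTree 10, ⟦T⟧ ∈ R → T.rotationGroup = ⊤) := by
  refine ⟨Shabat.ncard_treeType, (fun r => ⟦Shabat.repTree r⟧) '' {r | r < 3},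
    ⟦Shabat.repTree 3⟧, (fun r => ⟦Shabat.repTree r⟧) '' {r | 3 < r}, ?_, ?_, ?_, ?_, ?_,
    Shabat.isGaloisOrbit_symm, ?_, (Shabat.isDoubleStar_rep_iff 3 _).2 rfl,
    Shabat.isRationalTree_of_rational Shabat.mem_shabatPolynomials_special,
    ⟨_, by norm_num, Shabat.mem_shabatPolynomials_special⟩, ?_, ?_,
    Shabat.isGaloisOrbit_generic, ?_⟩
  · rw [Shabat.treeType_eq_range, ← Set.image_univ,
      ← Set.image_singleton (f := fun r => (⟦Shabat.repTree r⟧ : TreeClass 10)), ← Set.image_union,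
      ← Set.image_union]
    congr 1
    ext r
    simp only [Set.mem_univ, Set.mem_union, Set.mem_ofPred_eq, Set.mem_singleton_iff, true_iff]
    revert r
    decide
  · rw [Set.disjoint_singleton_right]
    rintro ⟨r, hr, h⟩
    rw [Shabat.repTree_injective h] at hr
    exact lt_irrefl (3 : Fin 9) hr
  · rw [Set.disjoint_left]
    rintro _ (⟨r, hr, rfl⟩ | rfl) ⟨r', hr', h⟩
    · rw [Shabat.repTree_injective h] at hr'
      exact lt_asymm (show r < 3 from hr) hr'
    · rw [Shabat.repTree_injective (a₂ := 3) h] at hr'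
      exact lt_irrefl (3 : Fin 9) hr'
  · intro T hT
    rw [Shabat.treeType_eq_range] at hT
    obtain ⟨r, hr⟩ := hT
    rw [← Shabat.isSymmetric_iff_of_isotopic (Quotient.exact hr), Shabat.repTree_isSymmetric_iff,
      ← hr]
    exact ⟨fun h => ⟨r, h, rfl⟩, fun ⟨r', hr', h⟩ => Shabat.repTree_injective h ▸ hr'⟩
  · ext x
    have h0 := Shabat.isDoubleStar_rep_iff 0 x
    have h1 := Shabat.isDoubleStar_rep_iff 1 x
    have h2 := Shabat.isDoubleStar_rep_iff 2 x
    change _ ↔ IsDoubleStar (Shabat.starPos 0).1 (Shabat.starPos 0).2 x ∨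
      IsDoubleStar (Shabat.starPos 1).1 (Shabat.starPos 1).2 x ∨
      IsDoubleStar (Shabat.starPos 2).1 (Shabat.starPos 2).2 x
    rw [h0, h1, h2]
    constructor
    · rintro ⟨r, hr, rfl⟩
      have hr' : r = 0 ∨ r = 1 ∨ r = 2 := by
        have key : ∀ r : Fin 9, r < 3 → r = 0 ∨ r = 1 ∨ r = 2 := by decide
        exact key r hr
      rcases hr' with rfl | rfl | rfl
      · exact Or.inl rfl
      · exact Or.inr (Or.inl rfl)
      · exact Or.inr (Or.inr rfl)
    · rintro (rfl | rfl | rfl)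
      · exact ⟨0, by decide, rfl⟩
      · exact ⟨1, by decide, rfl⟩
      · exact ⟨2, by decide, rfl⟩
  · rintro T ⟨r, hr, h⟩
    rw [Shabat.card_rotationGroup_eq (Quotient.exact h), Shabat.card_rotationGroup_symm hr]
  · have h := Shabat.isGaloisOrbit_special
    rwa [Set.image_singleton] at h
  · intro T hT
    have h := Quotient.exact hT.symm
    have hcard : Nat.card T.rotationGroup = 1440 := by
      rw [Shabat.card_rotationGroup_eq h, Shabat.card_rotationGroup_special]
    refine ⟨⟨Shabat.isPreprimitive_of_isotopic h Shabat.isPreprimitive_special, ?_⟩, hcard⟩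
    rw [hcard]
    decide
  · rintro T ⟨r, hr, h⟩
    exact Shabat.rotationGroup_eq_top_of_isotopic (Quotient.exact h)
      (Shabat.rotationGroup_eq_top hr)
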